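/- Let $\mathbb R^3_1$ be Lorentz–Minkowski space with signature $(-,+,+)$, let $S^2=\mathbb C\cup\{\infty\}$, and let $f:S^2\setminus\{p_1,\dots,p_N\}\to\mathbb R^3_1$ be a maxface, i.e. a $C^\infty$ map that is a conformal space-like immersion of zero mean curvature on an open dense subset and satisfies $df\neq 0$ everywhere. Locally $f=\mathrm{Re}\,F$ with $F=(F_0,F_1,F_2)$ holomorphic; put $g=-\dfrac{dF_0}{dF_1-i\,dF_2}$ (the Gauss map) and $\omega=\frac12(dF_1-i\,dF_2)$. A singular point $p$ of $f$ (a point where $f$ is not an immersion) is called a fold singularity if $dg(p)\ne0$ and $\mathrm{Re}\big(dg/(g^2\omega)\big)=0$ at all singular points near $p$. An umbilic is a point at which $f$ is an immersion and the second fundamental form is a multiple of the first. Suppose that $f$ is a Kobayashi surface, that is: $f$ is weakly complete (the metric $ds_E^2=(1+|g|^2)^2|\omega|^2$ is complete on $S^2\setminus\{p_1,\dots,p_N\}$); $g$ has at most poles at $p_1,\dots,p_N$; and there is an anti-holomorphic involution $I:S^2\to S^2$ with $f\circ I=f$ such that all $p_j$ are fixed points of $I$, the fixed points of $I$ other than $p_1,\dots,p_N$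 are exactly the fold singularities of $f$, and $f$ has no singular points outside the fixed-point set of $I$. If $f$ has at most two umbilics, then there exist an integer $n\ge2$ and real numbers $0=\alpha_0\le\alpha_1\le\dots\le\alpha_{2n-1}<2\pi$ such that the pair $$g=z^{n-1},\qquad \omega=\frac{i\Lambda\,dz}{\prod_{j=0}^{2n-1}(z-e^{i\alpha_j})},\qquad \Lambda=\exp\Big(i\,\frac{\alpha_0+\dots+\alpha_{2n-1}}2\Big),$$ is a Weierstrass data of fold-type on $S^2$ and $f$ is homothetic to a single-valued maxface $f_0=\mathrm{Re}\int(-2g,\,1+g^2,\,i(1-g^2))\,\omega$ associated to it on $S^2$ minus its ends. Here: $(g,\omega)$ (a meromorphic function and a meromorphic $1$-form on $S^2$) is a Weierstrass data on $S^2$ if $(1+|g|^2)^2|\omega|^2$ has no zeros; its ends are the poles of $\omega$, $g\omega$, $g^2\omega$; it is of fold-type if all its ends lie on the unit circle $S^1$, $|g(z)|=1$ holds if and only if $z\in S^1$, and $\mathrm{Re}[dg/(g^2\omega)]$ vanishes identically on $S^1$. "Homothetic" means that there are a biholomorphic map $\varphi$ of $S^2$ carrying the punctures of $f$ onto the ends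 of $(g,\omega)$, a number $c>0$, a linear isometry $T$ of $\mathbb R^3_1$ and a vector $v$ with $f_0\circ\varphi=c\,Tf+v$. -/

import Mathlib

open Filter Topology Set
open scoped OnePoint ComplexConjugate

noncomputable section

namespace Maxface

/-! ### The Riemann sphere and its coordinates -/

/-- The Riemann sphere `ℂ ∪ {∞}`, with the topology of the one-point compactification. -/
abbrev Sphere : Type := OnePoint ℂ

/-- Lorentz-Minkowski 3-space: triples `(t, x, y)`; the scalar product is `lorentz`. -/
abbrev R31 : Type := Fin 3 → ℝ

/-- The Lorentzian scalar product of signature `(-, +, +)`. -/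
def lorentz (x y : R31) : ℝ := -(x 0 * y 0) + x 1 * y 1 + x 2 * y 2

/-- The parametrization (inverse chart) used at `p`: `w ↦ w` at a finite point,
`w ↦ 1 / w` (with `0 ↦ ∞`) at `∞`. -/
def paramAt (p : Sphere) (w : ℂ) : Sphere :=
  p.elim (if w = 0 then ∞ else ((w⁻¹ : ℂ) : Sphere)) (fun _ => (w : Sphere))

/-- The chart used at `p`: `q ↦ q` at a finite point, `q ↦ 1 / q` (with `∞ ↦ 0`) at `∞`.
(Outside the chart domain the value is `0`.) -/
def chartFn (p : Sphere) (q : Sphere) : ℂ :=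
  p.elim (q.elim 0 (fun z => z⁻¹)) (fun _ => q.elim 0 (fun z => z))

/-- The coordinate of `p` itself in the chart used at `p`. -/
def coordAt (p : Sphere) : ℂ := chartFn p p

/-- `φ : S² → S²` is holomorphic. -/
def IsHolo (φ : Sphere → Sphere) : Prop :=
  ∀ p, ContinuousAt φ p ∧
    DifferentiableAt ℂ (fun w => chartFn (φ p) (φ (paramAt p w))) (coordAt p)

/-- `φ : S² → S²` is anti-holomorphic. -/
def IsAntiHolo (φ : Sphere → Sphere) : Prop :=
  ∀ p, ContinuousAt φ p ∧
    DifferentiableAt ℂ (fun w => conj (chartFn (φ p) (φ (paramAt p w)))) (coordAt p)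

/-! ### Surfaces in a coordinate `w = x + i y` -/

/-- Directional derivative `∂_a u` of a map on the coordinate plane. -/
def dd (u : ℂ → R31) (a : ℂ) (w : ℂ) : R31 := fderiv ℝ u w a

/-- Coefficients of the first fundamental form. -/
def ffE (u : ℂ → R31) (w : ℂ) : ℝ := lorentz (dd u 1 w) (dd u 1 w)
def ffF (u : ℂ → R31) (w : ℂ) : ℝ := lorentz (dd u 1 w) (dd u Complex.I w)
def ffG (u : ℂ → R31) (w : ℂ) : ℝ := lorentz (dd u Complex.I w) (dd u Complex.I w)

/-- The normal vector `u_x × u_y` (Lorentzian vector product): it is Lorentz-orthogonal to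
`u_x` and `u_y`. It is not normalized, which is irrelevant for the notions below. -/
def normalVec (u : ℂ → R31) (w : ℂ) : R31 :=
  let a := dd u 1 w
  let b := dd u Complex.I w
  ![-(a 1 * b 2 - a 2 * b 1), a 2 * b 0 - a 0 * b 2, a 0 * b 1 - a 1 * b 0]

/-- Coefficients of the second fundamental form (with respect to `normalVec`). -/
def sfL (u : ℂ → R31) (w : ℂ) : ℝ := lorentz (dd (dd u 1) 1 w) (normalVec u w)
def sfM (u : ℂ → R31) (w : ℂ) : ℝ := lorentz (dd (dd u 1) Complex.I w) (normalVec u w)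
def sfN (u : ℂ → R31) (w : ℂ) : ℝ :=
  lorentz (dd (dd u Complex.I) Complex.I w) (normalVec u w)

/-- At `w` the map `u` is a conformal space-like immersion with vanishing mean curvature
`(E N - 2 F M + G L) / (2 (E G - F²))`. -/
def IsConformalMaximalAt (u : ℂ → R31) (w : ℂ) : Prop :=
  0 < ffE u w ∧ ffE u w = ffG u w ∧ ffF u w = 0 ∧
    ffE u w * sfN u w - 2 * ffF u w * sfM u w + ffG u w * sfL u w = 0

/-- The coefficients `φ_k` of `dF_k = φ_k dw`, where `u = Re F`: if `F = u + i v` is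
holomorphic then `F' = u_x - i u_y` by the Cauchy-Riemann equations. -/
def liftDeriv (u : ℂ → R31) (k : Fin 3) (w : ℂ) : ℂ :=
  (dd u 1 w k : ℂ) - Complex.I * (dd u Complex.I w k : ℂ)

/-- The Gauss map `g = - dF₀ / (dF₁ - i dF₂)` in the coordinate `w`
(with value `0` at its poles). -/
def gaussLoc (u : ℂ → R31) (w : ℂ) : ℂ :=
  -(liftDeriv u 0 w) / (liftDeriv u 1 w - Complex.I * liftDeriv u 2 w)

/-- The coefficient of `ω = (dF₁ - i dF₂) / 2` in the coordinate `w`. -/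
def omegaLoc (u : ℂ → R31) (w : ℂ) : ℂ :=
  (liftDeriv u 1 w - Complex.I * liftDeriv u 2 w) / 2

/-- The density of `ds_E = (1 + |g|²) |ω| = |ω| + |g² ω|` with respect to `|dw|`. Since
`g² ω = (dF₁ + i dF₂) / 2`, it is written here without division, so that the value is also
the right one at poles of `g`. -/
def densityE (u : ℂ → R31) (w : ℂ) : ℝ :=
  (‖liftDeriv u 1 w - Complex.I * liftDeriv u 2 w‖ +
    ‖liftDeriv u 1 w + Complex.I * liftDeriv u 2 w‖) / 2

/-! ### Maxfaces on the punctured sphere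

A map on `S² \ E` is given by a function on `S²` whose values on `E` are never used. -/

/-- The local expression of `f` in the chart used at `p`. -/
def loc (f : Sphere → R31) (p : Sphere) (w : ℂ) : R31 := f (paramAt p w)

/-- `p` is a singular point: `f` is not an immersion at `p`. -/
def IsSingular (f : Sphere → R31) (p : Sphere) : Prop :=
  ¬ Function.Injective (fderiv ℝ (loc f p) (coordAt p))

/-- `f : S² \ E → ℝ³₁` is a maxface: it is smooth, it is a conformal space-like immersion of
zero mean curvature on an open dense subset, and it has no branch points. -/
structure IsMaxface (f : Sphere → R31) (E : Set Sphere) : Prop where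
  smooth : ∀ p ∉ E, ContDiffAt ℝ ((⊤ : ℕ∞) : WithTop ℕ∞) (loc f p) (coordAt p)
  maximal : ∃ W : Set Sphere, IsOpen W ∧ W ⊆ Eᶜ ∧ Eᶜ ⊆ closure W ∧
    ∀ p ∈ W, IsConformalMaximalAt (loc f p) (coordAt p)
  no_branch : ∀ p ∉ E, fderiv ℝ (loc f p) (coordAt p) ≠ 0

/-- `γ : [0, 1) → S² \ E` is a `C¹` path. -/
def IsC1Path (E : Set Sphere) (γ : ℝ → Sphere) : Prop :=
  ∀ t ∈ Ico (0 : ℝ) 1, γ t ∉ E ∧ ContinuousAt γ t ∧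
    ContDiffAt ℝ 1 (fun s => chartFn (γ t) (γ s)) t

/-- `γ` leaves every compact subset of `S² \ E` as `t → 1`. -/
def IsDivergent (E : Set Sphere) (γ : ℝ → Sphere) : Prop :=
  ∀ K : Set Sphere, IsCompact K → K ⊆ Eᶜ → ∀ᶠ t in 𝓝[<] (1 : ℝ), γ t ∉ K

/-- The length of `γ : [0, 1) → S² \ E` with respect to `ds_E`. -/
def lengthE (f : Sphere → R31) (γ : ℝ → Sphere) : ENNReal :=
  ∫⁻ t in Ico (0 : ℝ) 1, ENNReal.ofReal
    (densityE (loc f (γ t)) (coordAt (γ t)) * ‖deriv (fun s => chartFn (γ t) (γ s)) t‖)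

/-- The metric `ds_E²` is complete on `S² \ E`: every divergent path has infinite length. -/
def IsWeaklyComplete (f : Sphere → R31) (E : Set Sphere) : Prop :=
  ∀ γ : ℝ → Sphere, IsC1Path E γ → IsDivergent E γ → lengthE f γ = ⊤

/-- `p` is a fold singularity: it is a singular point with `dg(p) ≠ 0`, and
`Re (dg / (g² ω))` vanishes at all singular points near `p`. -/
def IsFold (f : Sphere → R31) (p : Sphere) : Prop :=
  IsSingular f p ∧ deriv (gaussLoc (loc f p)) (coordAt p) ≠ 0 ∧
    ∀ᶠ w in 𝓝 (coordAt p), ¬ Function.Injective (fderiv ℝ (loc f p) w) →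
      (deriv (gaussLoc (loc f p)) w /
        (gaussLoc (loc f p) w ^ 2 * omegaLoc (loc f p) w)).re = 0

/-- `p` is an umbilic: `f` is an immersion at `p` and the second fundamental form is a multiple
of the first one at `p`. -/
def IsUmbilic (f : Sphere → R31) (p : Sphere) : Prop :=
  ¬ IsSingular f p ∧ ∃ c : ℝ,
    sfL (loc f p) (coordAt p) = c * ffE (loc f p) (coordAt p) ∧
    sfM (loc f p) (coordAt p) = c * ffF (loc f p) (coordAt p) ∧
    sfN (loc f p) (coordAt p) = c * ffG (loc f p) (coordAt p)

/-- `f : S² \ E → ℝ³₁` is a Kobayashi surface with set of ends `E`: a weakly complete maxface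
whose Gauss map has at most poles at `E`, which is invariant under an anti-holomorphic
involution `I` of the sphere whose fixed-point set contains the ends and is (away from the ends)
the set of fold singularities, and which has no other singularities. -/
structure IsKobayashi (f : Sphere → R31) (E : Finset Sphere) : Prop where
  maxface : IsMaxface f E
  complete : IsWeaklyComplete f E
  gauss : ∀ p ∈ E, MeromorphicAt (gaussLoc (loc f p)) (coordAt p)
  symm : ∃ I : Sphere → Sphere, IsAntiHolo I ∧ (∀ p, I (I p) = p) ∧
    (∀ p ∉ E, f (I p) = f p) ∧
    (∀ p ∈ E, I p = p) ∧
    (∀ p ∉ E, I p = p ↔ IsFold f p) ∧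
    (∀ p ∉ E, I p ≠ p → ¬ IsSingular f p)

/-- `f` on `S² \ E` is homothetic to `f'` on `S² \ E'`: up to a biholomorphic change of
parameter, `f'` is obtained from `f` by an isometry `x ↦ T x + v` of Lorentz-Minkowski space and
a homothety with factor `c > 0`. -/
def Homothetic (f : Sphere → R31) (E : Set Sphere) (f' : Sphere → R31) (E' : Set Sphere) :
    Prop :=
  ∃ (φ : Sphere ≃ Sphere) (c : ℝ) (T : R31 →ₗ[ℝ] R31) (v : R31),
    IsHolo φ ∧ IsHolo φ.symm ∧ (∀ p, p ∈ E ↔ φ p ∈ E') ∧ 0 < c ∧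
    (∀ x y, lorentz (T x) (T y) = lorentz x y) ∧
    ∀ p ∉ E, f' (φ p) = c • T (f p) + v

/-! ### Weierstrass data on the sphere

`g` and `h` are functions of the coordinate `z ∈ ℂ`, and `ω = h dz`. -/

/-- The coefficient of the 1-form `h dz` in the chart used at `p`
(at `∞`, with `z = 1 / w`, one has `dz = - dw / w²`). -/
def formCoeff (p : Sphere) (h : ℂ → ℂ) : ℂ → ℂ :=
  p.elim (fun w => -(h w⁻¹) / w ^ 2) (fun _ => h)

/-- The order at `p` of the meromorphic 1-form `h dz`. -/
def formOrder (p : Sphere) (h : ℂ → ℂ) : WithTop ℤ :=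
  meromorphicOrderAt (formCoeff p h) (coordAt p)

/-- The ends of `(g, ω)`: the poles of `ω`, `g ω`, `g² ω`. -/
def IsEnd (g h : ℂ → ℂ) (p : Sphere) : Prop :=
  formOrder p h < 0 ∨ formOrder p (fun z => g z * h z) < 0 ∨
    formOrder p (fun z => g z ^ 2 * h z) < 0

/-- `(g, ω)` is a Weierstrass data on `S²`: `g` is a meromorphic function and `ω = h dz` a
meromorphic 1-form on `S²` (`g` and `h` take their actual values at regular points and the value
`0` at poles), and the metric `(1 + |g|²)² |ω|²` has no zeros, i.e. `ω`, `g ω`, `g² ω` have no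
common zero. -/
structure IsWeierstrassData (g h : ℂ → ℂ) : Prop where
  mero_g : MeromorphicNFOn g univ
  mero_h : MeromorphicNFOn h univ
  mero_g_infty : MeromorphicAt (fun w => g w⁻¹) 0
  mero_h_infty : MeromorphicAt (fun w => h w⁻¹) 0
  no_zero : ∀ p, formOrder p h ≤ 0 ∨ formOrder p (fun z => g z * h z) ≤ 0 ∨
    formOrder p (fun z => g z ^ 2 * h z) ≤ 0

/-- The Weierstrass data `(g, ω)` on `S²` is of fold-type: all ends lie on the unit circle,
`|g| = 1` holds exactly on the unit circle (in particular not at `∞`), and `Re (dg / (g² ω))`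
vanishes on the unit circle. -/
structure IsFoldType (g h : ℂ → ℂ) : Prop extends IsWeierstrassData g h where
  ends : ∀ p, IsEnd g h p → ∃ z : ℂ, ‖z‖ = 1 ∧ p = (z : Sphere)
  norm_one : ∀ z : ℂ, ‖g z‖ = 1 ↔ ‖z‖ = 1
  norm_infty : ¬ Tendsto (fun w => ‖g w⁻¹‖) (𝓝[≠] 0) (𝓝 1)
  re_zero : ∀ z : ℂ, ‖z‖ = 1 → (deriv g z / (g z ^ 2 * h z)).re = 0

/-- The Weierstrass integrand `(-2 g, 1 + g², i (1 - g²)) h`. -/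
def weierstrassForm (g h : ℂ → ℂ) (z : ℂ) : Fin 3 → ℂ :=
  ![-2 * g z * h z, (1 + g z ^ 2) * h z, Complex.I * (1 - g z ^ 2) * h z]

/-- `f` is (single-valued and) a maxface associated to `(g, ω)`, i.e.
`f = Re ∫ (-2 g, 1 + g², i (1 - g²)) ω` up to an additive constant: `f` is continuous off the
ends, and `df = Re ((-2 g, 1 + g², i (1 - g²)) ω)` at all finite points where `g` and `ω` are
holomorphic. (The other points that are not ends are isolated.) -/
def IsAssociated (f : Sphere → R31) (g h : ℂ → ℂ) : Prop :=
  (∀ p, ¬ IsEnd g h p → ContinuousAt f p) ∧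
  ∀ z : ℂ, AnalyticAt ℂ g z → AnalyticAt ℂ h z → ∀ k : Fin 3,
    HasFDerivAt (fun w : ℂ => f (w : Sphere) k)
      (Complex.reCLM.comp (weierstrassForm g h z k • (1 : ℂ →L[ℝ] ℂ))) z

/-- The coefficient of `ω = i Λ dz / ∏ (z - e^{i α_j})`, with
`Λ = exp (i (α_0 + ⋯ + α_{2n-1}) / 2)`. -/
def principalForm {m : ℕ} (α : Fin m → ℝ) (z : ℂ) : ℂ :=
  Complex.I * Complex.exp (Complex.I * ((∑ j, (α j : ℂ)) / 2)) /
    ∏ j, (z - Complex.exp (Complex.I * (α j : ℂ)))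

end Maxface

end

/-! The involution reduces the theorem to function theory on a disc. Its fixed points form a circle,
which a Möbius coordinate turns into the unit circle, with `I` becoming inversion `z ↦ 1 / conj z`
(`exists_circle_coord`). The surface is then encoded by the derivative `φ = F'` of its holomorphic
null lift on the closed unit disc, and everything needed about it is collected in `DiscData`.
Invariance of `f` under inversion says that `z φ` is purely imaginary on the circle. This gives both
`|g| = 1` there and a reality condition on `ω`.

Gauss map. There are no singular points inside the disc, so after a Lorentz isometry `|g| < 1` there
and `g(0) = 0`. A critical point of `g` inside is an umbilic, and inversion produces a second one
outside. If there is an umbilic, the coordinate is centred at one; its mirror image is then `∞`, and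
a bound of two umbilics leaves no critical point of `g` in the disc except possibly `0`. On the
circle `z g' / g` is real. Schwarz's lemma keeps `g'` from vanishing there, so `g / (z g')` is
holomorphic on the closed disc and real on its boundary, hence constant. Therefore `g = l z ^ k`
(`eq_const_mul_pow_of_inner`).

The form. Weak completeness makes `1 / ω` extend analytically by zero to every end
(`exists_analyticAt_inv_of_isCompleteAt`): if `1 / ω` were unbounded, the holomorphic flow of the
corresponding vector field would reach the puncture along a path of finite length. So `1 / ω` is a
product of factors `z - e` over the ends times a zero-free analytic function. Since `z ^ (k + 1) ω /
dz` is imaginary on the circle after rotation, the same principle of real boundary values forces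
exactly `2 (k + 1)` factors and a constant cofactor (`exists_eq_principalForm`).

Both sides of the resulting identity are analytic off the ends, so it spreads from the disc to the
plane. It remains to check that the principal data are of fold-type (`isFoldType_principalForm`).
Here `n = k + 1`. -/

noncomputable section

namespace Maxface

/-! ### Real boundary values and inner functions on the unit disc. -/

section

-- The maximum principle applied to `exp (c H)` with `c = ± i` bounds `Im H` on both sides by its
-- boundary value `0`. A holomorphic function with values in the real line is not open, hence
-- constant.
open Metric in
lemma eq_const_of_im_eq_zero_on_sphere {H : ℂ → ℂ} (hd : DiffContOnCl ℂ H (ball 0 1))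
    (h : ∀ z, ‖z‖ = 1 → (H z).im = 0) : ∀ z ∈ closedBall (0 : ℂ) 1, H z = H 0 := by
  have key : ∀ c : ℂ, c.re = 0 → ∀ z ∈ ball (0 : ℂ) 1, (c * H z).re ≤ 0 := by
    intro c hc z hz
    have hd' : DiffContOnCl ℂ (fun w => Complex.exp (c * H w)) (ball 0 1) :=
      ⟨(hd.1.const_mul c).cexp, (continuousOn_const.mul hd.2).cexp⟩
    have := Complex.norm_le_of_forall_mem_frontier_norm_le isBounded_ball hd' (C := 1) (by
      intro w hw
      rw [frontier_ball _ one_ne_zero, mem_sphere_zero_iff_norm] at hw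
      simp [Complex.norm_exp, h w hw, hc]) (subset_closure hz)
    simpa [Complex.norm_exp] using this
  have him : ∀ z ∈ ball (0 : ℂ) 1, (H z).im = 0 := by
    intro z hz
    have h1 := key Complex.I (by simp) z hz
    have h2 := key (-Complex.I) (by simp) z hz
    simp at h1 h2
    linarith
  have hconst : ∀ z ∈ ball (0 : ℂ) 1, H z = H 0 := by
    rcases (hd.1.analyticOnNhd isOpen_ball).is_constant_or_isOpen
      (convex_ball _ _).isPreconnected with ⟨w, hw⟩ | ho
    · intro z hz
      rw [hw z hz, hw 0 (by simp)]
    · exfalso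
      have h1 := ho (ball 0 1) subset_rfl isOpen_ball
      have h2 : H 0 ∈ H '' ball 0 1 := ⟨0, by simp, rfl⟩
      obtain ⟨ε, hε, hs⟩ := Metric.isOpen_iff.1 h1 _ h2
      obtain ⟨z, hz, hzz⟩ := hs (show H 0 + (ε / 2 : ℝ) * Complex.I ∈ ball (H 0) ε by
        rw [mem_ball, dist_eq_norm, add_sub_cancel_left, norm_mul, Complex.norm_real]
        simp [abs_of_pos hε, hε])
      have h3 := him z hz
      rw [hzz] at h3
      have h4 := him 0 (by simp)
      simp [h4] at h3
      exact hε.ne' h3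
  intro z hz
  have h1 : closure (ball (0 : ℂ) 1) = closedBall 0 1 := closure_ball _ one_ne_zero
  have := hd.2
  rw [h1] at this
  exact (Set.EqOn.of_subset_closure (s := ball 0 1) (f := H) (g := fun _ => H 0) hconst this
    continuousOn_const ball_subset_closedBall h1.ge) hz

open Metric in
lemma diffContOnCl_ball_of_differentiableAt {H : ℂ → ℂ}
    (h : ∀ z ∈ closedBall (0 : ℂ) 1, DifferentiableAt ℂ H z) : DiffContOnCl ℂ H (ball 0 1) :=
  ⟨fun z hz => (h z (ball_subset_closedBall hz)).differentiableWithinAt,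
   fun z hz => (h z (closure_ball_subset_closedBall hz)).continuousAt.continuousWithinAt⟩

/-- If `|g| = 1` on the unit circle, then `z g' / g` is real there. -/
lemma im_mul_deriv_eq_zero {g : ℂ → ℂ} (hc : ∀ z, ‖z‖ = 1 → ‖g z‖ = 1) {z : ℂ} (hz : ‖z‖ = 1)
    (hg : DifferentiableAt ℂ g z) : (z * deriv g z * conj (g z)).im = 0 := by
  have h1 : HasDerivAt (fun t : ℝ => z * Complex.exp (t * Complex.I)) (z * Complex.I) 0 := by
    have h := ((((hasDerivAt_id (0 : ℝ)).ofReal_comp).mul_const Complex.I).cexp).const_mul z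
    simpa using h
  have h2 : HasDerivAt (fun t : ℝ => g (z * Complex.exp (t * Complex.I)))
      (deriv g z * (z * Complex.I)) 0 := by
    have := hg.hasDerivAt
    have h3 : HasDerivAt g (deriv g z) (z * Complex.exp (((0:ℝ):ℂ) * Complex.I)) := by
      simpa using this
    exact h3.comp (0:ℝ) h1
  have h3 := h2.norm_sq
  have h4 : (fun t : ℝ => ‖g (z * Complex.exp (t * Complex.I))‖ ^ 2) = fun _ => 1 := by
    funext t
    rw [hc]
    · norm_num
    · rw [norm_mul, hz, Complex.norm_exp_ofReal_mul_I, one_mul]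
  rw [h4] at h3
  have h5 := h3.unique (hasDerivAt_const _ _)
  simp [Complex.inner] at h5
  simp
  linarith

open Metric in
/-- A self-map of the disc which is inner, fixes `0` and has no critical point other than `0`
is a power map up to rotation. -/
lemma eq_const_mul_pow_of_inner {g : ℂ → ℂ} (hg : ∀ z ∈ closedBall (0 : ℂ) 1, AnalyticAt ℂ g z)
    (hlt : ∀ z ∈ ball (0 : ℂ) 1, ‖g z‖ < 1) (hc : ∀ z, ‖z‖ = 1 → ‖g z‖ = 1) (h0 : g 0 = 0)
    (hcrit : ∀ z ∈ ball (0 : ℂ) 1, z ≠ 0 → deriv g z ≠ 0) :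
    ∃ (k : ℕ) (l : ℂ), 1 ≤ k ∧ ‖l‖ = 1 ∧ ∀ z ∈ closedBall (0 : ℂ) 1, g z = l * z ^ k := by
  have h0b : (0 : ℂ) ∈ ball (0 : ℂ) 1 := by simp
  have hon : AnalyticOnNhd ℂ g (ball 0 1) := fun z hz => hg z (ball_subset_closedBall hz)
  have hdc : DiffContOnCl ℂ g (ball 0 1) :=
    diffContOnCl_ball_of_differentiableAt fun z hz => (hg z hz).differentiableAt
  have hcl : closure (ball (0 : ℂ) 1) = closedBall 0 1 := closure_ball _ one_ne_zero
  -- Schwarz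
  have hcrit1 : ∀ z, ‖z‖ = 1 → deriv g z ≠ 0 := by
    intro z hz h
    have hzc : z ∈ closedBall (0 : ℂ) 1 := by simp [hz]
    have h1 : HasDerivAt (fun t : ℝ => (t : ℂ) * z) z 1 := by
      simpa using ((hasDerivAt_id (1 : ℝ)).ofReal_comp).mul_const z
    have h2 : HasDerivAt (fun t : ℝ => g (t * z)) 0 1 := by
      have h3 : HasDerivAt g (deriv g z) (((1:ℝ):ℂ) * z) := by
        simpa using (hg z hzc).differentiableAt.hasDerivAt
      have h4 := h3.comp (1:ℝ) h1
      rw [h, zero_mul] at h4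
      exact h4
    -- If `g'` vanished at `z`, then `|g(tz) - g(z)|` would be at most `(1 - t) / 2` for `t` near
    -- `1`. Schwarz gives `|g(tz)| ≤ t`, so this difference is at least `1 - t`.
    have h3 := h2.isLittleO
    have h4 := (h3.def (c := 1/2) (by norm_num)).filter_mono
      (nhdsWithin_le_nhds (s := Iio 1))
    have h5 : ∀ᶠ t in 𝓝[<] (1:ℝ), t ∈ Ioo (0:ℝ) 1 := Ioo_mem_nhdsLT (by norm_num)
    obtain ⟨t, ht, ht0, ht1⟩ := (h4.and h5).exists
    simp only [Complex.ofReal_one, one_mul, smul_zero, sub_zero] at ht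
    have htz : ‖(t:ℂ) * z‖ = t := by simp [hz, abs_of_pos ht0]
    have h6 : ‖g (t * z)‖ ≤ ‖(t:ℂ) * z‖ :=
      Complex.norm_le_norm_of_mapsTo_ball (R := 1) hdc.1
        (fun w hw => ball_subset_closedBall (by simpa using hlt w hw)) h0 (by rw [htz]; exact ht1)
    rw [htz] at h6
    have h7 : ‖g z‖ ≤ ‖g (t * z)‖ + ‖g (t * z) - g z‖ := by
      have := norm_sub_norm_le (g z) (g (t * z))
      rw [norm_sub_rev] at this
      linarith
    rw [hc z hz] at h7
    rw [Real.norm_eq_abs, abs_of_neg (by linarith)] at ht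
    linarith
  -- order at zero
  have hne : analyticOrderAt g 0 ≠ ⊤ := by
    intro h
    rw [analyticOrderAt_eq_top] at h
    have h1 : EqOn g 0 (ball 0 1) :=
      hon.eqOn_of_preconnected_of_eventuallyEq (g := 0) (fun _ _ => analyticAt_const)
        (convex_ball _ _).isPreconnected h0b h
    have h2 := (h1.of_subset_closure (t := closedBall 0 1) (hcl ▸ hdc.2) continuousOn_const
      ball_subset_closedBall hcl.ge) (show (1 : ℂ) ∈ closedBall (0:ℂ) 1 by simp)
    have h3 := hc 1 (by simp)
    rw [h2] at h3
    simp at h3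
  obtain ⟨k, hk⟩ := ENat.ne_top_iff_exists.1 hne
  obtain ⟨q, hq, hq0, hgq⟩ := ((hg 0 (by simp)).analyticOrderAt_eq_natCast).1 hk.symm
  simp only [sub_zero, smul_eq_mul] at hgq
  have hk1 : 1 ≤ k := by
    rcases Nat.eq_zero_or_pos k with rfl | h
    · have := hgq.self_of_nhds
      simp [h0] at this
      exact absurd this.symm hq0
    · exact h
  have hk0 : (k : ℂ) ≠ 0 := by exact_mod_cast (by omega : k ≠ 0)
  -- the quotient
  have hdq : ∀ᶠ z in 𝓝 (0:ℂ), deriv g z * z = z ^ k * (k * q z + z * deriv q z) := by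
    filter_upwards [hgq.eventually_nhds, hq.eventually_analyticAt] with z hz hqz
    have hz' : g =ᶠ[𝓝 z] fun z => z ^ k * q z := hz
    rw [hz'.deriv_eq]
    have := ((hasDerivAt_pow k z).mul hqz.differentiableAt.hasDerivAt).deriv
    rw [show (fun z => z ^ k * q z) = (fun z => z ^ k) * q from rfl, this]
    obtain ⟨m, rfl⟩ : ∃ m, k = m + 1 := ⟨k - 1, by omega⟩
    simp [pow_succ]
    ring
  have hden : AnalyticAt ℂ (fun z => k * q z + z * deriv q z) 0 :=
    (analyticAt_const.mul hq).add (analyticAt_id.mul hq.deriv)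
  have hden0 : (fun z => k * q z + z * deriv q z) 0 ≠ 0 := by simp [hk0, hq0]
  -- The reciprocal of `z g' / g` is used because `g` may have zeros in the disc, whereas `g'` has
  -- none off the origin. At `0` the value is the limit `1 / k`, with `k` the order of the zero of
  -- `g`.
  set H : ℂ → ℂ := fun z => if z = 0 then 1 / k else g z / (deriv g z * z) with hH
  have hHd0 : DifferentiableAt ℂ H 0 := by
    have h1 : H =ᶠ[𝓝 0] fun z => q z / (k * q z + z * deriv q z) := by
      filter_upwards [hdq, hgq] with z h1 h2
      by_cases hz : z = 0
      · subst hz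
        simp [hH]
        field_simp
      · simp only [hH, hz, if_false]
        rw [h1, h2]
        exact mul_div_mul_left _ _ (pow_ne_zero _ hz)
    exact ((hq.div hden hden0).differentiableAt).congr_of_eventuallyEq h1
  have hHd : ∀ z ∈ closedBall (0 : ℂ) 1, DifferentiableAt ℂ H z := by
    intro z hz
    by_cases hz0 : z = 0
    · rw [hz0]; exact hHd0
    · have h1 : H =ᶠ[𝓝 z] fun z => g z / (deriv g z * z) := by
        filter_upwards [isOpen_ne.mem_nhds hz0] with w hw
        have hw' : w ≠ 0 := hw
        simp [hH, hw']
      refine DifferentiableAt.congr_of_eventuallyEq ?_ h1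
      have h2 : deriv g z ≠ 0 := by
        rcases (mem_closedBall_zero_iff.1 hz).lt_or_eq with h | h
        · exact hcrit z (by simpa using h) hz0
        · exact hcrit1 z h
      exact (hg z hz).differentiableAt.div ((hg z hz).deriv.differentiableAt.mul differentiableAt_id)
        (mul_ne_zero h2 hz0)
  have hHim : ∀ z, ‖z‖ = 1 → (H z).im = 0 := by
    intro z hz
    have hz0 : z ≠ 0 := by rintro rfl; simp at hz
    have hgz : g z ≠ 0 := by intro h; have := hc z hz; simp [h] at this
    have h1 := im_mul_deriv_eq_zero hc hz (hg z (by simp [hz])).differentiableAt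
    have h2 : H z = (z * deriv g z * conj (g z))⁻¹ := by
      have h3 : conj (g z) * g z = 1 := by
        rw [mul_comm, Complex.mul_conj, Complex.normSq_eq_norm_sq, hc z hz]; simp
      have h4 := hcrit1 z hz
      simp only [hH, hz0, if_false]
      rw [div_eq_iff (mul_ne_zero h4 hz0), mul_inv, mul_inv, inv_eq_of_mul_eq_one_right h3]
      field_simp
    rw [h2, Complex.inv_im, h1]
    simp
  have hHc := eq_const_of_im_eq_zero_on_sphere (diffContOnCl_ball_of_differentiableAt hHd) hHim
  -- With `g = z ^ k q`, the equation `H = 1 / k` reads `z ^ (k + 1) q' = 0`.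
  have hq' : ∀ᶠ z in 𝓝 (0:ℂ), deriv q z = 0 := by
    have h1 : ∀ᶠ z in 𝓝[≠] (0:ℂ), deriv q z = 0 := by
      have hb : ∀ᶠ z in 𝓝 (0:ℂ), z ∈ ball (0:ℂ) 1 := ball_mem_nhds _ one_pos
      filter_upwards [hdq.filter_mono nhdsWithin_le_nhds, hgq.filter_mono nhdsWithin_le_nhds,
        hb.filter_mono nhdsWithin_le_nhds, self_mem_nhdsWithin] with z h1 h2 h3 h4
      have h4' : z ≠ 0 := h4
      have h5 := hHc z (ball_subset_closedBall h3)
      simp only [hH, h4', if_false, if_true] at h5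
      rw [div_eq_div_iff (mul_ne_zero (hcrit z h3 h4') h4') hk0, h1, h2] at h5
      have h6 : z ^ (k + 1) * deriv q z = 0 := by linear_combination -h5
      exact (mul_eq_zero.1 h6).resolve_left (pow_ne_zero _ h4')
    have := (hq.deriv.frequently_eq_iff_eventually_eq analyticAt_const).1 h1.frequently
    exact this
  obtain ⟨ε, hε, hball⟩ := Metric.eventually_nhds_iff_ball.1
    (hq'.and hq.eventually_analyticAt)
  have hqc : ∀ z ∈ ball (0:ℂ) ε, q z = q 0 := by
    intro z hz
    exact IsOpen.is_const_of_deriv_eq_zero isOpen_ball (convex_ball _ _).isPreconnected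
      (fun w hw => (hball w hw).2.differentiableAt.differentiableWithinAt)
      (fun w hw => (hball w hw).1) hz (mem_ball_self hε)
  have h1 : EqOn g (fun z => q 0 * z ^ k) (ball 0 1) := by
    refine hon.eqOn_of_preconnected_of_eventuallyEq
      (fun z _ => analyticAt_const.mul (analyticAt_id.pow k))
      (convex_ball _ _).isPreconnected h0b ?_
    filter_upwards [hgq, ball_mem_nhds _ hε] with z hz hz2
    rw [hz, hqc z hz2, mul_comm]
  have h2 : EqOn g (fun z => q 0 * z ^ k) (closedBall 0 1) :=
    h1.of_subset_closure (hcl ▸ hdc.2) (by fun_prop) ball_subset_closedBall hcl.ge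
  refine ⟨k, q 0, hk1, ?_, h2⟩
  have h3 := h2 (show (1 : ℂ) ∈ closedBall (0:ℂ) 1 by simp)
  have h4 := hc 1 (by simp)
  rw [h3] at h4
  simpa using h4

end

/-! ### Determination of a form from its zeros and its phase on the circle. -/

section

/-- Division of an analytic function by its zeros on `S`. -/
lemma exists_list_factor (S : Set ℂ) (E : Finset ℂ) : ∀ b : ℂ → ℂ, (∀ z ∈ S, AnalyticAt ℂ b z) →
    (∀ z ∈ S, ∀ᶠ w in 𝓝[≠] z, b w ≠ 0) → (∀ z ∈ E, z ∈ S) → (∀ z ∈ S, b z = 0 ↔ z ∈ E) →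
    ∃ (L : List ℂ) (b₁ : ℂ → ℂ), (∀ x, x ∈ L ↔ x ∈ E) ∧
      (∀ z ∈ S, AnalyticAt ℂ b₁ z ∧ b₁ z ≠ 0) ∧
      ∀ z ∈ S, b z = (L.map fun e => z - e).prod * b₁ z := by
  induction E using Finset.induction_on with
  | empty =>
    intro b hb _ _ hE
    exact ⟨[], b, by simp, fun z hz => ⟨hb z hz, fun h => by simpa using (hE z hz).1 h⟩, by simp⟩
  | insert e E he ih =>
    intro b hb hnz hES hE
    have heS : e ∈ S := hES e (by simp)
    have hne : analyticOrderAt b e ≠ ⊤ := by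
      intro h
      rw [analyticOrderAt_eq_top] at h
      obtain ⟨w, h1, h2⟩ := ((hnz e heS).and (h.filter_mono nhdsWithin_le_nhds)).exists
      exact h1 h2
    obtain ⟨m, hm⟩ := ENat.ne_top_iff_exists.1 hne
    obtain ⟨q, hq, hq0, hbq⟩ := ((hb e heS).analyticOrderAt_eq_natCast).1 hm.symm
    simp only [smul_eq_mul] at hbq
    have hm0 : m ≠ 0 := by
      rintro rfl
      have := hbq.self_of_nhds
      rw [(hE e heS).2 (by simp)] at this
      simp at this
      exact hq0 this.symm
    -- The whole zero at `e` is divided out at once, so that `b'` vanishes only on the smaller set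
    -- `E`.
    set b' : ℂ → ℂ := fun z => if z = e then q e else b z / (z - e) ^ m with hb'
    have hb'q : b' =ᶠ[𝓝 e] q := by
      filter_upwards [hbq] with z hz
      by_cases h : z = e
      · simp [hb', h]
      · simp only [hb', h, if_false]
        rw [hz, mul_div_cancel_left₀ _ (pow_ne_zero _ (sub_ne_zero.2 h))]
    have hb'n : ∀ z, z ≠ e → b' =ᶠ[𝓝 z] fun z => b z / (z - e) ^ m := by
      intro z hz
      filter_upwards [isOpen_ne.mem_nhds hz] with w hw
      have hw' : w ≠ e := hw
      simp [hb', hw']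
    obtain ⟨L, b₁, hL, hb₁, hprod⟩ := ih b' (by
      intro z hz
      by_cases h : z = e
      · rw [h]; exact hq.congr hb'q.symm
      · exact ((hb z hz).div ((analyticAt_id.sub analyticAt_const).pow m)
          (pow_ne_zero _ (sub_ne_zero.2 h))).congr (hb'n z h).symm) (by
      intro z hz
      by_cases h : z = e
      · rw [h]
        filter_upwards [(hb'q.filter_mono nhdsWithin_le_nhds),
          (hq.continuousAt.eventually_ne hq0).filter_mono nhdsWithin_le_nhds] with w h1 h2
        rw [h1]; exact h2
      · have h3 : ∀ᶠ w in 𝓝[≠] z, w ≠ e :=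
          (isOpen_ne.mem_nhds h : {w | w ≠ e} ∈ 𝓝 z) |> mem_nhdsWithin_of_mem_nhds
        filter_upwards [hnz z hz, h3] with w h1 h2
        simp only [hb', h2, if_false]
        exact div_ne_zero h1 (pow_ne_zero _ (sub_ne_zero.2 h2)))
      (fun z hz => hES z (by simp [hz])) (by
      intro z hz
      by_cases h : z = e
      · simp [hb', h, hq0, he]
      · simp only [hb', h, if_false]
        rw [div_eq_zero_iff, hE z hz]
        simp [h, sub_eq_zero])
    -- The list carries multiplicities; `m ≠ 0` guarantees that `e` itself is listed.
    refine ⟨List.replicate m e ++ L, b₁, fun x => ?_, hb₁, fun z hz => ?_⟩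
    · simp [hL, hm0]
    · rw [List.map_append, List.prod_append, mul_assoc, ← hprod z hz]
      by_cases h : z = e
      · rw [(hE z hz).2 (by simp [h])]; simp [h, hm0]
      · simp only [hb', h, if_false, List.map_replicate, List.prod_replicate]
        rw [mul_div_cancel₀ _ (pow_ne_zero _ (sub_ne_zero.2 h))]

lemma frequently_norm_eq_one {e : ℂ} (he : ‖e‖ = 1) : ∃ᶠ z in 𝓝[≠] e, ‖z‖ = 1 := by
  have h1 : HasDerivAt (fun t : ℝ => e * Complex.exp (t * Complex.I)) (e * Complex.I) 0 := by
    have h := ((((hasDerivAt_id (0 : ℝ)).ofReal_comp).mul_const Complex.I).cexp).const_mul e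
    simpa using h
  have he0 : e ≠ 0 := by rintro rfl; simp at he
  have h2 := h1.tendsto_nhdsNE (mul_ne_zero he0 Complex.I_ne_zero)
  simp only [Complex.ofReal_zero, zero_mul, Complex.exp_zero, mul_one] at h2
  refine h2.frequently (Eventually.frequently (Eventually.of_forall fun t => ?_))
  rw [norm_mul, he, Complex.norm_exp_ofReal_mul_I, one_mul]

lemma eventually_notMem_finset (E : Finset ℂ) (e : ℂ) : ∀ᶠ z in 𝓝[≠] e, z ∉ E := by
  have h : ((E.erase e : Finset ℂ) : Set ℂ)ᶜ ∈ 𝓝 e :=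
    (E.erase e).finite_toSet.isClosed.isOpen_compl.mem_nhds (by simp)
  filter_upwards [mem_nhdsWithin_of_mem_nhds h, self_mem_nhdsWithin] with z h1 h2 h3
  exact h1 (by simp [h3]; exact h2)

/-- Each point of the circle is a limit of circle points outside the finite set `E`, so continuity
fills in the missing values. -/
lemma im_eq_zero_of_continuousAt {G : ℂ → ℂ} {E : Finset ℂ}
    (h : ∀ z, ‖z‖ = 1 → z ∉ E → (G z).im = 0) (hG : ∀ z, ‖z‖ = 1 → ContinuousAt G z) :
    ∀ z, ‖z‖ = 1 → (G z).im = 0 := by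
  intro z hz
  by_contra hne
  have h1 : ∀ᶠ w in 𝓝 z, (G w).im ≠ 0 :=
    (Complex.continuous_im.continuousAt.comp (hG z hz)).eventually_ne hne
  obtain ⟨w, h2, h3, h4⟩ := ((frequently_norm_eq_one hz).and_eventually
    ((h1.filter_mono nhdsWithin_le_nhds).and (eventually_notMem_finset E z))).exists
  exact h3 (h w h2 h4)

/-- The argument in `[0, 2π)`. -/
def angle (e : ℂ) : ℝ := if 0 ≤ e.arg then e.arg else e.arg + 2 * Real.pi

lemma angle_nonneg (e : ℂ) : 0 ≤ angle e := by
  unfold angle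
  split_ifs with h
  · exact h
  · linarith [Complex.neg_pi_lt_arg e, Real.pi_pos]

lemma angle_lt (e : ℂ) : angle e < 2 * Real.pi := by
  unfold angle
  split_ifs with h
  · linarith [Complex.arg_le_pi e, Real.pi_pos]
  · linarith

lemma exp_angle {e : ℂ} (he : ‖e‖ = 1) : Complex.exp (Complex.I * (angle e : ℂ)) = e := by
  have h := Complex.norm_mul_exp_arg_mul_I e
  rw [he, Complex.ofReal_one, one_mul] at h
  unfold angle
  split_ifs
  · rw [mul_comm]; exact h
  · rw [← h]
    push_cast
    rw [mul_add, Complex.exp_add, h, mul_comm Complex.I (2 * (Real.pi : ℂ)),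
      Complex.exp_two_pi_mul_I, mul_one, mul_comm, h]

/-- On the circle conjugation is inversion, so `|z - e|² = (z - e)(1/z - 1/e)`. This isolates the
phase of each factor of the denominator of `ω`. -/
lemma sub_sq_of_norm_eq_one {z e : ℂ} (hz : ‖z‖ = 1) (he : ‖e‖ = 1) :
    (z - e) ^ 2 = -1 * z * e * ((‖z - e‖ ^ 2 : ℝ) : ℂ) := by
  have h1 : z * conj z = 1 := by rw [Complex.mul_conj, Complex.normSq_eq_norm_sq, hz]; simp
  have h2 : e * conj e = 1 := by rw [Complex.mul_conj, Complex.normSq_eq_norm_sq, he]; simp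
  rw [← Complex.normSq_eq_norm_sq, ← Complex.mul_conj, map_sub]
  linear_combination e * (z - e) * h1 - z * (z - e) * h2

open Metric in
/-- The degree and reality argument which determines the form `ω`. -/
lemma exists_eq_principalForm {E : Finset ℂ} (h1E : 1 ∈ E) (hE : ∀ e ∈ E, ‖e‖ = 1)
    {h b : ℂ → ℂ} {l : ℂ} (hl : ‖l‖ = 1) (k : ℕ)
    (hb : ∀ z ∈ closedBall (0 : ℂ) 1, AnalyticAt ℂ b z)
    (hbh : ∀ z ∈ closedBall (0 : ℂ) 1, z ∉ E → b z * h z = 1) (hbE : ∀ e ∈ E, b e = 0)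
    (hnz : ∀ z ∈ closedBall (0 : ℂ) 1, ∀ᶠ w in 𝓝[≠] z, b w ≠ 0)
    (him : ∀ z, ‖z‖ = 1 → z ∉ E → (l * z ^ (k + 1) * h z).re = 0) :
    ∃ α : Fin (2 * (k + 1)) → ℝ, α ⟨0, by omega⟩ = 0 ∧ Monotone α ∧ (∀ j, α j < 2 * Real.pi) ∧
      (∀ z, z ∈ E ↔ ∃ j, z = Complex.exp (Complex.I * (α j : ℂ))) ∧
      ∃ c : ℝ, c ≠ 0 ∧ ∀ z ∈ closedBall (0 : ℂ) 1, z ∉ E → l * h z = c * principalForm α z := by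
  have hb0 : ∀ z ∈ closedBall (0 : ℂ) 1, b z = 0 ↔ z ∈ E := by
    intro z hz
    refine ⟨fun h0 => ?_, hbE z⟩
    by_contra hzE
    have := hbh z hz hzE
    simp [h0] at this
  obtain ⟨L, b₁, hL, hb₁, hprod⟩ := exists_list_factor _ E b hb hnz
    (fun z hz => by simp [hE z hz]) hb0
  obtain ⟨m, e, heE, hprod⟩ : ∃ (m : ℕ) (e : Fin m → ℂ), (∀ x, x ∈ E ↔ ∃ j, x = e j) ∧
      ∀ z ∈ closedBall (0 : ℂ) 1, b z = (∏ j, (z - e j)) * b₁ z := by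
    refine ⟨L.length, fun j => L[j], fun x => ?_, fun z hz => ?_⟩
    · rw [← hL, List.mem_iff_get]
      exact ⟨fun ⟨n, hn⟩ => ⟨n, hn.symm⟩, fun ⟨n, hn⟩ => ⟨n, hn.symm⟩⟩
    · rw [hprod z hz, ← Fin.prod_univ_fun_getElem]
      rfl
  have he1 : ∀ j, ‖e j‖ = 1 := fun j => hE _ ((heE _).2 ⟨j, rfl⟩)
  set p : ℂ := ∏ j, e j with hp
  have hpn : ‖p‖ = 1 := by rw [hp, norm_prod]; simp [he1]
  have hp0 : p ≠ 0 := by intro h; simp [h] at hpn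
  have hl0 : l ≠ 0 := by rintro rfl; simp at hl
  -- The constant left when the squared imaginary quantity `l z ^ (k + 1) h` is rewritten through
  -- `b` and the phases of the factors `z - e j`. The square is negative, whence the sign in
  -- `hcirc`.
  set κ : ℂ := (-1) ^ m * p / l ^ 2 with hκ
  have hκ0 : κ ≠ 0 := by simp [hκ, hp0, hl0]
  have hcirc : ∀ z, ‖z‖ = 1 → z ∉ E →
      ∃ t : ℝ, 0 < t ∧ κ * b₁ z ^ 2 * z ^ m = -t * z ^ (2 * k + 2) := by
    intro z hz hzE
    have hzc : z ∈ closedBall (0 : ℂ) 1 := by simp [hz]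
    have hz0 : z ≠ 0 := by rintro rfl; simp at hz
    have h2 := hbh z hzc hzE
    have hP : (∏ j, (z - e j)) ^ 2 = (-1) ^ m * z ^ m * p * ((∏ j, ‖z - e j‖ ^ 2 : ℝ) : ℂ) := by
      rw [← Finset.prod_pow]
      simp_rw [sub_sq_of_norm_eq_one hz (he1 _)]
      rw [Finset.prod_mul_distrib, Finset.prod_mul_distrib, Finset.prod_mul_distrib]
      simp [hp]
    set r : ℝ := ∏ j, ‖z - e j‖ ^ 2 with hr
    have hr0 : 0 < r := Finset.prod_pos fun j _ => by
      have : z - e j ≠ 0 := sub_ne_zero.2 fun h => hzE ((heE z).2 ⟨j, h⟩)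
      positivity
    set w := l * z ^ (k + 1) * h z with hw
    have hw0 : w ≠ 0 := mul_ne_zero (mul_ne_zero hl0 (pow_ne_zero _ hz0)) (right_ne_zero_of_mul_eq_one h2)
    have hw2 : w ^ 2 = -((w.im ^ 2 : ℝ) : ℂ) := by
      have : w = w.im * Complex.I := by
        apply Complex.ext
        · rw [him z hz hzE]; simp
        · simp
      rw [this, mul_pow, Complex.I_sq]; simp
    have hwim : w.im ≠ 0 := fun h => hw0 (Complex.ext (him z hz hzE) h)
    refine ⟨1 / (r * w.im ^ 2), by positivity, ?_⟩
    rw [hprod z hzc] at h2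
    have h3 : l ^ 2 * z ^ (2 * k + 2) = w ^ 2 * ((∏ j, (z - e j)) * b₁ z) ^ 2 := by
      rw [hw]
      linear_combination (-(l ^ 2 * z ^ (2 * k + 2)) * ((∏ j, (z - e j)) * b₁ z * h z + 1)) * h2
    rw [mul_pow (∏ j, (z - e j)) (b₁ z), hP, hw2] at h3
    have hrc : (r : ℂ) ≠ 0 := by exact_mod_cast hr0.ne'
    have hwc : (w.im : ℂ) ≠ 0 := by exact_mod_cast hwim
    push_cast at h3 ⊢
    rw [hκ]
    field_simp
    linear_combination h3
  have hb₁d : ∀ z ∈ closedBall (0 : ℂ) 1, DifferentiableAt ℂ b₁ z :=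
    fun z hz => (hb₁ z hz).1.differentiableAt
  have h1b : b₁ 1 ≠ 0 := (hb₁ 1 (by simp)).2
  -- If the exponents differed, `hcirc` would exhibit a holomorphic function with real values on the
  -- circle and a factor `z ^ (d + 1)`. Being constant it would vanish identically, but it is
  -- nonzero at `1`.
  have hm : m = 2 * (k + 1) := by
    rcases lt_trichotomy m (2 * k + 2) with hlt | heq | hgt
    · exfalso
      obtain ⟨d, hd⟩ : ∃ d, 2 * k + 2 = m + d + 1 := ⟨2 * k + 2 - m - 1, by omega⟩
      have hdiff : ∀ z ∈ closedBall (0 : ℂ) 1,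
          DifferentiableAt ℂ (fun z => z ^ (d + 1) / (κ * b₁ z ^ 2)) z := fun z hz =>
        (differentiableAt_id.pow _).div ((hb₁d z hz).pow 2 |>.const_mul κ)
          (mul_ne_zero hκ0 (pow_ne_zero _ (hb₁ z hz).2))
      have := eq_const_of_im_eq_zero_on_sphere (diffContOnCl_ball_of_differentiableAt hdiff)
        (im_eq_zero_of_continuousAt (E := E) (fun z hz hzE => by
          obtain ⟨t, ht, h2⟩ := hcirc z hz hzE
          have hz0 : z ≠ 0 := by rintro rfl; simp at hz
          have h3 : z ^ (d + 1) / (κ * b₁ z ^ 2) = ((-1 / t : ℝ) : ℂ) := by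
            have ht' : (t : ℂ) ≠ 0 := by exact_mod_cast ht.ne'
            rw [div_eq_iff (mul_ne_zero hκ0 (pow_ne_zero _ (hb₁ z (by simp [hz])).2))]
            apply mul_right_cancel₀ (pow_ne_zero m hz0)
            rw [mul_assoc, h2, hd]
            push_cast
            field_simp
            ring
          rw [h3, Complex.ofReal_im])
          (fun z hz => (hdiff z (by simp [hz])).continuousAt)) 1 (by simp)
      simp [h1b, hκ0] at this
    · omega
    · exfalso
      obtain ⟨d, hd⟩ : ∃ d, m = 2 * k + 2 + d + 1 := ⟨m - (2 * k + 2) - 1, by omega⟩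
      have hdiff : ∀ z ∈ closedBall (0 : ℂ) 1,
          DifferentiableAt ℂ (fun z => κ * b₁ z ^ 2 * z ^ (d + 1)) z := fun z hz =>
        ((hb₁d z hz).pow 2 |>.const_mul κ).mul (differentiableAt_id.pow _)
      have := eq_const_of_im_eq_zero_on_sphere (diffContOnCl_ball_of_differentiableAt hdiff)
        (im_eq_zero_of_continuousAt (E := E) (fun z hz hzE => by
          obtain ⟨t, ht, h2⟩ := hcirc z hz hzE
          have hz0 : z ≠ 0 := by rintro rfl; simp at hz
          have h3 : κ * b₁ z ^ 2 * z ^ (d + 1) = ((-t : ℝ) : ℂ) := by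
            apply mul_right_cancel₀ (pow_ne_zero (2 * k + 2) hz0)
            rw [hd] at h2
            push_cast
            linear_combination h2
          rw [h3, Complex.ofReal_im])
          (fun z hz => (hdiff z (by simp [hz])).continuousAt)) 1 (by simp)
      simp [h1b, hκ0] at this
  subst hm
  -- `b₁` is constant
  have hdiff : ∀ z ∈ closedBall (0 : ℂ) 1, DifferentiableAt ℂ (fun z => κ * b₁ z ^ 2) z :=
    fun z hz => ((hb₁d z hz).pow 2 |>.const_mul κ)
  have hcirc' : ∀ z, ‖z‖ = 1 → z ∉ E → ∃ t : ℝ, 0 < t ∧ κ * b₁ z ^ 2 = ((-t : ℝ) : ℂ) := by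
    intro z hz hzE
    obtain ⟨t, ht, h2⟩ := hcirc z hz hzE
    have hz0 : z ≠ 0 := by rintro rfl; simp at hz
    refine ⟨t, ht, ?_⟩
    apply mul_right_cancel₀ (pow_ne_zero (2 * (k + 1)) hz0)
    rw [h2, mul_add]
    push_cast
    ring
  have hconst := eq_const_of_im_eq_zero_on_sphere (diffContOnCl_ball_of_differentiableAt hdiff)
    (im_eq_zero_of_continuousAt (E := E) (fun z hz hzE => by
      obtain ⟨t, ht, h2⟩ := hcirc' z hz hzE
      rw [h2, Complex.ofReal_im]) (fun z hz => (hdiff z (by simp [hz])).continuousAt))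
  obtain ⟨z₀, hz₀, hz₀E⟩ := ((frequently_norm_eq_one (e := 1) (by simp)).and_eventually
    (eventually_notMem_finset E 1)).exists
  obtain ⟨t, ht, hzt⟩ := hcirc' z₀ hz₀ hz₀E
  rw [hconst z₀ (by simp [hz₀])] at hzt
  -- Only `b₁ ^ 2` is known to be constant so far. On a connected set a continuous zero-free square
  -- root cannot change sign.
  have hb₁c : ∀ z ∈ closedBall (0 : ℂ) 1, b₁ z = b₁ 0 := by
    intro z hz
    refine (convex_closedBall (0:ℂ) 1).isPreconnected.eq_of_sq_eq (f := b₁) (g := fun _ => b₁ 0)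
      (fun z hz => (hb₁d z hz).continuousAt.continuousWithinAt) continuousOn_const ?_ ?_
      (y := 0) (by simp) rfl hz
    · intro z hz
      exact mul_left_cancel₀ hκ0 (hconst z hz)
    · intro z hz; exact (hb₁ 0 (by simp)).2
  have hb00 : b₁ 0 ≠ 0 := (hb₁ 0 (by simp)).2
  set a : Fin (2 * (k + 1)) → ℝ := fun j => angle (e j) with ha
  have hexp : ∀ j, Complex.exp (Complex.I * (a j : ℂ)) = e j := fun j => exp_angle (he1 j)
  set σ := Tuple.sort a with hσ
  refine ⟨a ∘ σ, ?_, Tuple.monotone_sort a, fun j => angle_lt _, fun z => ?_, ?_⟩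
  -- The end `1` has angle `0`, the least possible value, so sorting puts a zero in front.
  · obtain ⟨j, hj⟩ := (heE 1).1 h1E
    have h2 : a j = 0 := by simp [ha, ← hj, angle]
    have h3 := Tuple.monotone_sort a (show (⟨0, by omega⟩ : Fin (2 * (k + 1))) ≤ σ.symm j from
      Fin.mk_le_of_le_val (Nat.zero_le _))
    refine le_antisymm ?_ (angle_nonneg _)
    rw [← h2]
    simpa [← hσ] using h3
  · rw [heE]
    constructor
    · rintro ⟨j, hj⟩
      exact ⟨σ.symm j, by simp [hexp, hj]⟩
    · rintro ⟨j, hj⟩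
      exact ⟨σ j, by rw [hj]; exact hexp _⟩
  set Λ : ℂ := Complex.exp (Complex.I * ((∑ j, ((a ∘ σ) j : ℂ)) / 2)) with hΛ
  have hΛ2 : Λ ^ 2 = p := by
    rw [hΛ, ← Complex.exp_nat_mul, hp, ← Finset.prod_congr rfl (fun j _ => hexp j),
      ← Complex.exp_sum, ← Finset.mul_sum]
    congr 1
    rw [← Equiv.sum_comp σ (fun j => (a j : ℂ))]
    push_cast
    simp only [Function.comp]
    ring
  have hΛ0 : Λ ≠ 0 := Complex.exp_ne_zero _
  -- The relation `κ b₁(0)² = -t` gives `(l / b₁(0))² = -Λ² / t`. The square root is determined up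
  -- to sign, so `c` may be negative.
  obtain ⟨c, hc0, hc⟩ : ∃ c : ℝ, c ≠ 0 ∧ l / b₁ 0 = c * (Complex.I * Λ) := by
    have ht' : ((Real.sqrt (1 / t) : ℝ) : ℂ) ^ 2 = 1 / t := by
      rw [← Complex.ofReal_pow, Real.sq_sqrt (by positivity)]; simp
    have h2 : (l / b₁ 0) ^ 2 = (((Real.sqrt (1 / t) : ℝ) : ℂ) * (Complex.I * Λ)) ^ 2 := by
      rw [mul_pow, mul_pow, ht', Complex.I_sq, hΛ2]
      have htc : (t : ℂ) ≠ 0 := by exact_mod_cast ht.ne'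
      have h3 : ((-1 : ℂ)) ^ (2 * (k + 1)) = 1 := by rw [pow_mul]; simp
      simp only [hκ, h3] at hzt
      push_cast at hzt
      field_simp at hzt ⊢
      linear_combination hzt
    have hs : Real.sqrt (1 / t) ≠ 0 := (Real.sqrt_pos.2 (by positivity)).ne'
    rcases sq_eq_sq_iff_eq_or_eq_neg.1 h2 with h3 | h3
    · exact ⟨_, hs, h3⟩
    · exact ⟨-Real.sqrt (1 / t), neg_ne_zero.2 hs, by rw [h3]; push_cast; ring⟩
  refine ⟨c, hc0, fun z hz hzE => ?_⟩
  have h2 := hbh z hz hzE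
  have h4 : ∏ j, (z - Complex.exp (Complex.I * (((a ∘ σ) j : ℝ) : ℂ))) = ∏ j, (z - e j) := by
    rw [← Equiv.prod_comp σ (fun j => z - e j)]
    exact Finset.prod_congr rfl fun j _ => by rw [← hexp]; rfl
  rw [principalForm, h4, ← hΛ, ← mul_div_assoc, ← hc]
  rw [hprod z hz, hb₁c z hz] at h2
  have h5 : ∏ j, (z - e j) ≠ 0 := by
    intro h; simp [h] at h2
  field_simp
  linear_combination h2

end

/-! ### Holomorphic flows: existence, uniqueness, extension. -/

section

open Metric

/-- `ψ` is a holomorphic solution of `ψ' = b(ψ)` on `V` with values in `U`. -/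
def IsFlow (b : ℂ → ℂ) (U V : Set ℂ) (ψ : ℂ → ℂ) : Prop :=
  ∀ ζ ∈ V, ψ ζ ∈ U ∧ HasDerivAt ψ (b (ψ ζ)) ζ

section flow

variable {b : ℂ → ℂ} {U : Set ℂ}

lemma IsFlow.mono {V W : Set ℂ} {ψ : ℂ → ℂ} (h : IsFlow b U V ψ) (hW : W ⊆ V) : IsFlow b U W ψ :=
  fun ζ hζ => h ζ (hW hζ)

lemma IsFlow.continuousAt {V : Set ℂ} {ψ : ℂ → ℂ} (h : IsFlow b U V ψ) {ζ : ℂ} (hζ : ζ ∈ V) :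
    ContinuousAt ψ ζ := (h ζ hζ).2.continuousAt

lemma IsFlow.differentiableOn {V : Set ℂ} {ψ : ℂ → ℂ} (h : IsFlow b U V ψ) :
    DifferentiableOn ℂ ψ V := fun ζ hζ => (h ζ hζ).2.differentiableAt.differentiableWithinAt

lemma IsFlow.congr {V : Set ℂ} {ψ φ : ℂ → ℂ} (h : IsFlow b U V ψ) (hV : IsOpen V)
    (he : EqOn φ ψ V) : IsFlow b U V φ := by
  intro ζ hζ
  rw [he hζ]
  exact ⟨(h ζ hζ).1, (h ζ hζ).2.congr_of_eventuallyEq (he.eventuallyEq_of_mem (hV.mem_nhds hζ))⟩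

/-- A local coordinate `P` straightening the field `b`. -/
lemma exists_straightening (hU : IsOpen U) (hb : DifferentiableOn ℂ b U) (hb0 : ∀ z ∈ U, b z ≠ 0)
    {q : ℂ} (hq : q ∈ U) :
    ∃ (ρ : ℝ) (P L : ℂ → ℂ), 0 < ρ ∧ ball q ρ ⊆ U ∧ (∀ x ∈ ball q ρ, HasDerivAt P (b x)⁻¹ x) ∧
      (∀ᶠ x in 𝓝 q, L (P x) = x) ∧ (∀ᶠ w in 𝓝 (P q), L w ∈ U ∧ HasDerivAt L (b (L w)) w) := by
  obtain ⟨ρ, hρ, hball⟩ := Metric.isOpen_iff.1 hU q hq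
  have hbi : DifferentiableOn ℂ (fun x => (b x)⁻¹) (ball q ρ) :=
    (hb.mono hball).inv fun x hx => hb0 x (hball hx)
  obtain ⟨P, hP⟩ := hbi.isExactOn_ball
  have hPd : DifferentiableOn ℂ P (ball q ρ) := fun x hx =>
    (hP x hx).differentiableAt.differentiableWithinAt
  have hPs : HasStrictDerivAt P (b q)⁻¹ q := by
    have h1 := (hPd.analyticAt (isOpen_ball.mem_nhds (mem_ball_self hρ))).hasStrictDerivAt
    rwa [(hP q (mem_ball_self hρ)).deriv] at h1
  have hne : (b q)⁻¹ ≠ 0 := inv_ne_zero (hb0 q hq)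
  have hPe := hPs.hasStrictFDerivAt_equiv hne
  set e := hPe.toOpenPartialHomeomorph P
  have hqs : q ∈ e.source := hPe.mem_toOpenPartialHomeomorph_source
  have heP : ∀ x, e x = P x := fun x => rfl
  refine ⟨ρ, P, e.symm, hρ, hball, hP, ?_, ?_⟩
  · exact e.eventually_left_inverse hqs
  · have h1 : P q ∈ e.target := e.map_source hqs
    have h2 : ContinuousAt e.symm (P q) := e.continuousAt_symm h1
    have h3 : e.symm (P q) = q := e.left_inv hqs
    have h4 : ∀ᶠ w in 𝓝 (P q), e.symm w ∈ ball q ρ := by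
      apply h2.eventually_mem
      rw [h3]
      exact ball_mem_nhds _ hρ
    filter_upwards [h4, e.open_target.mem_nhds h1] with w hw hwt
    refine ⟨hball hw, ?_⟩
    have := HasDerivAt.of_local_left_inverse (e.continuousAt_symm hwt) (hP _ hw)
      (inv_ne_zero (hb0 _ (hball hw))) (e.eventually_right_inverse hwt)
    rwa [inv_inv] at this

/-- In the straightening coordinate the flow is translation. What matters is that one existence
radius `ε` serves all initial points near `q`. -/
lemma exists_flow (hU : IsOpen U) (hb : DifferentiableOn ℂ b U) (hb0 : ∀ z ∈ U, b z ≠ 0)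
    {q : ℂ} (hq : q ∈ U) :
    ∃ ε > 0, ∀ᶠ x in 𝓝 q, ∃ χ : ℂ → ℂ, χ 0 = x ∧ IsFlow b U (ball 0 ε) χ := by
  obtain ⟨ρ, P, L, hρ, hball, hP, hLP, hL⟩ := exists_straightening hU hb hb0 hq
  obtain ⟨δ, hδ, hLδ⟩ := Metric.eventually_nhds_iff_ball.1 hL
  refine ⟨δ / 2, by positivity, ?_⟩
  have h1 : ∀ᶠ x in 𝓝 q, P x ∈ ball (P q) (δ / 2) :=
    (hP q (mem_ball_self hρ)).continuousAt.eventually_mem (ball_mem_nhds _ (by positivity))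
  filter_upwards [hLP, h1] with x hx hx2
  refine ⟨fun ζ => L (P x + ζ), by simpa using hx, fun ζ hζ => ?_⟩
  have h2 : P x + ζ ∈ ball (P q) δ := by
    rw [mem_ball, dist_eq_norm] at hx2 ⊢
    rw [mem_ball_zero_iff] at hζ
    calc ‖P x + ζ - P q‖ = ‖(P x - P q) + ζ‖ := by ring_nf
      _ ≤ ‖P x - P q‖ + ‖ζ‖ := norm_add_le _ _
      _ < δ := by linarith
  refine ⟨(hLδ _ h2).1, ?_⟩
  have := (hLδ _ h2).2.comp ζ ((hasDerivAt_id ζ).const_add (P x))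
  rwa [mul_one] at this

/-- Near `ζ₀` the function `P (χ ζ) - ζ` is constant for each solution `χ`, which determines `χ` by
its initial value. The identity theorem does the rest. -/
lemma IsFlow.eqOn (hU : IsOpen U) (hb : DifferentiableOn ℂ b U) (hb0 : ∀ z ∈ U, b z ≠ 0)
    {V : Set ℂ} (hV : IsOpen V) (hVc : IsPreconnected V) {ψ φ : ℂ → ℂ} (hψ : IsFlow b U V ψ)
    (hφ : IsFlow b U V φ) {ζ₀ : ℂ} (hζ₀ : ζ₀ ∈ V) (h0 : ψ ζ₀ = φ ζ₀) : EqOn ψ φ V := by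
  refine (hψ.differentiableOn.analyticOnNhd hV).eqOn_of_preconnected_of_eventuallyEq
    (hφ.differentiableOn.analyticOnNhd hV) hVc hζ₀ ?_
  obtain ⟨ρ, P, L, hρ, hball, hP, hLP, -⟩ := exists_straightening hU hb hb0 (hψ ζ₀ hζ₀).1
  have key : ∀ χ : ℂ → ℂ, IsFlow b U V χ → χ ζ₀ = ψ ζ₀ →
      ∀ᶠ ζ in 𝓝 ζ₀, χ ζ = L (P (ψ ζ₀) + (ζ - ζ₀)) := by
    intro χ hχ hχ0
    have hc := hχ.continuousAt hζ₀
    have hmem : ∀ᶠ ζ in 𝓝 ζ₀, χ ζ ∈ ball (ψ ζ₀) ρ :=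
      hc.eventually_mem (by rw [hχ0]; exact ball_mem_nhds _ hρ)
    obtain ⟨ε, hε, hεb⟩ := Metric.eventually_nhds_iff_ball.1 (hmem.and (hV.mem_nhds hζ₀))
    have hd : ∀ ζ ∈ ball ζ₀ ε, HasDerivAt (fun ζ => P (χ ζ) - ζ) 0 ζ := by
      intro ζ hζ
      obtain ⟨h1, h2⟩ := hεb ζ hζ
      have h3 := ((hP _ h1).comp ζ (hχ ζ h2).2).sub (hasDerivAt_id ζ)
      rw [inv_mul_cancel₀ (hb0 _ (hball h1)), sub_self] at h3
      exact h3
    have hconst : ∀ ζ ∈ ball ζ₀ ε, P (χ ζ) - ζ = P (χ ζ₀) - ζ₀ := fun ζ hζ =>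
      isOpen_ball.is_const_of_deriv_eq_zero (convex_ball _ _).isPreconnected
        (fun w hw => (hd w hw).differentiableAt.differentiableWithinAt)
        (fun w hw => (hd w hw).deriv) hζ (mem_ball_self hε)
    have hLχ : ∀ᶠ ζ in 𝓝 ζ₀, L (P (χ ζ)) = χ ζ := by
      rw [ContinuousAt, hχ0] at hc
      exact hc.eventually hLP
    filter_upwards [hLχ, ball_mem_nhds _ hε] with ζ h1 h2
    rw [← h1]
    congr 1
    rw [← hχ0]
    linear_combination hconst ζ h2
  filter_upwards [key ψ hψ rfl, key φ hφ h0.symm] with ζ h1 h2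
  rw [h1, h2]

/-- If the solution along the radius to `ζ` clusters at a point of `U`, restarting it near that
point with the uniform existence radius passes beyond `ζ`. When this holds for every boundary point,
a Lebesgue number of the resulting cover of the circle gives a larger disc, and uniqueness glues the
pieces. -/
lemma IsFlow.exists_extension (hU : IsOpen U) (hb : DifferentiableOn ℂ b U)
    (hb0 : ∀ z ∈ U, b z ≠ 0) {r : ℝ} (hr : 0 < r) {ψ : ℂ → ℂ} (hψ : IsFlow b U (ball 0 r) ψ)
    (hcl : ∀ ζ : ℂ, ‖ζ‖ = r → ∃ q ∈ U, MapClusterPt q (𝓝[<] (1 : ℝ)) fun t => ψ (t * ζ)) :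
    ∃ r' > r, ∃ φ, φ 0 = ψ 0 ∧ IsFlow b U (ball 0 r') φ := by
  have hloc : ∀ ζ : sphere (0 : ℂ) r, ∃ ε > 0, ∃ χ, IsFlow b U (ball (ζ : ℂ) ε) χ ∧
      EqOn χ ψ (ball (ζ : ℂ) ε ∩ ball 0 r) := by
    rintro ⟨ζ, hζ⟩
    rw [mem_sphere_zero_iff_norm] at hζ
    obtain ⟨q, hqU, hq⟩ := hcl ζ hζ
    obtain ⟨ε, hε, hex⟩ := exists_flow hU hb hb0 hqU
    have h1 : ∀ᶠ t in 𝓝[<] (1:ℝ), t ∈ Ioo (max 0 (1 - ε / r)) 1 :=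
      Ioo_mem_nhdsLT (by simp; positivity)
    obtain ⟨t, ⟨χ, hχ0, hχ⟩, ht0, ht1⟩ := ((mapClusterPt_iff_frequently.1 hq _ hex).and_eventually h1).exists
    rw [max_lt_iff, sub_lt_comm, lt_div_iff₀ hr] at ht0
    have hn : ‖ζ - t * ζ‖ = (1 - t) * r := by
      rw [show ζ - t * ζ = ((1 - t : ℝ) : ℂ) * ζ by push_cast; ring, norm_mul, hζ, Complex.norm_real,
        Real.norm_of_nonneg (by linarith)]
    have hsub : ball ζ (ε - (1 - t) * r) ⊆ ball (t * ζ) ε := by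
      apply ball_subset_ball'
      rw [dist_eq_norm, hn]
      linarith
    have htb : (t : ℂ) * ζ ∈ ball (0 : ℂ) r := by
      rw [mem_ball_zero_iff, norm_mul, hζ, Complex.norm_real, Real.norm_of_nonneg ht0.1.le]
      nlinarith
    have hχ' : IsFlow b U (ball (t * ζ) ε) fun w => χ (w - t * ζ) := by
      intro w hw
      have h2 : w - t * ζ ∈ ball (0 : ℂ) ε := by
        rw [mem_ball_zero_iff, ← dist_eq_norm]; exact hw
      refine ⟨(hχ _ h2).1, ?_⟩
      have := (hχ _ h2).2.comp w ((hasDerivAt_id w).sub_const (t * ζ))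
      rwa [mul_one] at this
    refine ⟨ε - (1 - t) * r, by linarith, fun w => χ (w - t * ζ), hχ'.mono hsub, ?_⟩
    refine EqOn.mono (inter_subset_inter_left _ hsub) ?_
    exact IsFlow.eqOn hU hb hb0 (isOpen_ball.inter isOpen_ball)
      ((convex_ball _ _).inter (convex_ball _ _)).isPreconnected (hχ'.mono inter_subset_left)
      (hψ.mono inter_subset_right) (ζ₀ := t * ζ) ⟨mem_ball_self hε, htb⟩ (by simp [hχ0])
  choose ε hε χ hχ hχψ using hloc
  obtain ⟨δ, hδ, hδs⟩ := lebesgue_number_lemma_of_metric (isCompact_sphere (0 : ℂ) r)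
    (c := fun ζ : sphere (0 : ℂ) r => ball (ζ : ℂ) (ε ζ)) (fun _ => isOpen_ball)
    (fun ζ hζ => mem_iUnion.2 ⟨⟨ζ, hζ⟩, mem_ball_self (hε _)⟩)
  have : Nonempty (sphere (0 : ℂ) r) := ⟨⟨(r : ℂ), by simp [abs_of_pos hr]⟩⟩
  choose! i hi using hδs
  -- Radial projection to the circle selects the local solution to be used at a point outside the
  -- disc.
  set π : ℂ → ℂ := fun w => ((r / ‖w‖ : ℝ) : ℂ) * w with hπ
  have hπs : ∀ w, w ≠ 0 → π w ∈ sphere (0 : ℂ) r := by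
    intro w hw
    rw [mem_sphere_zero_iff_norm, hπ]
    simp only
    rw [norm_mul, Complex.norm_real, Real.norm_of_nonneg (by positivity)]
    field_simp
  have hπd : ∀ w, w ≠ 0 → r ≤ ‖w‖ → dist w (π w) = ‖w‖ - r := by
    intro w hw hrw
    have hw' := norm_pos_iff.2 hw
    rw [dist_eq_norm, hπ]
    simp only
    rw [show w - ((r / ‖w‖ : ℝ) : ℂ) * w = ((1 - r / ‖w‖ : ℝ) : ℂ) * w by push_cast; ring,
      norm_mul, Complex.norm_real, Real.norm_of_nonneg (by
        rw [sub_nonneg, div_le_one hw']; exact hrw)]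
    field_simp
  set Ψ : ℂ → ℂ := fun w => if ‖w‖ < r then ψ w else χ (i (π w)) w with hΨ
  refine ⟨r + δ, by linarith, Ψ, by simp [hΨ, hr], fun w₀ hw₀ => ?_⟩
  rw [mem_ball_zero_iff] at hw₀
  by_cases hlt : ‖w₀‖ < r
  · have h0 : w₀ ∈ ball (0 : ℂ) r := by simpa using hlt
    have h1 : EqOn Ψ ψ (ball 0 r) := fun w hw => by
      rw [mem_ball_zero_iff] at hw
      simp [hΨ, hw]
    exact hψ.congr isOpen_ball h1 w₀ h0
  · rw [not_lt] at hlt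
    have hw₀0 : w₀ ≠ 0 := norm_pos_iff.1 (by linarith)
    set x₀ := π w₀ with hx₀
    have hx₀s : x₀ ∈ sphere (0 : ℂ) r := hπs w₀ hw₀0
    have hx₀n : ‖x₀‖ = r := by simpa using hx₀s
    have hwx : w₀ ∈ ball x₀ δ := by
      rw [mem_ball, hπd w₀ hw₀0 hlt]; linarith
    have hπc : ContinuousAt π w₀ := by
      have : ContinuousAt (fun w : ℂ => r / ‖w‖) w₀ :=
        continuousAt_const.div continuous_norm.continuousAt (by simpa using hw₀0)
      exact (Complex.continuous_ofReal.continuousAt.comp this).mul continuousAt_id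
    have heq : Ψ =ᶠ[𝓝 w₀] χ (i x₀) := by
      have h1 : ∀ᶠ w in 𝓝 w₀, π w ∈ ball x₀ (δ / 2) :=
        hπc.eventually_mem (ball_mem_nhds _ (by positivity))
      have h2 : ∀ᶠ w in 𝓝 w₀, ‖w‖ < r + δ := continuous_norm.continuousAt.eventually_lt_const hw₀
      filter_upwards [h1, h2, isOpen_ball.mem_nhds hwx, isOpen_ne.mem_nhds hw₀0] with w h1 h2 h3 h4
      by_cases hw : ‖w‖ < r
      · simp only [hΨ, hw, if_true]
        exact (hχψ (i x₀) ⟨hi x₀ hx₀s h3, by simpa using hw⟩).symm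
      · simp only [hΨ, hw, if_false]
        rw [not_lt] at hw
        have hx := hπs w h4
        have hwb : w ∈ ball (π w) δ := by
          rw [mem_ball, hπd w h4 hw]; linarith
        -- a point of the disc close to both centres
        set s : ℝ := max 0 (1 - δ / (4 * r)) with hs
        have hs1 : s < 1 := by rw [hs]; simp; positivity
        have hs0 : 0 ≤ s := le_max_left _ _
        have hs2 : 1 - δ / (4 * r) ≤ s := le_max_right _ _
        have hsd : ‖(s : ℂ) * x₀ - x₀‖ < δ / 2 := by
          rw [show (s : ℂ) * x₀ - x₀ = ((s - 1 : ℝ) : ℂ) * x₀ by push_cast; ring, norm_mul, hx₀n,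
            Complex.norm_real, Real.norm_of_nonpos (by linarith)]
          calc -(s - 1) * r ≤ δ / (4 * r) * r := by
                apply mul_le_mul_of_nonneg_right _ hr.le; linarith
            _ = δ / 4 := by field_simp
            _ < δ / 2 := by linarith
        have hp0 : (s : ℂ) * x₀ ∈ ball (0 : ℂ) r := by
          rw [mem_ball_zero_iff, norm_mul, hx₀n, Complex.norm_real, Real.norm_of_nonneg hs0]
          nlinarith
        have hp1 : (s : ℂ) * x₀ ∈ ball x₀ δ := by
          rw [mem_ball, dist_eq_norm]; linarith
        have hp2 : (s : ℂ) * x₀ ∈ ball (π w) δ := by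
          rw [mem_ball]
          rw [mem_ball, dist_comm] at h1
          calc dist ((s : ℂ) * x₀) (π w) ≤ dist ((s : ℂ) * x₀) x₀ + dist x₀ (π w) :=
                dist_triangle _ _ _
            _ < δ := by rw [dist_eq_norm]; linarith
        have h5 := IsFlow.eqOn hU hb hb0 (isOpen_ball.inter isOpen_ball)
          ((convex_ball _ _).inter (convex_ball _ _)).isPreconnected
          (((hχ (i (π w))).mono (hi _ hx)).mono (inter_subset_left (t := ball x₀ δ)))
          (((hχ (i x₀)).mono (hi _ hx₀s)).mono inter_subset_right) (ζ₀ := s * x₀) ⟨hp2, hp1⟩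
          ((hχψ _ ⟨hi _ hx hp2, hp0⟩).trans (hχψ _ ⟨hi _ hx₀s hp1, hp0⟩).symm)
        exact h5 ⟨hwb, h3⟩
    have h6 := (hχ (i x₀)) w₀ (hi x₀ hx₀s hwx)
    rw [heq.self_of_nhds]
    exact ⟨h6.1, h6.2.congr_of_eventuallyEq heq⟩

end flow

end

/-! ### Complete punctures are poles. -/

section

open Metric

/-- A maximal disc of existence has a boundary point along whose radius the solution leaves
every compact subset of `U`. -/
lemma exists_maximal_flow {b : ℂ → ℂ} {U : Set ℂ} (hU : IsOpen U) (hb : DifferentiableOn ℂ b U)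
    (hb0 : ∀ z ∈ U, b z ≠ 0) {z₀ : ℂ} (hz₀ : z₀ ∈ U) {ρ : ℝ}
    (hbd : ∀ r ψ, 0 < r → ψ 0 = z₀ → IsFlow b U (ball 0 r) ψ → r ≤ ρ) :
    ∃ r ψ, 0 < r ∧ ψ 0 = z₀ ∧ IsFlow b U (ball 0 r) ψ ∧
      ∃ ζ : ℂ, ‖ζ‖ = r ∧ ∀ q ∈ U, ¬ MapClusterPt q (𝓝[<] (1 : ℝ)) fun t => ψ (t * ζ) := by
  -- By uniqueness the solutions on the discs with radii in `T` agree, so they fit together on the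
  -- disc of radius `sSup T`. Cluster points in `U` along all radii would contradict the supremum.
  set T : Set ℝ := {r | 0 < r ∧ ∃ ψ, ψ 0 = z₀ ∧ IsFlow b U (ball 0 r) ψ} with hT
  have hTne : T.Nonempty := by
    obtain ⟨ε, hε, h⟩ := exists_flow hU hb hb0 hz₀
    exact ⟨ε, hε, h.self_of_nhds⟩
  have hTb : BddAbove T := ⟨ρ, fun r ⟨hr, ψ, h0, hψ⟩ => hbd r ψ hr h0 hψ⟩
  have hpos : 0 < sSup T := by
    obtain ⟨r, hr⟩ := hTne
    exact hr.1.trans_le (le_csSup hTb hr)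
  have hex : ∀ ζ ∈ ball (0 : ℂ) (sSup T), ∃ r ψ, ζ ∈ ball (0 : ℂ) r ∧ ψ 0 = z₀ ∧
      IsFlow b U (ball 0 r) ψ := by
    intro ζ hζ
    rw [mem_ball_zero_iff] at hζ
    obtain ⟨r, ⟨hr, ψ, h0, hψ⟩, hlt⟩ := exists_lt_of_lt_csSup hTne hζ
    exact ⟨r, ψ, by simpa using hlt, h0, hψ⟩
  choose! R Ψ hR h0 hΨ using hex
  have hflow : IsFlow b U (ball 0 (sSup T)) fun ζ => Ψ ζ ζ := by
    intro ζ hζ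
    have heq : (fun w => Ψ w w) =ᶠ[𝓝 ζ] Ψ ζ := by
      filter_upwards [isOpen_ball.mem_nhds hζ, isOpen_ball.mem_nhds (hR ζ hζ)] with w h1 h2
      have h3 : (0 : ℂ) ∈ ball (0 : ℂ) (R w) :=
        mem_ball_self (pos_of_mem_ball (hR w h1))
      have h4 : (0 : ℂ) ∈ ball (0 : ℂ) (R ζ) :=
        mem_ball_self (pos_of_mem_ball (hR ζ hζ))
      exact IsFlow.eqOn hU hb hb0 (isOpen_ball.inter isOpen_ball)
        ((convex_ball _ _).inter (convex_ball _ _)).isPreconnected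
        ((hΨ w h1).mono inter_subset_left) ((hΨ ζ hζ).mono inter_subset_right) ⟨h3, h4⟩
        ((h0 w h1).trans (h0 ζ hζ).symm) ⟨hR w h1, h2⟩
    have h5 := hΨ ζ hζ ζ (hR ζ hζ)
    exact ⟨h5.1, h5.2.congr_of_eventuallyEq heq⟩
  have hψ0 : (fun ζ => Ψ ζ ζ) 0 = z₀ := h0 0 (mem_ball_self hpos)
  refine ⟨sSup T, fun ζ => Ψ ζ ζ, hpos, hψ0, hflow, ?_⟩
  by_contra! hcon
  obtain ⟨r', hr', φ, hφ0, hφ⟩ := hflow.exists_extension hU hb hb0 hpos hcon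
  have : r' ∈ T := ⟨hpos.trans hr', φ, hφ0.trans hψ0, hφ⟩
  exact absurd (le_csSup hTb this) (not_le.2 hr')

/-- The metric `|a| |dz|` on the punctured disc is complete at the puncture `e`. -/
def IsCompleteAt (a : ℂ → ℂ) (e : ℂ) (R : ℝ) : Prop :=
  ∀ y : ℝ → ℂ, (∀ t ∈ Ico (0 : ℝ) 1, y t ∈ ball e R \ {e} ∧ ContDiffAt ℝ 1 y t) →
    Tendsto y (𝓝[<] 1) (𝓝 e) →
    ∫⁻ t in Ico (0 : ℝ) 1, ENNReal.ofReal (‖a (y t)‖ * ‖deriv y t‖) = ⊤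

lemma lintegral_ne_top_of_le {u : ℝ → ℝ} {C : ℝ} (h : ∀ t ∈ Ico (0 : ℝ) 1, u t ≤ C) :
    ∫⁻ t in Ico (0 : ℝ) 1, ENNReal.ofReal (u t) ≠ ⊤ := by
  have h1 : ∫⁻ t in Ico (0 : ℝ) 1, ENNReal.ofReal (u t) ≤
      ∫⁻ _ in Ico (0 : ℝ) 1, ENNReal.ofReal C :=
    MeasureTheory.setLIntegral_mono measurable_const fun t ht =>
      ENNReal.ofReal_le_ofReal (h t ht)
  refine ne_top_of_le_ne_top ?_ h1
  simp

/-- Suppose `b = 1 / a` is very large at `z₀`. The flow of `b` from `z₀` has bounded values and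
large derivative at time `0`, so its maximal disc is small. Some radius of that disc leaves every
compact subset of the punctured ball; it has too little time to cross the outer annulus, so it tends
to the puncture. Since `a(ψ) ψ' = 1`, its length in the metric `|a| |dz|` is at most the radius of
the disc, against completeness. -/
lemma norm_inv_le_of_isCompleteAt {a : ℂ → ℂ} {e : ℂ} {R : ℝ} (hR : 0 < R)
    (ha : DifferentiableOn ℂ a (ball e R \ {e})) (ha0 : ∀ z ∈ ball e R \ {e}, a z ≠ 0)
    (hc : IsCompleteAt a e R) : ∃ C, ∀ z ∈ ball e (R / 2) \ {e}, ‖(a z)⁻¹‖ ≤ C := by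
  set U := ball e R \ {e} with hUdef
  set b : ℂ → ℂ := fun z => (a z)⁻¹ with hb'
  have hU : IsOpen U := isOpen_ball.sdiff isClosed_singleton
  have hb : DifferentiableOn ℂ b U := ha.inv ha0
  have hb0 : ∀ z ∈ U, b z ≠ 0 := fun z hz => inv_ne_zero (ha0 z hz)
  -- bound on the annulus
  set A : Set ℂ := closedBall e (3 * R / 4) \ ball e (R / 2) with hA
  have hAU : A ⊆ U := by
    rintro z ⟨h1, h2⟩
    refine ⟨closedBall_subset_ball (by linarith) h1, ?_⟩
    rintro rfl
    exact h2 (mem_ball_self (by positivity))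
  have hAc : IsCompact A := (isCompact_closedBall _ _).diff isOpen_ball
  obtain ⟨M, hM⟩ := hAc.exists_bound_of_continuousOn (hb.continuousOn.mono hAU)
  set M' := max M 0 + 1 with hM'
  have hM'0 : 0 < M' := by positivity
  have hMM : M < M' := by rw [hM']; linarith [le_max_left M 0]
  -- On the annulus the speed is below `M' δ = R / 4` per unit of `t` when the radius is less than
  -- `δ`. Starting within `R / 2` of `e`, the path stays within `3 R / 4`.
  set δ := R / (4 * M') with hδ
  have hδ0 : 0 < δ := by positivity
  refine ⟨2 * R / δ, fun z₀ hz₀ => ?_⟩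
  have hz₀U : z₀ ∈ U := ⟨ball_subset_ball (by linarith) hz₀.1, hz₀.2⟩
  by_contra! hlt
  have hbz : 0 < ‖b z₀‖ := norm_pos_iff.2 (hb0 z₀ hz₀U)
  -- A map of the disc of radius `r` into a ball of radius `2 R` about its value at `0` has
  -- derivative at most `2 R / r` there.
  have hbd' : ∀ r ψ, 0 < r → ψ 0 = z₀ → IsFlow b U (ball 0 r) ψ → r ≤ 2 * R / ‖b z₀‖ := by
    intro r ψ hr h0 hψ
    have h1 := Complex.norm_deriv_le_div_of_mapsTo_ball (R₂ := 2 * R) hψ.differentiableOn (by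
      intro ζ hζ
      have h2 := (hψ ζ hζ).1.1
      have h3 := hz₀U.1
      rw [mem_ball] at h2 h3
      rw [mem_closedBall, h0]
      calc dist (ψ ζ) z₀ ≤ dist (ψ ζ) e + dist e z₀ := dist_triangle _ _ _
        _ ≤ 2 * R := by rw [dist_comm e]; linarith) hr
    rw [(hψ 0 (mem_ball_self hr)).2.deriv, h0, le_div_iff₀ hr] at h1
    rw [le_div_iff₀ hbz]
    linarith
  obtain ⟨r, ψ, hr, h0, hψ, ζ, hζ, hζc⟩ := exists_maximal_flow hU hb hb0 hz₀U hbd'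
  have hrδ : r < δ := by
    refine (hbd' r ψ hr h0 hψ).trans_lt ?_
    rw [div_lt_iff₀ hbz]
    rw [div_lt_iff₀ hδ0] at hlt
    rw [mul_comm δ]
    exact hlt
  have hmem : ∀ t : ℝ, |t| < 1 → (t : ℂ) * ζ ∈ ball (0 : ℂ) r := by
    intro t ht
    rw [mem_ball_zero_iff, norm_mul, hζ, Complex.norm_real, Real.norm_eq_abs]
    nlinarith
  have hyd : ∀ t : ℝ, |t| < 1 → HasDerivAt (fun t : ℝ => ψ (t * ζ)) (b (ψ (t * ζ)) * ζ) t := by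
    intro t ht
    have h1 : HasDerivAt (fun t : ℝ => (t : ℂ) * ζ) ζ t := by
      simpa using ((hasDerivAt_id t).ofReal_comp).mul_const ζ
    exact (hψ _ (hmem t ht)).2.comp t h1
  have hyann : ∀ t ∈ Ico (0 : ℝ) 1, ‖ψ (t * ζ) - e‖ ≤ 3 * R / 4 := by
    intro T hT
    have habs : ∀ t ∈ Icc 0 T, |t| < 1 := fun t ht => by
      rw [abs_of_nonneg ht.1]; exact ht.2.trans_lt hT.2
    have h1 := image_norm_le_of_norm_deriv_right_lt_deriv_boundary (a := 0) (b := T)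
      (f := fun t : ℝ => ψ (t * ζ) - e) (f' := fun t => b (ψ (t * ζ)) * ζ)
      (B := fun t => R / 2 + (M' * δ) * t) (B' := fun _ => M' * δ)
      (fun t ht => ((hyd t (habs t ht)).sub_const e).continuousAt.continuousWithinAt)
      (fun t ht => ((hyd t (habs t (Ico_subset_Icc_self ht))).sub_const e).hasDerivWithinAt)
      (by
        have h2 := hz₀.1
        rw [mem_ball, dist_eq_norm] at h2
        simp [h0, h2.le])
      (fun t => by simpa using ((hasDerivAt_id t).const_mul (M' * δ)).const_add (R / 2))
      (by
        intro t ht hteq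
        have hMδ : M' * δ = R / 4 := by rw [hδ]; field_simp
        rw [hMδ] at hteq
        have ht1 : t ≤ 1 := ht.2.le.trans hT.2.le
        have hann : ψ (t * ζ) ∈ A := by
          refine ⟨?_, ?_⟩
          · rw [mem_closedBall, dist_eq_norm, hteq]; nlinarith
          · rw [mem_ball, dist_eq_norm, hteq, not_lt]; nlinarith [ht.1]
        rw [norm_mul, hζ]
        have := hM _ hann
        calc ‖b (ψ (t * ζ))‖ * r ≤ M * r := by gcongr
          _ ≤ M' * r := by gcongr
          _ < M' * δ := by gcongr)
      (right_mem_Icc.2 hT.1)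
    have hMδ : M' * δ = R / 4 := by rw [hδ]; field_simp
    rw [hMδ] at h1
    refine h1.trans ?_
    nlinarith [hT.2]
  -- the path tends to the puncture
  have htend : Tendsto (fun t : ℝ => ψ (t * ζ)) (𝓝[<] 1) (𝓝 e) := by
    by_contra hnt
    rw [Metric.tendsto_nhds] at hnt
    push Not at hnt
    obtain ⟨ε, hε, hfr⟩ := hnt
    have hK : IsCompact (closedBall e (3 * R / 4) \ ball e ε) :=
      (isCompact_closedBall _ _).diff isOpen_ball
    have h01 : ∀ᶠ t in 𝓝[<] (1:ℝ), t ∈ Ico (0:ℝ) 1 :=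
      Ico_mem_nhdsLT (by norm_num)
    have hfr2 : ∃ᶠ t : ℝ in 𝓝[<] (1 : ℝ), ψ (t * ζ) ∈ closedBall e (3 * R / 4) \ ball e ε := by
      refine (hfr.and_eventually h01).mono fun t ⟨h1, h2⟩ => ⟨?_, ?_⟩
      · rw [mem_closedBall, dist_eq_norm]; exact hyann t h2
      · exact not_lt.2 h1
    obtain ⟨q, hq, hqc⟩ := hK.exists_mapClusterPt_of_frequently hfr2
    refine hζc q ⟨closedBall_subset_ball (by linarith) hq.1, ?_⟩ hqc
    rintro rfl
    exact hq.2 (mem_ball_self hε)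
  -- reparametrize so that the path is `C¹` at the initial time
  set y : ℝ → ℂ := fun t => ψ (((1 + t) / 2 : ℝ) * ζ) with hy
  have habs : ∀ t ∈ Ico (0 : ℝ) 1, |(1 + t) / 2| < 1 := by
    intro t ht
    rw [abs_of_nonneg (by linarith [ht.1])]
    linarith [ht.2]
  have hyd' : ∀ t ∈ Ico (0 : ℝ) 1, HasDerivAt y ((1 / 2 : ℝ) • (b (y t) * ζ)) t := by
    intro t ht
    have h1 : HasDerivAt (fun t : ℝ => (1 + t) / 2) (1 / 2) t :=
      ((hasDerivAt_id t).const_add 1).div_const 2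
    exact (hyd _ (habs t ht)).scomp t h1
  have hlen := hc y (fun t ht => ⟨(hψ _ (hmem _ (habs t ht))).1, by
    have h1 : ContDiffAt ℂ 1 ψ (((1 + t) / 2 : ℝ) * ζ) :=
      (hψ.differentiableOn.analyticAt (isOpen_ball.mem_nhds (hmem _ (habs t ht)))).contDiffAt
    have h2 : ContDiffAt ℝ 1 (fun t : ℝ => (((1 + t) / 2 : ℝ) : ℂ) * ζ) t :=
      (Complex.ofRealCLM.contDiff.comp
        (show ContDiff ℝ 1 (fun t : ℝ => (1 + t) / 2) by fun_prop)).contDiffAt.mul contDiffAt_const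
    exact (h1.restrict_scalars ℝ).comp t h2⟩) (by
      have h1 : Tendsto (fun t : ℝ => (1 + t) / 2) (𝓝[<] 1) (𝓝[<] 1) := by
        refine tendsto_nhdsWithin_iff.2 ⟨?_, ?_⟩
        · have : ContinuousAt (fun t : ℝ => (1 + t) / 2) 1 := by fun_prop
          have h2 := this.tendsto
          norm_num at h2
          exact h2.mono_left nhdsWithin_le_nhds
        · filter_upwards [self_mem_nhdsWithin] with t ht
          have : t < 1 := ht
          show (1 + t) / 2 < 1
          linarith
      exact htend.comp h1)
  refine lintegral_ne_top_of_le (C := r) (fun t ht => ?_) hlen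
  rw [(hyd' t ht).deriv]
  have h1 : a (y t) * b (y t) = 1 := mul_inv_cancel₀ (ha0 _ (hψ _ (hmem _ (habs t ht))).1)
  have h2 : ‖a (y t)‖ * ‖b (y t)‖ = 1 := by rw [← norm_mul, h1, norm_one]
  rw [norm_smul, norm_mul, hζ, show ‖a (y t)‖ * (‖(1 / 2 : ℝ)‖ * (‖b (y t)‖ * r)) =
    (‖a (y t)‖ * ‖b (y t)‖) * (‖(1 / 2 : ℝ)‖ * r) by ring, h2]
  norm_num
  linarith

/-- At a complete puncture a zero-free holomorphic function has a pole. -/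
theorem exists_analyticAt_inv_of_isCompleteAt {a : ℂ → ℂ} {e : ℂ} {R : ℝ} (hR : 0 < R)
    (ha : DifferentiableOn ℂ a (ball e R \ {e})) (ha0 : ∀ z ∈ ball e R \ {e}, a z ≠ 0)
    (hc : IsCompleteAt a e R) :
    ∃ β : ℂ → ℂ, AnalyticAt ℂ β e ∧ β e = 0 ∧ ∀ᶠ z in 𝓝[≠] e, β z * a z = 1 := by
  obtain ⟨C, hC⟩ := norm_inv_le_of_isCompleteAt hR ha ha0 hc
  have hb : DifferentiableOn ℂ (fun z => (a z)⁻¹) (ball e (R / 2) \ {e}) :=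
    (ha.inv ha0).mono (sdiff_subset_sdiff_left (ball_subset_ball (by linarith)))
  have hnhds : ball e (R / 2) ∈ 𝓝 e := ball_mem_nhds _ (by positivity)
  have hd := Complex.differentiableOn_update_limUnder_of_bddAbove hnhds hb
    ⟨C, by rintro _ ⟨z, hz, rfl⟩; exact hC z hz⟩
  set β := Function.update (fun z => (a z)⁻¹) e (limUnder (𝓝[≠] e) fun z => (a z)⁻¹) with hβ
  have hβa : AnalyticAt ℂ β e := hd.analyticAt hnhds
  have hβe : ∀ z, z ≠ e → β z = (a z)⁻¹ := fun z hz => by simp [hβ, hz]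
  have hβ1 : ∀ᶠ z in 𝓝[≠] e, β z * a z = 1 := by
    filter_upwards [mem_nhdsWithin_of_mem_nhds (ball_mem_nhds e hR), self_mem_nhdsWithin]
      with z h1 h2
    rw [hβe z h2, inv_mul_cancel₀ (ha0 z ⟨h1, h2⟩)]
  refine ⟨β, hβa, ?_, hβ1⟩
  by_contra hne
  -- otherwise a radius has finite length
  have h1 : ∀ᶠ z in 𝓝 e, ‖β e‖ / 2 < ‖β z‖ :=
    hβa.continuousAt.norm.eventually_const_lt (by
      have := norm_pos_iff.2 hne; linarith)
  obtain ⟨ε, hε, hball⟩ := Metric.eventually_nhds_iff_ball.1 h1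
  set v : ℝ := min ε R / 2 with hv
  have hv0 : 0 < v := by positivity
  have hvε : v < ε := by
    have := min_le_left ε R; have : 0 < min ε R := by positivity
    rw [hv]; linarith
  have hvR : v < R := by
    have := min_le_right ε R; have : 0 < min ε R := by positivity
    rw [hv]; linarith
  set y : ℝ → ℂ := fun t => e + ((1 - t) * v : ℝ) with hy
  have hyn : ∀ t ∈ Ico (0 : ℝ) 1, ‖y t - e‖ ≤ v ∧ y t ≠ e := by
    intro t ht
    have h2 : 0 < (1 - t) * v := mul_pos (by linarith [ht.2]) hv0
    refine ⟨?_, ?_⟩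
    · simp only [hy, add_sub_cancel_left, Complex.norm_real, Real.norm_eq_abs]
      rw [abs_of_pos h2]; nlinarith [ht.1]
    · simp only [hy, ne_eq, add_eq_left, Complex.ofReal_eq_zero]
      exact h2.ne'
  have hyd : ∀ t, HasDerivAt y ((-v : ℝ) : ℂ) t := by
    intro t
    have h2 : HasDerivAt (fun t : ℝ => (1 - t) * v) (-v) t := by
      simpa using ((hasDerivAt_id t).const_sub 1).mul_const v
    exact (h2.ofReal_comp).const_add e
  have hlen := hc y (fun t ht => ⟨⟨by
      rw [mem_ball, dist_eq_norm]; exact (hyn t ht).1.trans_lt hvR, (hyn t ht).2⟩, by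
      have : ContDiff ℝ 1 y := contDiff_const.add
        (Complex.ofRealCLM.contDiff.comp (show ContDiff ℝ 1 (fun t : ℝ => (1 - t) * v) by fun_prop))
      exact this.contDiffAt⟩) (by
      have h2 : ContinuousAt y 1 := (hyd 1).continuousAt
      have h3 := h2.tendsto
      simp only [hy, sub_self, zero_mul, Complex.ofReal_zero, add_zero] at h3
      exact h3.mono_left nhdsWithin_le_nhds)
  refine lintegral_ne_top_of_le (C := 2 / ‖β e‖ * v) (fun t ht => ?_) hlen
  obtain ⟨h2, h3⟩ := hyn t ht
  have h4 := hball (y t) (by rw [mem_ball, dist_eq_norm]; linarith)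
  rw [hβe _ h3, norm_inv] at h4
  have hpos := norm_pos_iff.2 hne
  have h5 : 0 < ‖a (y t)‖ := norm_pos_iff.2 (ha0 _ ⟨by
    rw [mem_ball, dist_eq_norm]; linarith, h3⟩)
  rw [(hyd t).deriv, Complex.norm_real, norm_neg, Real.norm_of_nonneg hv0.le]
  refine mul_le_mul_of_nonneg_right ?_ hv0.le
  rw [div_lt_iff₀ two_pos, inv_mul_eq_div, lt_div_iff₀ h5] at h4
  rw [le_div_iff₀ hpos]
  linarith

end

section

open Matrix (GeneralLinearGroup)

/-! ### Coordinates on the sphere and Möbius transformations -/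

@[simp] lemma paramAt_coe (z w : ℂ) : paramAt (z : Sphere) w = (w : Sphere) := rfl

lemma paramAt_infty (w : ℂ) : paramAt ∞ w = if w = 0 then ∞ else ((w⁻¹ : ℂ) : Sphere) := rfl

@[simp] lemma coordAt_coe (z : ℂ) : coordAt (z : Sphere) = z := rfl

@[simp] lemma coordAt_infty : coordAt ∞ = 0 := rfl

@[simp] lemma chartFn_paramAt (p : Sphere) (w : ℂ) : chartFn p (paramAt p w) = w := by
  induction p using OnePoint.rec with
  | infty =>
    by_cases h : w = 0
    · simp [paramAt_infty, h, chartFn]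
    · simp [paramAt_infty, h, chartFn]
  | coe z => rfl

@[simp] lemma paramAt_coordAt (p : Sphere) : paramAt p (coordAt p) = p := by
  induction p using OnePoint.rec with
  | infty => simp [paramAt_infty]
  | coe z => rfl

lemma map_paramAt_nhds (p : Sphere) : map (paramAt p) (𝓝 (coordAt p)) = 𝓝 p := by
  induction p using OnePoint.rec with
  | infty =>
    rw [OnePoint.nhds_infty_eq, coordAt_infty, ← nhdsNE_sup_pure, Filter.map_sup, Filter.map_pure]
    congr 1
    · have h1 : map (paramAt ∞) (𝓝[≠] 0) = map (fun w : ℂ => ((w⁻¹ : ℂ) : Sphere)) (𝓝[≠] 0) := by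
        apply Filter.map_congr
        filter_upwards [self_mem_nhdsWithin] with w hw
        have : w ≠ 0 := hw
        simp [paramAt_infty, this]
      rw [h1, Filter.coclosedCompact_eq_cocompact, ← Metric.cobounded_eq_cocompact,
        ← Filter.inv_nhdsNE_zero, ← Filter.map_inv, Filter.map_map]
      rfl
    · simp [paramAt_infty]
  | coe z => rw [OnePoint.nhds_coe_eq]; rfl

lemma continuousAt_paramAt (p : Sphere) : ContinuousAt (paramAt p) (coordAt p) := by
  rw [ContinuousAt, paramAt_coordAt, ← map_paramAt_nhds p]
  exact tendsto_map

/-- The matrix of the parametrization `paramAt p`. -/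
def paramMatrix (p : Sphere) : GL (Fin 2) ℂ :=
  p.elim (GeneralLinearGroup.mkOfDetNeZero !![0, 1; 1, 0] (by simp)) (fun _ => 1)

lemma paramAt_eq_smul (p : Sphere) (w : ℂ) : paramAt p w = paramMatrix p • (w : Sphere) := by
  induction p using OnePoint.rec with
  | infty =>
    simp [paramAt_infty, paramMatrix, OnePoint.smul_some_eq_ite,
      GeneralLinearGroup.mkOfDetNeZero]
  | coe z => simp [paramMatrix]

/-- The charts are Möbius maps themselves, so the coordinate expression of `M` is the fractional
linear map of a conjugated matrix `N`. Finite source and target coordinates make its denominator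
nonzero, and the determinant makes its derivative nonzero. -/
lemma exists_mobius_coord (M : GL (Fin 2) ℂ) (p : Sphere) :
    ∃ μ : ℂ → ℂ, AnalyticAt ℂ μ (coordAt p) ∧ deriv μ (coordAt p) ≠ 0 ∧
      μ (coordAt p) = coordAt (M • p) ∧
      ∀ᶠ w in 𝓝 (coordAt p), M • paramAt p w = paramAt (M • p) (μ w) := by
  set N := (paramMatrix (M • p))⁻¹ * M * paramMatrix p with hN
  set c := coordAt p
  have h1 : N • (c : Sphere) = (coordAt (M • p) : Sphere) := by
    rw [hN, mul_smul, mul_smul, ← paramAt_eq_smul, paramAt_coordAt, inv_smul_eq_iff,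
      ← paramAt_eq_smul, paramAt_coordAt]
  rw [OnePoint.smul_some_eq_ite] at h1
  have hden : N 1 0 * c + N 1 1 ≠ 0 := by
    intro h
    rw [if_pos h] at h1
    exact OnePoint.infty_ne_coe _ h1
  rw [if_neg hden] at h1
  have hden' : ∀ᶠ w in 𝓝 c, N 1 0 * w + N 1 1 ≠ 0 := by
    have : ContinuousAt (fun w => N 1 0 * w + N 1 1) c := by fun_prop
    exact this.eventually_ne hden
  have hdet : N 0 0 * N 1 1 - N 0 1 * N 1 0 ≠ 0 := by
    have := N.det_ne_zero
    rwa [Matrix.det_fin_two] at this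
  refine ⟨fun w => (N 0 0 * w + N 0 1) / (N 1 0 * w + N 1 1), ?_, ?_, ?_, ?_⟩
  · exact ((analyticAt_const.mul analyticAt_id).add analyticAt_const).div
      ((analyticAt_const.mul analyticAt_id).add analyticAt_const) hden
  · have h2 := (((hasDerivAt_id c).const_mul (N 0 0)).add_const (N 0 1)).div
      (((hasDerivAt_id c).const_mul (N 1 0)).add_const (N 1 1)) hden
    have h3 := h2.deriv
    simp only [id] at h3
    intro h4
    rw [show (fun w => (N 0 0 * w + N 0 1) / (N 1 0 * w + N 1 1)) =
      ((fun w => N 0 0 * w + N 0 1) / (fun w => N 1 0 * w + N 1 1)) from rfl] at h4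
    rw [h4, eq_comm, div_eq_zero_iff] at h3
    refine h3.elim (fun h => hdet ?_) (fun h => hden (pow_eq_zero_iff two_ne_zero |>.1 h))
    linear_combination h
  · exact OnePoint.coe_eq_coe.1 h1
  · filter_upwards [hden'] with w hw
    rw [paramAt_eq_smul, paramAt_eq_smul]
    have h2 : N • (w : Sphere) = (((N 0 0 * w + N 0 1) / (N 1 0 * w + N 1 1) : ℂ) : Sphere) := by
      rw [OnePoint.smul_some_eq_ite, if_neg hw]
    rw [← h2, hN, mul_smul, mul_smul, smul_inv_smul]

lemma continuous_smul_sphere (M : GL (Fin 2) ℂ) : Continuous fun p : Sphere => M • p := by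
  rw [continuous_iff_continuousAt]
  intro p
  obtain ⟨μ, hμ, -, hμc, hM⟩ := exists_mobius_coord M p
  rw [ContinuousAt, ← map_paramAt_nhds p, tendsto_map'_iff]
  have h1 : ContinuousAt (fun w => paramAt (M • p) (μ w)) (coordAt p) := by
    apply ContinuousAt.comp (g := paramAt (M • p)) (f := μ)
    · rw [hμc]; exact continuousAt_paramAt _
    · exact hμ.continuousAt
  have h2 := h1.tendsto
  rw [hμc, paramAt_coordAt] at h2
  exact h2.congr' (by filter_upwards [hM] with w hw using hw.symm)

lemma isHolo_smul (M : GL (Fin 2) ℂ) : IsHolo fun p => M • p := by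
  intro p
  refine ⟨(continuous_smul_sphere M).continuousAt, ?_⟩
  obtain ⟨μ, hμ, -, hμc, hM⟩ := exists_mobius_coord M p
  refine hμ.differentiableAt.congr_of_eventuallyEq ?_
  filter_upwards [hM] with w hw
  rw [hw, chartFn_paramAt]

end

section

open Matrix (GeneralLinearGroup)

/-! ### Anti-holomorphic involutions of the sphere -/

lemma eventually_eq_paramAt (p : Sphere) : ∀ᶠ q in 𝓝 p, q = paramAt p (chartFn p q) := by
  rw [← map_paramAt_nhds p, eventually_map]
  exact Eventually.of_forall fun w => by rw [chartFn_paramAt]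

/-- In coordinates the conjugate of the new map is `conj ∘ ν ∘ conj ∘ k ∘ μ`, with `μ`, `ν` and `k`
holomorphic, and conjugation on both sides of `ν` preserves holomorphy. -/
lemma IsAntiHolo.conj_smul {I : Sphere → Sphere} (hI : IsAntiHolo I) (N : GL (Fin 2) ℂ) :
    IsAntiHolo fun q => N⁻¹ • I (N • q) := by
  intro q
  obtain ⟨hc, hd⟩ := hI (N • q)
  obtain ⟨μ, hμ, -, hμc, hN⟩ := exists_mobius_coord N q
  obtain ⟨ν, hν, -, hνc, hN'⟩ := exists_mobius_coord N⁻¹ (I (N • q))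
  refine ⟨?_, ?_⟩
  · exact (continuous_smul_sphere _).continuousAt.comp
      (hc.comp (continuous_smul_sphere N).continuousAt)
  set k : ℂ → ℂ := fun w => conj (chartFn (I (N • q)) (I (paramAt (N • q) w))) with hk
  have hkc : conj (k (coordAt (N • q))) = coordAt (I (N • q)) := by
    simp only [hk, Complex.conj_conj, paramAt_coordAt]
    rfl
  have hIk : ∀ᶠ w in 𝓝 (coordAt (N • q)),
      I (paramAt (N • q) w) = paramAt (I (N • q)) (conj (k w)) := by
    have h1 : Tendsto (fun w => I (paramAt (N • q) w)) (𝓝 (coordAt (N • q))) (𝓝 (I (N • q))) := by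
      have := map_paramAt_nhds (N • q)
      rw [ContinuousAt, ← this, tendsto_map'_iff] at hc
      exact hc
    filter_upwards [h1.eventually (eventually_eq_paramAt _)] with w hw
    simpa [hk] using hw
  have hd2 : DifferentiableAt ℂ (fun w => conj (ν (conj (k (μ w))))) (coordAt q) := by
    have h1 : DifferentiableAt ℂ (conj ∘ ν ∘ conj) (k (coordAt (N • q))) := by
      rw [differentiableAt_conj_conj_iff, hkc]
      exact hν.differentiableAt
    have h2 : DifferentiableAt ℂ (k ∘ μ) (coordAt q) :=
      DifferentiableAt.comp _ (by rw [hμc]; exact hd) hμ.differentiableAt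
    have h3 : DifferentiableAt ℂ ((conj ∘ ν ∘ conj) ∘ (k ∘ μ)) (coordAt q) :=
      DifferentiableAt.comp _ (by rw [Function.comp_apply, hμc]; exact h1) h2
    exact h3
  refine hd2.congr_of_eventuallyEq ?_
  have h1 : Tendsto μ (𝓝 (coordAt q)) (𝓝 (coordAt (N • q))) := by
    rw [← hμc]; exact hμ.continuousAt
  have h2 : Tendsto (fun w => conj (k (μ w))) (𝓝 (coordAt q)) (𝓝 (coordAt (I (N • q)))) := by
    have h3 : ContinuousAt k (coordAt (N • q)) := hd.continuousAt
    have h4 := (Complex.continuous_conj.continuousAt.comp h3).tendsto.comp h1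
    simp only [Function.comp_def, hkc] at h4
    exact h4
  filter_upwards [hN, h1.eventually hIk, h2.eventually hN'] with w e1 e2 e3
  rw [e1, e2, e3, chartFn_paramAt]

/-- An anti-holomorphic involution of the sphere fixing `∞` is `z ↦ α z̄ + β`. -/
lemma exists_affine_of_isAntiHolo {J : Sphere → Sphere} (hJ : IsAntiHolo J)
    (hinv : ∀ p, J (J p) = p) (hinf : J ∞ = ∞) :
    ∃ α β : ℂ, ∀ z : ℂ, J z = ((α * conj z + β : ℂ) : Sphere) := by
  have hfin : ∀ z : ℂ, ∃ w : ℂ, J z = w := by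
    intro z
    induction h : J z using OnePoint.rec with
    | infty =>
      exfalso
      have := hinv z
      rw [h, hinf] at this
      exact OnePoint.infty_ne_coe _ this
    | coe w => exact ⟨w, rfl⟩
  choose j hj using hfin
  have hjj : ∀ z, j (j z) = z := by
    intro z
    have := hinv z
    rw [hj, hj] at this
    exact OnePoint.coe_eq_coe.1 this
  set h : ℂ → ℂ := fun z => conj (j z) with hh
  have hd : Differentiable ℂ h := by
    intro z
    have := (hJ z).2
    refine this.congr_of_eventuallyEq (Eventually.of_forall fun w => ?_)
    simp only [hh, paramAt_coe, hj]
    rfl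
  -- linear growth at infinity
  obtain ⟨K, hK⟩ : ∃ K, ∀ᶠ w in 𝓝[≠] (0 : ℂ), ‖(h w⁻¹)⁻¹‖ ≤ K * ‖w‖ := by
    have h1 := (hJ ∞).2
    rw [coordAt_infty] at h1
    obtain ⟨K, hK⟩ := h1.isBigO_sub.bound
    refine ⟨K, ?_⟩
    filter_upwards [hK.filter_mono nhdsWithin_le_nhds, self_mem_nhdsWithin] with w hw hw0
    have hw0' : w ≠ 0 := hw0
    simp only [paramAt_infty, hinf, hw0', if_false, hj, if_true, chartFn] at hw
    simpa [hh] using hw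
  set z₁ := j 0 with hz₁
  have hz : ∀ z, h z = 0 ↔ z = z₁ := by
    intro z
    simp only [hh, map_eq_zero]
    constructor
    · intro h0; rw [hz₁, ← h0, hjj]
    · rintro rfl; rw [hz₁, hjj]
  -- The involution gives `(conj ∘ h ∘ conj) ∘ h = id`, so the chain rule excludes a critical point.
  have hder : deriv h z₁ ≠ 0 := by
    have h1 : DifferentiableAt ℂ (conj ∘ h ∘ conj) (h z₁) := by
      rw [differentiableAt_conj_conj_iff]; exact hd _
    have h2 := h1.hasDerivAt.comp z₁ (hd z₁).hasDerivAt
    have h3 : (conj ∘ h ∘ conj) ∘ h = id := by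
      funext z
      simp [hh, hjj]
    rw [h3] at h2
    have h4 := h2.unique (hasDerivAt_id z₁)
    exact right_ne_zero_of_mul_eq_one h4
  -- The quotient `h z / (z - z₁)` is entire and zero-free, and by the growth estimate its
  -- reciprocal is bounded. Liouville's theorem makes it constant.
  set k := dslope h z₁ with hk
  have hkd : Differentiable ℂ k := by
    rw [← differentiableOn_univ, hk, Complex.differentiableOn_dslope univ_mem]
    exact hd.differentiableOn
  have hkne : ∀ z, z ≠ z₁ → k z = h z / (z - z₁) := by
    intro z hz'
    rw [hk, dslope_of_ne _ hz', slope_def_field, (hz z₁).2 rfl, sub_zero]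
  have hk0 : ∀ z, k z ≠ 0 := by
    intro z
    by_cases hz' : z = z₁
    · rw [hz', hk, dslope_same]; exact hder
    · rw [hkne z hz']
      exact div_ne_zero (fun h0 => hz' ((hz z).1 h0)) (sub_ne_zero.2 hz')
  have hkid : Differentiable ℂ fun z => (k z)⁻¹ := fun z => (hkd z).inv (hk0 z)
  obtain ⟨a, ha⟩ : ∃ a, ∀ z, (k z)⁻¹ = a := by
    refine hkid.exists_const_forall_eq_of_bounded ?_
    obtain ⟨ε, hε, hball⟩ := Metric.eventually_nhds_iff_ball.1 (eventually_nhdsWithin_iff.1 hK)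
    have hc : IsCompact (Metric.closedBall (0 : ℂ) (max (2 / ε) (‖z₁‖ + 1))) :=
      isCompact_closedBall _ _
    obtain ⟨C, hC⟩ := hc.exists_bound_of_continuousOn hkid.continuous.continuousOn
    refine (isBounded_iff_forall_norm_le).2 ⟨max C (|K| * 2), ?_⟩
    rintro _ ⟨z, rfl⟩
    by_cases hzb : z ∈ Metric.closedBall (0 : ℂ) (max (2 / ε) (‖z₁‖ + 1))
    · exact (hC z hzb).trans (le_max_left _ _)
    · rw [mem_closedBall_zero_iff, not_le, max_lt_iff] at hzb
      have hz0 : 0 < ‖z‖ := by linarith [norm_nonneg z₁]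
      have hzz : z ≠ z₁ := by rintro rfl; linarith
      have h1 := hball z⁻¹ (by
        rw [mem_ball_zero_iff, norm_inv, inv_lt_comm₀ hz0 hε]
        have : ε⁻¹ ≤ 2 / ε := by
          rw [div_eq_mul_inv]; have := inv_pos.2 hε; linarith
        linarith [hzb.1]) (inv_ne_zero (norm_pos_iff.1 hz0))
      rw [inv_inv, norm_inv z] at h1
      simp only
      rw [hkne z hzz, inv_div, div_eq_mul_inv, norm_mul]
      calc ‖z - z₁‖ * ‖(h z)⁻¹‖ ≤ (2 * ‖z‖) * (|K| * ‖z‖⁻¹) := by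
            apply mul_le_mul
            · linarith [norm_sub_le z z₁]
            · exact h1.trans (mul_le_mul_of_nonneg_right (le_abs_self K) (by positivity))
            · positivity
            · positivity
        _ = |K| * 2 := by field_simp
        _ ≤ _ := le_max_right _ _
  have hlin : ∀ z, h z = a⁻¹ * (z - z₁) := by
    intro z
    rw [← ha z, inv_inv]
    by_cases hz' : z = z₁
    · rw [hz', (hz z₁).2 rfl]; simp
    · rw [hkne z hz']
      field_simp [sub_ne_zero.2 hz']
  refine ⟨conj a⁻¹, -conj (a⁻¹ * z₁), fun z => ?_⟩
  rw [hj, OnePoint.coe_eq_coe]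
  have h1 : j z = conj (h z) := by simp [hh]
  rw [h1, hlin z, map_mul, map_sub, map_mul]
  ring

/-- With `p` at `∞` the involution is `z ↦ α conj z + β`. Being an involution forces `|α| = 1` and
`α conj β = -β`. The substitution `z ↦ s z + β / 2` with `s² = α` turns it into complex conjugation.
-/
theorem exists_conj_coord {I : Sphere → Sphere} (hI : IsAntiHolo I) (hinv : ∀ p, I (I p) = p)
    {p : Sphere} (hp : I p = p) :
    ∃ N : GL (Fin 2) ℂ, N • (∞ : Sphere) = p ∧
      ∀ z : ℂ, I (N • (z : Sphere)) = N • ((conj z : ℂ) : Sphere) := by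
  obtain ⟨N₀, hN₀⟩ : ∃ N₀ : GL (Fin 2) ℂ, N₀ • (∞ : Sphere) = p := by
    induction p using OnePoint.rec with
    | infty => exact ⟨1, one_smul _ _⟩
    | coe z =>
      refine ⟨GeneralLinearGroup.mkOfDetNeZero !![z, 1; 1, 0] (by simp), ?_⟩
      simp [OnePoint.smul_infty_eq_ite, GeneralLinearGroup.mkOfDetNeZero]
  obtain ⟨α, β, hJ⟩ := exists_affine_of_isAntiHolo (hI.conj_smul N₀)
    (fun q => by simp [smul_inv_smul, hinv]) (by simp [hN₀, hp, inv_smul_eq_iff])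
  have hJJ : ∀ z : ℂ, α * conj (α * conj z + β) + β = z := by
    intro z
    have h1 := hJ (α * conj z + β)
    rw [← hJ z, smul_inv_smul, hinv, inv_smul_smul] at h1
    exact (OnePoint.coe_eq_coe.1 h1).symm
  have hβ : α * conj β + β = 0 := by simpa using hJJ 0
  have hα : α * conj α = 1 := by
    have := hJJ 1
    simp only [map_add, map_one, mul_one] at this
    linear_combination this - hβ
  have hα0 : α ≠ 0 := left_ne_zero_of_mul_eq_one hα
  obtain ⟨s, hs⟩ : ∃ s : ℂ, s ^ 2 = α := IsAlgClosed.exists_pow_nat_eq α two_pos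
  have hs0 : s ≠ 0 := by rintro rfl; simp at hs; exact hα0 hs.symm
  have hss : s * conj s = 1 := by
    have h1 : (s * conj s) ^ 2 = 1 := by
      rw [mul_pow, ← map_pow, hs, hα]
    rw [Complex.mul_conj] at h1 ⊢
    have h2 : Complex.normSq s ^ 2 = 1 := by exact_mod_cast h1
    have h3 : Complex.normSq s = 1 := by
      nlinarith [Complex.normSq_nonneg s]
    rw [h3, Complex.ofReal_one]
  refine ⟨N₀ * GeneralLinearGroup.mkOfDetNeZero !![s, β / 2; 0, 1] (by simp [hs0]), ?_, ?_⟩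
  · rw [mul_smul, OnePoint.smul_infty_eq_ite]
    simpa [GeneralLinearGroup.mkOfDetNeZero] using hN₀
  · have hB : ∀ z : ℂ, GeneralLinearGroup.mkOfDetNeZero !![s, β / 2; 0, 1] (by simp [hs0]) •
        (z : Sphere) = ((s * z + β / 2 : ℂ) : Sphere) := by
      intro z
      rw [OnePoint.smul_some_eq_ite]
      simp [GeneralLinearGroup.mkOfDetNeZero]
    intro z
    rw [mul_smul, mul_smul, hB, hB, ← inv_smul_eq_iff, hJ, OnePoint.coe_eq_coe]
    simp only [map_add, map_mul, map_div₀, Complex.conj_ofNat]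
    rw [← hs] at hβ ⊢
    linear_combination s * conj z * hss + hβ / 2

/-- Coordinates in which the involution is the reflection in the unit circle. -/
theorem exists_circle_coord {I : Sphere → Sphere} (hI : IsAntiHolo I) (hinv : ∀ p, I (I p) = p)
    {p q : Sphere} (hp : I p = p) (hq : I q ≠ q) :
    ∃ M : GL (Fin 2) ℂ, M • ((1 : ℂ) : Sphere) = p ∧ M • ((0 : ℂ) : Sphere) = q ∧
      I (M • ((0 : ℂ) : Sphere)) = M • (∞ : Sphere) ∧
      ∀ z : ℂ, z ≠ 0 → I (M • (z : Sphere)) = M • (((conj z)⁻¹ : ℂ) : Sphere) := by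
  obtain ⟨N, hN, hIN⟩ := exists_conj_coord hI hinv hp
  obtain ⟨c, rfl⟩ : ∃ c : ℂ, q = N • (c : Sphere) := by
    induction h : N⁻¹ • q using OnePoint.rec with
    | infty =>
      exfalso
      rw [inv_smul_eq_iff, hN] at h
      exact hq (h ▸ hp)
    | coe c => exact ⟨c, inv_smul_eq_iff.1 h⟩
  have hc : c - conj c ≠ 0 := by
    intro h
    rw [hIN, ← sub_eq_zero.1 h] at hq
    exact hq rfl
  have hdet : (!![-conj c, c; -1, 1] : Matrix (Fin 2) (Fin 2) ℂ).det ≠ 0 := by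
    rw [Matrix.det_fin_two_of]
    intro h; apply hc; linear_combination h
  -- The Cayley map with `0 ↦ c`, `∞ ↦ conj c`, `1 ↦ ∞`; it carries inversion in the unit circle to
  -- complex conjugation.
  set C := GeneralLinearGroup.mkOfDetNeZero !![-conj c, c; -1, 1] hdet with hC
  have hCz : ∀ z : ℂ, z ≠ 1 → C • (z : Sphere) = (((-conj c * z + c) / (1 - z) : ℂ) : Sphere) := by
    intro z hz
    have h1 : -1 * z + 1 ≠ 0 := by
      intro h; apply hz; linear_combination -h
    rw [OnePoint.smul_some_eq_ite]
    have e : C 0 0 = -conj c ∧ C 0 1 = c ∧ C 1 0 = -1 ∧ C 1 1 = 1 := ⟨rfl, rfl, rfl, rfl⟩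
    rw [e.1, e.2.1, e.2.2.1, e.2.2.2, if_neg h1, OnePoint.coe_eq_coe]
    congr 1
    ring
  have hC1 : C • ((1 : ℂ) : Sphere) = ∞ := by
    rw [OnePoint.smul_some_eq_ite]
    simp [hC, GeneralLinearGroup.mkOfDetNeZero]
  have hCi : C • (∞ : Sphere) = ((conj c : ℂ) : Sphere) := by
    rw [OnePoint.smul_infty_eq_ite]
    simp [hC, GeneralLinearGroup.mkOfDetNeZero]
  have hC0 : C • ((0 : ℂ) : Sphere) = (c : Sphere) := by
    rw [hCz 0 zero_ne_one]; simp
  refine ⟨N * C, by rw [mul_smul, hC1, hN], by rw [mul_smul, hC0],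
    by rw [mul_smul, mul_smul, hC0, hCi, hIN], fun z hz => ?_⟩
  rw [mul_smul, mul_smul]
  by_cases hz1 : z = 1
  · rw [hz1, hC1, hN, hp, map_one, inv_one, hC1, hN]
  · have h1 : conj z ≠ 1 := fun h => hz1 (by simpa using congrArg conj h)
    have h0 : conj z ≠ 0 := by simpa using hz
    have h2 : (conj z)⁻¹ ≠ 1 := by simpa using h1
    have h3 : 1 - conj z ≠ 0 := sub_ne_zero.2 h1.symm
    have h4 : conj z - 1 ≠ 0 := sub_ne_zero.2 h1
    rw [hCz z hz1, hIN, hCz _ h2]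
    congr 2
    simp only [map_div₀, map_add, map_mul, map_neg, map_sub, map_one, Complex.conj_conj]
    field_simp
    ring

lemma exists_ne_of_isAntiHolo {I : Sphere → Sphere} (hI : IsAntiHolo I)
    (hinv : ∀ p, I (I p) = p) {p : Sphere} (hp : I p = p) : ∃ q, I q ≠ q := by
  obtain ⟨N, hN, hIN⟩ := exists_conj_coord hI hinv hp
  refine ⟨N • ((Complex.I : ℂ) : Sphere), ?_⟩
  rw [hIN]
  intro h
  have h1 := OnePoint.coe_eq_coe.1 (smul_left_cancel N h)
  have h2 := congrArg Complex.im h1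
  norm_num at h2

end

section

/-! ### The holomorphic lift of a maxface in a chart -/

lemma liftDeriv_re (u : ℂ → R31) (k : Fin 3) (w : ℂ) : (liftDeriv u k w).re = dd u 1 w k := by
  simp [liftDeriv]

lemma liftDeriv_im (u : ℂ → R31) (k : Fin 3) (w : ℂ) :
    (liftDeriv u k w).im = -dd u Complex.I w k := by
  simp [liftDeriv]

lemma dd_eq_re (u : ℂ → R31) (a w : ℂ) (k : Fin 3) : dd u a w k = (liftDeriv u k w * a).re := by
  rw [Complex.mul_re, liftDeriv_re, liftDeriv_im]
  have h : a = a.re • (1 : ℂ) + a.im • Complex.I := by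
    apply Complex.ext <;> simp
  have : dd u a w = a.re • dd u 1 w + a.im • dd u Complex.I w := by
    unfold dd
    conv_lhs => rw [h]
    rw [map_add, map_smul, map_smul]
  rw [this]
  simp
  ring

lemma dd_apply {u : ℂ → R31} {w : ℂ} (hu : DifferentiableAt ℝ u w) (a : ℂ) (k : Fin 3) :
    dd u a w k = fderiv ℝ (fun x => u x k) w a := by
  have h := hasFDerivAt_pi'.1 hu.hasFDerivAt k
  rw [h.fderiv]
  rfl

lemma ContDiffAt.comp_apply_fin {u : ℂ → R31} {w : ℂ} {n : WithTop ℕ∞}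
    (hu : ContDiffAt ℝ n u w) (k : Fin 3) : ContDiffAt ℝ n (fun x => u x k) w :=
  contDiffAt_pi.1 hu k


lemma contDiffAt_fderiv {u : ℂ → R31} {w : ℂ} (hu : ContDiffAt ℝ 2 u w) :
    ContDiffAt ℝ 1 (fderiv ℝ u) w := hu.fderiv_right (by norm_num)

lemma differentiableAt_dd {u : ℂ → R31} {w : ℂ} (hu : ContDiffAt ℝ 2 u w) (a : ℂ) :
    DifferentiableAt ℝ (dd u a) w :=
  ((contDiffAt_fderiv hu).differentiableAt (by norm_num)).clm_apply (differentiableAt_const a)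

lemma dd_dd_apply {u : ℂ → R31} {w : ℂ} (hu : ContDiffAt ℝ 2 u w) (a b : ℂ) (k : Fin 3) :
    dd (dd u a) b w k = fderiv ℝ (fderiv ℝ fun x => u x k) w b a := by
  rw [dd_apply (differentiableAt_dd hu a)]
  have h1 : (fun x => dd u a x k) =ᶠ[𝓝 w] fun x => fderiv ℝ (fun x => u x k) x a := by
    filter_upwards [hu.eventually (by simp)] with x hx
    exact dd_apply (hx.differentiableAt (by norm_num)) a k
  have h2 : DifferentiableAt ℝ (fderiv ℝ fun x => u x k) w :=
    ((ContDiffAt.comp_apply_fin hu k).fderiv_right (m := 1) (by norm_num)).differentiableAt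
      (by norm_num)
  rw [h1.fderiv_eq, fderiv_clm_apply h2 (differentiableAt_const a)]
  simp

lemma fderiv_lorentz {p q : ℂ → R31} {w : ℂ} (hp : DifferentiableAt ℝ p w)
    (hq : DifferentiableAt ℝ q w) (b : ℂ) :
    fderiv ℝ (fun x => lorentz (p x) (q x)) w b =
      lorentz (dd p b w) (q w) + lorentz (p w) (dd q b w) := by
  have hpk := fun k => hasFDerivAt_pi'.1 hp.hasFDerivAt k
  have hqk := fun k => hasFDerivAt_pi'.1 hq.hasFDerivAt k
  have h := (((hpk 0).mul (hqk 0)).neg.add ((hpk 1).mul (hqk 1))).add ((hpk 2).mul (hqk 2))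
  have h' : HasFDerivAt (fun x => lorentz (p x) (q x)) _ w := h
  rw [h'.fderiv]
  simp [lorentz, dd]
  ring

/-- The Lorentzian product is nondegenerate on a frame `a, b, a × b` with `a, b` conformal. -/
lemma eq_zero_of_lorentz_eq_zero {a b X : R31} (ha : 0 < lorentz a a)
    (hab : lorentz a a = lorentz b b) (h0 : lorentz a b = 0) (hXa : lorentz X a = 0)
    (hXb : lorentz X b = 0)
    (hXn : lorentz X ![-(a 1 * b 2 - a 2 * b 1), a 2 * b 0 - a 0 * b 2, a 0 * b 1 - a 1 * b 0] = 0) :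
    X = 0 := by
  set e := lorentz a a with he
  simp only [lorentz, Matrix.cons_val_zero, Matrix.cons_val_one, Matrix.cons_val] at *
  set c0 := a 1 * b 2 - a 2 * b 1 with hc0
  set c1 := a 2 * b 0 - a 0 * b 2 with hc1
  set c2 := a 0 * b 1 - a 1 * b 0 with hc2
  have hdet : c0 ^ 2 - c1 ^ 2 - c2 ^ 2 = e ^ 2 := by
    have : c0 ^ 2 - c1 ^ 2 - c2 ^ 2 = (-(a 0 * a 0) + a 1 * a 1 + a 2 * a 2) *
      (-(b 0 * b 0) + b 1 * b 1 + b 2 * b 2) - (-(a 0 * b 0) + a 1 * b 1 + a 2 * b 2) ^ 2 := by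
      rw [hc0, hc1, hc2]; ring
    rw [this, h0, ← hab, ← he]; ring
  have he0 : e ^ 2 ≠ 0 := by positivity
  funext k
  apply mul_left_cancel₀ he0
  rw [← hdet]
  fin_cases k
  · simp only [Fin.zero_eta, Pi.zero_apply, mul_zero]
    linear_combination (b 1 * c2 - b 2 * c1) * hXa + (a 2 * c1 - a 1 * c2) * hXb + c0 * hXn
  · simp only [Fin.mk_one, Pi.zero_apply, mul_zero]
    linear_combination (b 2 * c0 + b 0 * c2) * hXa - (a 2 * c0 + a 0 * c2) * hXb - c1 * hXn
  · simp only [Fin.reduceFinMk, Pi.zero_apply, mul_zero]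
    linear_combination (- b 0 * c1 - b 1 * c0) * hXa + (a 0 * c1 + a 1 * c0) * hXb - c2 * hXn

/-- `u` is, near `c`, the real part of a holomorphic null curve. -/
structure IsNullLift (u : ℂ → R31) (c : ℂ) : Prop where
  diff : ∀ᶠ w in 𝓝 c, DifferentiableAt ℝ u w
  analytic : ∀ k, AnalyticAt ℂ (liftDeriv u k) c
  null : ∀ᶠ w in 𝓝 c, liftDeriv u 1 w ^ 2 + liftDeriv u 2 w ^ 2 = liftDeriv u 0 w ^ 2

lemma eq_zero_of_mem_closure {P : ℂ → ℝ} {W : Set ℂ} {z : ℂ} (hP : ContinuousAt P z)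
    (hz : z ∈ closure W) (h : ∀ w ∈ W, P w = 0) : P z = 0 := by
  by_contra hne
  obtain ⟨w, hw, hw'⟩ := ((mem_closure_iff_frequently.1 hz).and_eventually
    (hP.eventually_ne hne)).exists
  exact hw' (h w hw)

/-- Differentiating `E = G` and `F = 0` shows that the Laplacian of `u` is orthogonal to `u_x` and
`u_y`; zero mean curvature removes the remaining normal component. -/
lemma laplacian_eq_zero_of_conformal {u : ℂ → R31} {W : Set ℂ} (hW : IsOpen W)
    (hu : ∀ z ∈ W, ContDiffAt ℝ 2 u z) (hc : ∀ z ∈ W, IsConformalMaximalAt u z) {z : ℂ}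
    (hz : z ∈ W) : dd (dd u 1) 1 z + dd (dd u Complex.I) Complex.I z = 0 := by
  have hx := differentiableAt_dd (hu z hz) 1
  have hy := differentiableAt_dd (hu z hz) Complex.I
  obtain ⟨hE, hEG, hF, hH⟩ := hc z hz
  have hsymm : dd (dd u 1) Complex.I z = dd (dd u Complex.I) 1 z := by
    funext k
    rw [dd_dd_apply (hu z hz), dd_dd_apply (hu z hz)]
    exact ((ContDiffAt.comp_apply_fin (hu z hz) k).isSymmSndFDerivAt (by simp)) _ _
  have hEG' : ∀ b, fderiv ℝ (fun x => lorentz (dd u 1 x) (dd u 1 x)) z b =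
      fderiv ℝ (fun x => lorentz (dd u Complex.I x) (dd u Complex.I x)) z b := by
    intro b
    have : (fun x => lorentz (dd u 1 x) (dd u 1 x)) =ᶠ[𝓝 z]
        fun x => lorentz (dd u Complex.I x) (dd u Complex.I x) := by
      filter_upwards [hW.mem_nhds hz] with x hx using (hc x hx).2.1
    rw [this.fderiv_eq]
  have hF' : ∀ b, fderiv ℝ (fun x => lorentz (dd u 1 x) (dd u Complex.I x)) z b = 0 := by
    intro b
    have : (fun x => lorentz (dd u 1 x) (dd u Complex.I x)) =ᶠ[𝓝 z] fun _ => 0 := by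
      filter_upwards [hW.mem_nhds hz] with x hx using (hc x hx).2.2.1
    rw [this.fderiv_eq]
    simp
  have e1 := hEG' 1
  have e2 := hEG' Complex.I
  have e3 := hF' 1
  have e4 := hF' Complex.I
  rw [fderiv_lorentz hx hx, fderiv_lorentz hy hy] at e1 e2
  rw [fderiv_lorentz hx hy] at e3 e4
  rw [hsymm] at e2 e4
  simp only [ffE, ffF, ffG, sfL, sfM, sfN, normalVec] at hE hEG hF hH
  refine eq_zero_of_lorentz_eq_zero hE hEG hF ?_ ?_ ?_
  · simp only [lorentz, Pi.add_apply] at e1 e2 e3 e4 ⊢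
    linarith
  · simp only [lorentz, Pi.add_apply] at e1 e2 e3 e4 ⊢
    linarith
  · rw [hF, ← hEG] at hH
    have h2 : lorentz (dd u 1 z) (dd u 1 z) * lorentz (dd (dd u 1) 1 z + dd (dd u Complex.I) Complex.I z)
      ![-(dd u 1 z 1 * dd u Complex.I z 2 - dd u 1 z 2 * dd u Complex.I z 1),
          dd u 1 z 2 * dd u Complex.I z 0 - dd u 1 z 0 * dd u Complex.I z 2,
          dd u 1 z 0 * dd u Complex.I z 1 - dd u 1 z 1 * dd u Complex.I z 0] = 0 := by
      rw [← hH]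
      simp only [lorentz, Pi.add_apply]
      ring
    exact (mul_eq_zero.1 h2).resolve_left hE.ne'

/-- Harmonicity and the conformality relations are closed conditions, so they pass from the dense
set `W` to all of `X`, singular points included. The complex derivative of a harmonic function is
analytic, and conformality becomes the null condition. -/
lemma isNullLift_of_conformal {u : ℂ → R31} {X W : Set ℂ} (hX : IsOpen X) (hW : IsOpen W)
    (hu : ∀ z ∈ X, ContDiffAt ℝ 2 u z) (hWX : W ⊆ X) (hd : X ⊆ closure W)
    (hc : ∀ z ∈ W, IsConformalMaximalAt u z) : ∀ z ∈ X, IsNullLift u z := by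
  have hlap : ∀ z ∈ X, ∀ k, fderiv ℝ (fderiv ℝ fun x => u x k) z 1 1 +
      fderiv ℝ (fderiv ℝ fun x => u x k) z Complex.I Complex.I = 0 := by
    intro z hz k
    have h1 : ContinuousAt (fderiv ℝ (fderiv ℝ fun x => u x k)) z :=
      (((ContDiffAt.comp_apply_fin (hu z hz) k).fderiv_right (m := 1) (by norm_num)).fderiv_right
        (m := 0) (by norm_num)).continuousAt
    refine eq_zero_of_mem_closure (P := fun z => fderiv ℝ (fderiv ℝ fun x => u x k) z 1 1 +
      fderiv ℝ (fderiv ℝ fun x => u x k) z Complex.I Complex.I) ?_ (hd hz) fun w hw => ?_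
    · exact ((h1.clm_apply continuousAt_const).clm_apply continuousAt_const).add
        ((h1.clm_apply continuousAt_const).clm_apply continuousAt_const)
    · have := congrFun (laplacian_eq_zero_of_conformal hW (fun z hz => hu z (hWX hz)) hc hw) k
      rw [Pi.add_apply, dd_dd_apply (hu w (hWX hw)), dd_dd_apply (hu w (hWX hw))] at this
      exact this
  have hdiff : ∀ z ∈ X, DifferentiableAt ℝ u z := fun z hz =>
    (hu z hz).differentiableAt (by norm_num)
  have hcont : ∀ z ∈ X, ∀ a, ContinuousAt (dd u a) z := fun z hz a =>
    (differentiableAt_dd (hu z hz) a).continuousAt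
  intro z hz
  have hXz := hX.mem_nhds hz
  refine ⟨?_, fun k => ?_, ?_⟩
  · filter_upwards [hXz] with w hw using hdiff w hw
  · have hh : InnerProductSpace.HarmonicAt (fun x => u x k) z := by
      refine ⟨ContDiffAt.comp_apply_fin (hu z hz) k, ?_⟩
      filter_upwards [hXz] with w hw
      simp only [InnerProductSpace.laplacian_eq_iteratedFDeriv_complexPlane,
        iteratedFDeriv_two_apply]
      simpa using hlap w hw k
    refine (HarmonicAt.analyticAt_complex_partial hh).congr ?_
    filter_upwards [hXz] with w hw
    rw [liftDeriv, dd_apply (hdiff w hw), dd_apply (hdiff w hw)]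
  · filter_upwards [hXz] with w hw
    have hl : ∀ a b, ContinuousAt (fun x => lorentz (dd u a x) (dd u b x)) w := by
      intro a b
      have h1 := fun k => continuousAt_pi.1 (hcont w hw a) k
      have h2 := fun k => continuousAt_pi.1 (hcont w hw b) k
      exact (((h1 0).mul (h2 0)).neg.add ((h1 1).mul (h2 1))).add ((h1 2).mul (h2 2))
    have e1 := eq_zero_of_mem_closure ((hl 1 1).sub (hl Complex.I Complex.I)) (hd hw)
      (fun x hx => sub_eq_zero.2 (hc x hx).2.1)
    have e2 := eq_zero_of_mem_closure (hl 1 Complex.I) (hd hw) (fun x hx => (hc x hx).2.2.1)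
    simp only [lorentz] at e1 e2
    apply Complex.ext
    · simp only [Complex.add_re, pow_two, Complex.mul_re, liftDeriv_re, liftDeriv_im]
      simp only [Pi.sub_apply] at e1
      linarith
    · simp only [Complex.add_im, pow_two, Complex.mul_im, liftDeriv_re, liftDeriv_im]
      linarith

lemma liftDeriv_comp {u v : ℂ → R31} {μ : ℂ → ℂ} {w : ℂ} (hv : DifferentiableAt ℝ v (μ w))
    (hμ : DifferentiableAt ℂ μ w) (h : ∀ᶠ x in 𝓝 w, u x = v (μ x)) (k : Fin 3) :
    liftDeriv u k w = liftDeriv v k (μ w) * deriv μ w := by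
  have h4 : HasFDerivAt μ ((ContinuousLinearMap.toSpanSingleton ℂ (deriv μ w)).restrictScalars ℝ) w :=
    hμ.hasDerivAt.hasFDerivAt.restrictScalars ℝ
  have h5 := (hv.hasFDerivAt.comp w h4).congr_of_eventuallyEq h
  have h6 : ∀ a, dd u a w = dd v (a * deriv μ w) (μ w) := by
    intro a
    simp only [dd, h5.fderiv]
    simp
  apply Complex.ext
  · rw [liftDeriv_re, h6, dd_eq_re, one_mul]
  · rw [liftDeriv_im, h6, dd_eq_re]
    simp
    ring

/-- Change of the parameter. -/
lemma IsNullLift.comp {u v : ℂ → R31} {μ : ℂ → ℂ} {c : ℂ} (hv : IsNullLift v (μ c))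
    (hμ : AnalyticAt ℂ μ c) (h : ∀ᶠ w in 𝓝 c, u w = v (μ w)) :
    IsNullLift u c ∧ ∀ᶠ w in 𝓝 c, ∀ k, liftDeriv u k w = liftDeriv v k (μ w) * deriv μ w := by
  have hμc : Tendsto μ (𝓝 c) (𝓝 (μ c)) := hμ.continuousAt
  have hdiff : ∀ᶠ w in 𝓝 c, DifferentiableAt ℝ u w := by
    filter_upwards [h.eventually_nhds, hμc.eventually hv.diff, hμ.eventually_analyticAt]
      with w h1 h2 h3
    have h4 : DifferentiableAt ℝ μ w := h3.differentiableAt.restrictScalars ℝ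
    exact (h2.comp w h4).congr_of_eventuallyEq h1
  have hrel : ∀ᶠ w in 𝓝 c, ∀ k, liftDeriv u k w = liftDeriv v k (μ w) * deriv μ w := by
    filter_upwards [h.eventually_nhds, hμc.eventually hv.diff, hμ.eventually_analyticAt]
      with w h1 h2 h3 k
    exact liftDeriv_comp h2 h3.differentiableAt h1 k
  refine ⟨⟨hdiff, fun k => ?_, ?_⟩, hrel⟩
  · refine (((hv.analytic k).comp hμ).mul hμ.deriv).congr ?_
    filter_upwards [hrel] with w hw using (hw k).symm
  · filter_upwards [hrel, hμc.eventually hv.null] with w h1 h2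
    rw [h1, h1, h1]
    linear_combination deriv μ w ^ 2 * h2

/-- Finite points are covered by the planar result. At `∞` the change of parameter `w ↦ 1 / w`
handles a punctured neighbourhood, and continuity of `liftDeriv` makes the puncture removable. -/
theorem IsMaxface.isNullLift {f : Sphere → R31} {E : Finset Sphere} (hf : IsMaxface f E)
    {p : Sphere} (hp : p ∉ E) : IsNullLift (loc f p) (coordAt p) := by
  have hle : ((2 : ℕ∞) : WithTop ℕ∞) ≤ ((⊤ : ℕ∞) : WithTop ℕ∞) := by exact_mod_cast le_top
  have hEc : IsOpen ((E : Set Sphere)ᶜ) := E.finite_toSet.isClosed.isOpen_compl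
  have hfin : ∀ z : ℂ, (z : Sphere) ∉ E → IsNullLift (fun w : ℂ => f w) z := by
    obtain ⟨W, hWo, hWE, hdense, hW⟩ := hf.maximal
    have hc : Continuous ((↑) : ℂ → Sphere) := OnePoint.continuous_coe
    refine isNullLift_of_conformal (X := {z : ℂ | (z : Sphere) ∉ E}) (W := {z : ℂ | (z : Sphere) ∈ W})
      (hEc.preimage hc) (hWo.preimage hc) (fun z hz => ?_) (fun z hz => hWE hz) ?_ (fun z hz => hW z hz)
    · exact (hf.smooth z hz).of_le hle
    · intro z hz
      have h1 : (z : Sphere) ∈ closure W := hdense hz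
      exact OnePoint.isOpenEmbedding_coe.isOpenMap.preimage_closure_subset_closure_preimage h1
  induction p using OnePoint.rec with
  | coe z => exact hfin z hp
  | infty =>
    rw [coordAt_infty]
    set v := loc f ∞ with hv
    have hsm : ContDiffAt ℝ 2 v 0 := (hf.smooth ∞ hp).of_le hle
    have hcE : ∀ᶠ w in 𝓝 (0 : ℂ), paramAt ∞ w ∉ E := by
      have := continuousAt_paramAt ∞
      exact this.eventually_mem (hEc.mem_nhds (by rw [paramAt_coordAt]; exact hp))
    have hloc : ∀ᶠ w in 𝓝[≠] (0 : ℂ), IsNullLift v w := by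
      filter_upwards [hcE.filter_mono nhdsWithin_le_nhds, self_mem_nhdsWithin] with w hw hw0
      have hw0' : w ≠ 0 := hw0
      rw [paramAt_infty, if_neg hw0'] at hw
      refine (IsNullLift.comp (μ := fun w => w⁻¹) (hfin _ hw) (analyticAt_inv hw0') ?_).1
      filter_upwards [isOpen_ne.mem_nhds hw0'] with x hx
      have hx' : x ≠ 0 := hx
      simp [hv, loc, paramAt_infty, hx']
    have hcont : ∀ a, ∀ᶠ w in 𝓝 (0 : ℂ), ContinuousAt (dd v a) w := by
      intro a
      filter_upwards [hsm.eventually (by simp)] with w hw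
      exact (differentiableAt_dd hw a).continuousAt
    have hlc : ∀ k, ContinuousAt (liftDeriv v k) 0 := by
      intro k
      have h1 := continuousAt_pi.1 (hcont 1).self_of_nhds k
      have h2 := continuousAt_pi.1 (hcont Complex.I).self_of_nhds k
      exact (Complex.continuous_ofReal.continuousAt.comp h1).sub
        (continuousAt_const.mul (Complex.continuous_ofReal.continuousAt.comp h2))
    refine ⟨?_, fun k => ?_, ?_⟩
    · filter_upwards [hsm.eventually (by simp)] with w hw using hw.differentiableAt (by norm_num)
    · exact Complex.analyticAt_of_differentiable_on_punctured_nhds_of_continuousAt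
        (hloc.mono fun w hw => (hw.analytic k).differentiableAt) (hlc k)
    · have h1 : ∀ᶠ w in 𝓝[≠] (0:ℂ),
          liftDeriv v 1 w ^ 2 + liftDeriv v 2 w ^ 2 = liftDeriv v 0 w ^ 2 :=
        hloc.mono fun w hw => hw.null.self_of_nhds
      have h2 : liftDeriv v 1 0 ^ 2 + liftDeriv v 2 0 ^ 2 = liftDeriv v 0 0 ^ 2 := by
        have t1 : Tendsto (fun w => liftDeriv v 1 w ^ 2 + liftDeriv v 2 w ^ 2) (𝓝[≠] 0)
            (𝓝 (liftDeriv v 1 0 ^ 2 + liftDeriv v 2 0 ^ 2)) :=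
          (((hlc 1).pow 2).add ((hlc 2).pow 2)).tendsto.mono_left nhdsWithin_le_nhds
        have t2 : Tendsto (fun w => liftDeriv v 0 w ^ 2) (𝓝[≠] 0) (𝓝 (liftDeriv v 0 0 ^ 2)) :=
          ((hlc 0).pow 2).tendsto.mono_left nhdsWithin_le_nhds
        exact tendsto_nhds_unique (t1.congr' h1) t2
      rw [eventually_nhdsWithin_iff] at h1
      filter_upwards [h1] with w hw
      by_cases h : w = 0
      · rw [h]; exact h2
      · exact hw h

end

/-! ### Singular points, umbilics and lengths in Möbius coordinates. -/

section

open Matrix (GeneralLinearGroup)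

lemma IsMaxface.isNullLift_paramAt {f : Sphere → R31} {E : Finset Sphere} (hf : IsMaxface f E)
    {p : Sphere} {w : ℂ} (hp : paramAt p w ∉ E) : IsNullLift (loc f p) w := by
  induction p using OnePoint.rec with
  | coe z => exact hf.isNullLift (p := (w : Sphere)) hp
  | infty =>
    by_cases hw : w = 0
    · rw [hw] at hp ⊢
      exact hf.isNullLift (p := ∞) (by simpa [paramAt_infty] using hp)
    · rw [paramAt_infty, if_neg hw] at hp
      refine (IsNullLift.comp (μ := fun w => w⁻¹) (hf.isNullLift hp) (analyticAt_inv hw) ?_).1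
      filter_upwards [isOpen_ne.mem_nhds hw] with x hx
      have hx' : x ≠ 0 := hx
      simp [loc, paramAt_infty, hx']

/-- With `C = φ₀`, `X = φ₁ - i φ₂`, `Y = φ₁ + i φ₂` the null condition is `X Y = C²`. If also `|X| =
|Y|`, the direction `i conj C` (or any direction when `C = 0`) lies in the kernel of the
differential. -/
lemma not_injective_of_norm_eq {v : ℂ → R31} {c : ℂ}
    (hnull : liftDeriv v 1 c ^ 2 + liftDeriv v 2 c ^ 2 = liftDeriv v 0 c ^ 2)
    (h : ‖liftDeriv v 1 c - Complex.I * liftDeriv v 2 c‖ =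
      ‖liftDeriv v 1 c + Complex.I * liftDeriv v 2 c‖) :
    ¬ Function.Injective (fderiv ℝ v c) := by
  set X := liftDeriv v 1 c - Complex.I * liftDeriv v 2 c with hX
  set Y := liftDeriv v 1 c + Complex.I * liftDeriv v 2 c with hY
  set C := liftDeriv v 0 c with hC
  have hXY : X * Y = C ^ 2 := by
    rw [hX, hY, ← hnull]; linear_combination -(liftDeriv v 2 c) ^ 2 * Complex.I_sq
  suffices ∃ a : ℂ, a ≠ 0 ∧ (C * a).re = 0 ∧ a * X = -conj (a * Y) by
    obtain ⟨a, ha, h0, h1⟩ := this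
    intro hinj
    apply ha
    apply hinj
    rw [map_zero]
    funext k
    change dd v a c k = 0
    rw [dd_eq_re]
    have hre := congrArg Complex.re h1
    have him := congrArg Complex.im h1
    have e1 : liftDeriv v 1 c * a = (a * X + a * Y) / 2 := by rw [hX, hY]; ring
    have e2 : liftDeriv v 2 c * a = Complex.I * (a * X - a * Y) / 2 := by
      rw [hX, hY]; linear_combination (a * liftDeriv v 2 c) * Complex.I_sq
    rw [Complex.neg_re, Complex.conj_re] at hre
    rw [Complex.neg_im, Complex.conj_im, neg_neg] at him
    fin_cases k
    · exact h0
    · change (liftDeriv v 1 c * a).re = 0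
      rw [e1, h1]
      simp
    · change (liftDeriv v 2 c * a).re = 0
      rw [e2]
      have : (Complex.I * (a * X - a * Y) / 2).re = -((a * X).im - (a * Y).im) / 2 := by
        rw [Complex.div_ofNat_re, Complex.I_mul_re, Complex.sub_im]
      rw [this, him]
      simp
  by_cases hC0 : C = 0
  · rw [hC0] at hXY
    have hX0 : X = 0 := by
      rcases mul_eq_zero.1 (hXY.trans (by ring : (0:ℂ) ^ 2 = 0)) with h' | h'
      · exact h'
      · rw [h', norm_zero] at h; exact norm_eq_zero.1 h
    have hY0 : Y = 0 := by rw [hX0, norm_zero] at h; exact norm_eq_zero.1 h.symm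
    exact ⟨1, one_ne_zero, by simp [hC0], by simp [hX0, hY0]⟩
  · refine ⟨Complex.I * conj C, by simp [hC0], ?_, ?_⟩
    · rw [show C * (Complex.I * conj C) = Complex.I * (C * conj C) by ring, Complex.mul_conj]
      simp
    · simp only [map_mul, Complex.conj_I, Complex.conj_conj]
      apply mul_left_cancel₀ hC0
      have e1 : X * conj X = Y * conj Y := by
        rw [Complex.mul_conj, Complex.mul_conj, Complex.normSq_eq_norm_sq,
          Complex.normSq_eq_norm_sq, h]
      have e2 : C * conj C = Y * conj Y := by
        have h3 : ‖C‖ ^ 2 = ‖Y‖ ^ 2 := by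
          rw [← norm_pow, ← hXY, norm_mul, h, pow_two]
        rw [Complex.mul_conj, Complex.mul_conj, Complex.normSq_eq_norm_sq,
          Complex.normSq_eq_norm_sq, h3]
      linear_combination Complex.I * X * e2 + Complex.I * conj Y * hXY

/-- The second derivatives of `f` are the real and imaginary parts of multiples of `F''`. If `F'' =
a F'` they are tangential, and the second fundamental form vanishes. -/
lemma isUmbilic_of_parallel {f : Sphere → R31} {p : Sphere} (hns : ¬ IsSingular f p)
    (hv : IsNullLift (loc f p) (coordAt p)) {a : ℂ}
    (ha : ∀ k, deriv (liftDeriv (loc f p) k) (coordAt p) = a * liftDeriv (loc f p) k (coordAt p)) :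
    IsUmbilic f p := by
  set v := loc f p
  set c := coordAt p
  have hF : ∀ k, HasFDerivAt (liftDeriv v k)
      ((ContinuousLinearMap.toSpanSingleton ℂ (a * liftDeriv v k c)).restrictScalars ℝ) c := by
    intro k
    have := (hv.analytic k).differentiableAt.hasDerivAt
    rw [ha] at this
    exact this.hasFDerivAt.restrictScalars ℝ
  have h1 : ∀ b k, dd (dd v 1) b c k = (b * (a * liftDeriv v k c)).re := by
    intro b k
    have h2 : HasFDerivAt (dd v 1) (ContinuousLinearMap.pi fun k => Complex.reCLM.comp
        ((ContinuousLinearMap.toSpanSingleton ℂ (a * liftDeriv v k c)).restrictScalars ℝ)) c := by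
      rw [hasFDerivAt_pi]
      intro k
      have := Complex.reCLM.hasFDerivAt.comp c (hF k)
      refine this.congr_of_eventuallyEq (Eventually.of_forall fun w => ?_)
      simp [liftDeriv_re]
    rw [show dd (dd v 1) b c = fderiv ℝ (dd v 1) c b from rfl, h2.fderiv]
    simp
  have h1' : ∀ b k, dd (dd v Complex.I) b c k = -(b * (a * liftDeriv v k c)).im := by
    intro b k
    have h2 : HasFDerivAt (dd v Complex.I) (ContinuousLinearMap.pi fun k => (-Complex.imCLM).comp
        ((ContinuousLinearMap.toSpanSingleton ℂ (a * liftDeriv v k c)).restrictScalars ℝ)) c := by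
      rw [hasFDerivAt_pi]
      intro k
      have := (-Complex.imCLM).hasFDerivAt.comp c (hF k)
      refine this.congr_of_eventuallyEq (Eventually.of_forall fun w => ?_)
      simp [liftDeriv_im]
    rw [show dd (dd v Complex.I) b c = fderiv ℝ (dd v Complex.I) c b from rfl, h2.fderiv]
    simp
  have hs : ∀ X : R31, (∃ r s : ℝ, ∀ k, X k = r * dd v 1 c k + s * dd v Complex.I c k) →
      lorentz X (normalVec v c) = 0 := by
    rintro X ⟨r, s, h⟩
    simp only [lorentz, normalVec, h, Matrix.cons_val_zero, Matrix.cons_val_one, Matrix.cons_val]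
    ring
  refine ⟨hns, 0, ?_, ?_, ?_⟩
  · rw [zero_mul]
    refine hs _ ⟨a.re, a.im, fun k => ?_⟩
    rw [h1, ← liftDeriv_re]
    have := liftDeriv_im v k c
    simp only [one_mul, Complex.mul_re]
    linear_combination -a.im * this
  · rw [zero_mul]
    refine hs _ ⟨-a.im, a.re, fun k => ?_⟩
    rw [h1, ← liftDeriv_re]
    have := liftDeriv_im v k c
    simp only [Complex.I_mul_re, Complex.mul_im]
    linear_combination -a.re * this
  · rw [zero_mul]
    refine hs _ ⟨-a.re, -a.im, fun k => ?_⟩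
    rw [h1', ← liftDeriv_re]
    have := liftDeriv_im v k c
    simp only [Complex.I_mul_im, Complex.mul_re]
    linear_combination a.im * this

lemma hasDerivAt_comp_mul_deriv {P Q μ : ℂ → ℂ} {c : ℂ} (hμ : AnalyticAt ℂ μ c)
    (hQ : DifferentiableAt ℂ Q (μ c)) (h : ∀ᶠ w in 𝓝 c, P w = Q (μ w) * deriv μ w) :
    deriv P c = deriv Q (μ c) * deriv μ c ^ 2 + Q (μ c) * deriv (deriv μ) c := by
  have h1 := (hQ.hasDerivAt.comp c hμ.differentiableAt.hasDerivAt).mul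
    hμ.deriv.differentiableAt.hasDerivAt
  have h2 : P =ᶠ[𝓝 c] (Q ∘ μ) * deriv μ := h
  rw [h2.deriv_eq, h1.deriv, Function.comp_apply]
  ring

/-- A change of coordinate rescales the derivative and adds a multiple of the vector itself, so
parallelism of `F''` and `F'` does not depend on the coordinate. -/
lemma exists_parallel_comp {P Q : Fin 3 → ℂ → ℂ} {μ : ℂ → ℂ} {c : ℂ} (hμ : AnalyticAt ℂ μ c)
    (hμ' : deriv μ c ≠ 0) (hQ : ∀ k, DifferentiableAt ℂ (Q k) (μ c))
    (h : ∀ᶠ w in 𝓝 c, ∀ k, P k w = Q k (μ w) * deriv μ w) :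
    (∃ a, ∀ k, deriv (P k) c = a * P k c) ↔ ∃ a, ∀ k, deriv (Q k) (μ c) = a * Q k (μ c) := by
  have h1 : ∀ k, P k c = Q k (μ c) * deriv μ c := h.self_of_nhds
  have h2 := fun k => hasDerivAt_comp_mul_deriv hμ (hQ k) (h.mono fun w hw => hw k)
  constructor
  · rintro ⟨a, ha⟩
    refine ⟨(a * deriv μ c - deriv (deriv μ) c) / deriv μ c ^ 2, fun k => ?_⟩
    have := ha k
    rw [h1, h2] at this
    field_simp
    linear_combination this
  · rintro ⟨a, ha⟩
    refine ⟨a * deriv μ c + deriv (deriv μ) c / deriv μ c, fun k => ?_⟩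
    rw [h1, h2, ha]
    field_simp

/-- The local description of `f ∘ M` for a Möbius transformation `M`. -/
lemma exists_coord_relation {f : Sphere → R31} {E : Finset Sphere} (hf : IsMaxface f E)
    (M : GL (Fin 2) ℂ) {z : ℂ} (hz : M • (z : Sphere) ∉ E) :
    IsNullLift (fun w : ℂ => f (M • (w : Sphere))) z ∧
    ∃ μ : ℂ → ℂ, AnalyticAt ℂ μ z ∧ deriv μ z ≠ 0 ∧ μ z = coordAt (M • (z : Sphere)) ∧
      (∀ᶠ w : ℂ in 𝓝 z, M • (w : Sphere) = paramAt (M • (z : Sphere)) (μ w)) ∧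
      ∀ᶠ w in 𝓝 z, ∀ k, liftDeriv (fun w : ℂ => f (M • (w : Sphere))) k w =
        liftDeriv (loc f (M • (z : Sphere))) k (μ w) * deriv μ w := by
  obtain ⟨μ, hμ, hμ', hμc, hM⟩ := exists_mobius_coord M (z : Sphere)
  rw [coordAt_coe] at *
  have h1 : IsNullLift (loc f (M • (z : Sphere))) (μ z) := by
    rw [hμc]; exact hf.isNullLift hz
  obtain ⟨h2, h3⟩ := IsNullLift.comp (u := fun w : ℂ => f (M • (w : Sphere))) h1 hμ (by
    filter_upwards [hM] with w hw
    rw [← paramAt_coe z w, hw]; rfl)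
  exact ⟨h2, μ, hμ, hμ', hμc, hM, h3⟩

lemma exists_liftDeriv_ne_zero {f : Sphere → R31} {E : Finset Sphere} (hf : IsMaxface f E)
    (M : GL (Fin 2) ℂ) {z : ℂ} (hz : M • (z : Sphere) ∉ E) :
    ∃ k, liftDeriv (fun w : ℂ => f (M • (w : Sphere))) k z ≠ 0 := by
  obtain ⟨-, μ, -, hμ', hμc, -, hrel⟩ := exists_coord_relation hf M hz
  by_contra! h
  apply hf.no_branch _ hz
  ext a k
  change dd (loc f (M • (z : Sphere))) a (coordAt (M • (z : Sphere))) k = 0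
  rw [dd_eq_re, ← hμc]
  have h1 := hrel.self_of_nhds k
  rw [h, eq_comm, mul_eq_zero] at h1
  rw [h1.resolve_right hμ']
  simp

lemma norm_ne_of_not_isSingular {f : Sphere → R31} {E : Finset Sphere} (hf : IsMaxface f E)
    (M : GL (Fin 2) ℂ) {z : ℂ} (hz : M • (z : Sphere) ∉ E)
    (hns : ¬ IsSingular f (M • (z : Sphere))) :
    ‖liftDeriv (fun w : ℂ => f (M • (w : Sphere))) 1 z -
        Complex.I * liftDeriv (fun w : ℂ => f (M • (w : Sphere))) 2 z‖ ≠
      ‖liftDeriv (fun w : ℂ => f (M • (w : Sphere))) 1 z +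
        Complex.I * liftDeriv (fun w : ℂ => f (M • (w : Sphere))) 2 z‖ := by
  obtain ⟨-, μ, -, hμ', hμc, -, hrel⟩ := exists_coord_relation hf M hz
  have h1 := hrel.self_of_nhds
  rw [h1, h1, hμc, ← mul_assoc, ← sub_mul, ← add_mul, norm_mul, norm_mul]
  intro h
  have h2 := mul_right_cancel₀ (norm_ne_zero_iff.2 hμ') h
  exact hns (not_injective_of_norm_eq (hf.isNullLift hz).null.self_of_nhds h2)

lemma isUmbilic_smul_of_parallel {f : Sphere → R31} {E : Finset Sphere} (hf : IsMaxface f E)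
    (M : GL (Fin 2) ℂ) {z : ℂ} (hz : M • (z : Sphere) ∉ E)
    (hns : ¬ IsSingular f (M • (z : Sphere)))
    (h : ∃ a, ∀ k, deriv (liftDeriv (fun w : ℂ => f (M • (w : Sphere))) k) z =
      a * liftDeriv (fun w : ℂ => f (M • (w : Sphere))) k z) :
    IsUmbilic f (M • (z : Sphere)) := by
  obtain ⟨-, μ, hμ, hμ', hμc, -, hrel⟩ := exists_coord_relation hf M hz
  have hv := hf.isNullLift hz
  obtain ⟨a, ha⟩ := (exists_parallel_comp hμ hμ'
    (fun k => by rw [hμc]; exact (hv.analytic k).differentiableAt) hrel).1 h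
  rw [hμc] at ha
  exact isUmbilic_of_parallel hns hv ha

lemma densityE_smul {f : Sphere → R31} (M : GL (Fin 2) ℂ) {z : ℂ} {μ : ℂ → ℂ}
    (hμc : μ z = coordAt (M • (z : Sphere)))
    (hrel : ∀ k, liftDeriv (fun w : ℂ => f (M • (w : Sphere))) k z =
        liftDeriv (loc f (M • (z : Sphere))) k (μ z) * deriv μ z) :
    densityE (loc f (M • (z : Sphere))) (coordAt (M • (z : Sphere))) * ‖deriv μ z‖ =
      densityE (fun w : ℂ => f (M • (w : Sphere))) z := by
  simp only [densityE, hrel, hμc]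
  rw [← mul_assoc, ← sub_mul, ← add_mul, norm_mul, norm_mul]
  ring

/-- `lengthE` evaluates each point in its own chart; invariance of density times speed allows the
length to be computed in the single coordinate given by `M`. -/
lemma isC1Path_smul {f : Sphere → R31} {E : Finset Sphere} (hf : IsMaxface f E)
    (M : GL (Fin 2) ℂ) {y : ℝ → ℂ}
    (hy : ∀ t ∈ Ico (0 : ℝ) 1, M • (y t : Sphere) ∉ E ∧ ContDiffAt ℝ 1 y t) :
    IsC1Path E (fun t => M • (y t : Sphere)) ∧ lengthE f (fun t => M • (y t : Sphere)) =
      ∫⁻ t in Ico (0 : ℝ) 1, ENNReal.ofReal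
        (densityE (fun w : ℂ => f (M • (w : Sphere))) (y t) * ‖deriv y t‖) := by
  have key : ∀ t ∈ Ico (0 : ℝ) 1, ∃ μ : ℂ → ℂ, AnalyticAt ℂ μ (y t) ∧
      μ (y t) = coordAt (M • (y t : Sphere)) ∧
      (∀ k, liftDeriv (fun w : ℂ => f (M • (w : Sphere))) k (y t) =
        liftDeriv (loc f (M • (y t : Sphere))) k (μ (y t)) * deriv μ (y t)) ∧
      (fun s => chartFn (M • (y t : Sphere)) (M • (y s : Sphere))) =ᶠ[𝓝 t] fun s => μ (y s) := by
    intro t ht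
    obtain ⟨-, μ, hμ, -, hμc, hM, hrel⟩ := exists_coord_relation hf M (hy t ht).1
    refine ⟨μ, hμ, hμc, hrel.self_of_nhds, ?_⟩
    have h1 : Tendsto y (𝓝 t) (𝓝 (y t)) := (hy t ht).2.continuousAt
    filter_upwards [h1.eventually hM] with s hs
    rw [hs, chartFn_paramAt]
  refine ⟨fun t ht => ⟨(hy t ht).1, ?_, ?_⟩, ?_⟩
  · exact (continuous_smul_sphere M).continuousAt.comp
      (OnePoint.continuous_coe.continuousAt.comp (hy t ht).2.continuousAt)
  · obtain ⟨μ, hμ, -, -, heq⟩ := key t ht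
    exact ((hμ.contDiffAt.restrict_scalars ℝ).comp t (hy t ht).2).congr_of_eventuallyEq heq
  · refine MeasureTheory.setLIntegral_congr_fun measurableSet_Ico fun t ht => ?_
    obtain ⟨μ, hμ, hμc, hrel, heq⟩ := key t ht
    have h1 : deriv (fun s => μ (y s)) t = deriv μ (y t) * deriv y t :=
      (hμ.differentiableAt.hasDerivAt.comp t
        ((hy t ht).2.differentiableAt (by norm_num)).hasDerivAt).deriv
    simp only
    rw [heq.deriv_eq, h1, norm_mul, ← mul_assoc, densityE_smul M hμc hrel]

end

/-! ### Lorentz transformations and null curves on the disc. -/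

section

open Metric (ball closedBall)

/-- The complex bilinear extension of `lorentz`. -/
def lorentzC (v w : Fin 3 → ℂ) : ℂ := -(v 0 * w 0) + v 1 * w 1 + v 2 * w 2

/-- The action of a real matrix on `ℂ³`. -/
def cmul (A : Matrix (Fin 3) (Fin 3) ℝ) (v : Fin 3 → ℂ) (k : Fin 3) : ℂ :=
  (A k 0 : ℂ) * v 0 + (A k 1 : ℂ) * v 1 + (A k 2 : ℂ) * v 2

/-- `A` preserves the Lorentzian scalar product. -/
def IsLorentz (A : Matrix (Fin 3) (Fin 3) ℝ) : Prop :=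
  ∀ x y : R31, lorentz (A.mulVec x) (A.mulVec y) = lorentz x y

lemma mulVec_fin_three (A : Matrix (Fin 3) (Fin 3) ℝ) (x : R31) (k : Fin 3) :
    A.mulVec x k = A k 0 * x 0 + A k 1 * x 1 + A k 2 * x 2 := by
  simp [Matrix.mulVec, dotProduct, Fin.sum_univ_three]

lemma IsLorentz.mul {A B : Matrix (Fin 3) (Fin 3) ℝ} (hA : IsLorentz A) (hB : IsLorentz B) :
    IsLorentz (A * B) := fun x y => by
  rw [← Matrix.mulVec_mulVec, ← Matrix.mulVec_mulVec, hA, hB]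

lemma cmul_mul (A B : Matrix (Fin 3) (Fin 3) ℝ) (v : Fin 3 → ℂ) :
    cmul (A * B) v = cmul A (cmul B v) := by
  funext k
  simp only [cmul, Matrix.mul_apply, Fin.sum_univ_three]
  push_cast
  ring

lemma cmul_conj (A : Matrix (Fin 3) (Fin 3) ℝ) (v : Fin 3 → ℂ) :
    cmul A (fun k => conj (v k)) = fun k => conj (cmul A v k) := by
  funext k
  simp [cmul]

lemma IsLorentz.lorentzC_cmul {A : Matrix (Fin 3) (Fin 3) ℝ} (hA : IsLorentz A)
    (v w : Fin 3 → ℂ) : lorentzC (cmul A v) (cmul A w) = lorentzC v w := by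
  have h : ∀ i j : Fin 3, ((-(A 0 i * A 0 j) + A 1 i * A 1 j + A 2 i * A 2 j : ℝ) : ℂ) =
      ((lorentz (Pi.single i 1) (Pi.single j 1) : ℝ) : ℂ) := by
    intro i j
    rw [← hA]
    simp [lorentz, Matrix.mulVec_single]
  have e : ∀ i j : Fin 3, ((lorentz (Pi.single i 1) (Pi.single j 1) : ℝ) : ℂ) =
      if i = j then (if i = 0 then -1 else 1) else 0 := by
    intro i j
    fin_cases i <;> fin_cases j <;> simp [lorentz]
  simp only [e] at h
  have h00 := h 0 0
  have h01 := h 0 1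
  have h02 := h 0 2
  have h11 := h 1 1
  have h12 := h 1 2
  have h22 := h 2 2
  simp at h00 h01 h02 h11 h12 h22
  simp only [lorentzC, cmul]
  linear_combination v 0 * w 0 * h00 + (v 0 * w 1 + v 1 * w 0) * h01 +
    (v 0 * w 2 + v 2 * w 0) * h02 + v 1 * w 1 * h11 + (v 1 * w 2 + v 2 * w 1) * h12 +
    v 2 * w 2 * h22

lemma IsLorentz.eq_zero_of_cmul {A : Matrix (Fin 3) (Fin 3) ℝ} (hA : IsLorentz A)
    {v : Fin 3 → ℂ} (h : ∀ k, cmul A v k = 0) : ∀ k, v k = 0 := by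
  have h1 : ∀ w, lorentzC v w = 0 := fun w => by
    rw [← hA.lorentzC_cmul]; simp [lorentzC, h]
  intro k
  have h2 := h1 (Pi.single k 1)
  fin_cases k <;> simpa [lorentzC] using h2

/-- For a null vector the Hermitian product equals `(|X| - |Y|)² / 2` with `X = v₁ - i v₂`, `Y = v₁
+ i v₂`. This gives the singular locus `|g| = 1` an isometry-invariant form. -/
lemma lorentzC_conj_eq_zero_iff {v : Fin 3 → ℂ} (hv : lorentzC v v = 0) :
    lorentzC v (fun k => conj (v k)) = 0 ↔
      ‖v 1 - Complex.I * v 2‖ = ‖v 1 + Complex.I * v 2‖ := by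
  set X := v 1 - Complex.I * v 2 with hX
  set Y := v 1 + Complex.I * v 2 with hY
  have hXY : X * Y = v 0 ^ 2 := by
    simp only [lorentzC] at hv
    rw [hX, hY]; linear_combination hv - (v 2) ^ 2 * Complex.I_sq
  have h0 : ‖v 0‖ ^ 2 = ‖X‖ * ‖Y‖ := by rw [← norm_pow, ← hXY, norm_mul]
  have h1 : lorentzC v (fun k => conj (v k)) = (((‖X‖ - ‖Y‖) ^ 2 / 2 : ℝ) : ℂ) := by
    have e1 : (X * conj X + Y * conj Y) / 2 = v 1 * conj (v 1) + v 2 * conj (v 2) := by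
      rw [hX, hY]
      simp only [map_sub, map_add, map_mul, Complex.conj_I]
      linear_combination -(v 2 * conj (v 2)) * Complex.I_sq
    have e2 : lorentzC v (fun k => conj (v k)) =
        -(v 0 * conj (v 0)) + (X * conj X + Y * conj Y) / 2 := by
      rw [e1, lorentzC]; ring
    rw [e2, Complex.mul_conj, Complex.mul_conj, Complex.mul_conj, Complex.normSq_eq_norm_sq,
      Complex.normSq_eq_norm_sq, Complex.normSq_eq_norm_sq, h0]
    push_cast
    ring
  rw [h1, Complex.ofReal_eq_zero, div_eq_zero_iff, or_iff_left two_ne_zero,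
    pow_eq_zero_iff two_ne_zero, sub_eq_zero]

/-- The properties of the null curve `φ = F'` of a Kobayashi surface on the closed unit disc
bounded by the fold singularities, with ends `E` on the unit circle. -/
structure DiscData (φ : ℂ → Fin 3 → ℂ) (E : Finset ℂ) : Prop where
  one_mem : 1 ∈ E
  norm_eq : ∀ e ∈ E, ‖e‖ = 1
  analytic : ∀ z ∈ closedBall (0 : ℂ) 1, z ∉ E → ∀ k, AnalyticAt ℂ (fun w => φ w k) z
  null : ∀ z ∈ closedBall (0 : ℂ) 1, z ∉ E → lorentzC (φ z) (φ z) = 0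
  ne_zero : ∀ z ∈ closedBall (0 : ℂ) 1, z ∉ E → ∃ k, φ z k ≠ 0
  re_zero : ∀ z, ‖z‖ = 1 → z ∉ E → ∀ k, (z * φ z k).re = 0
  spacelike : ∀ z ∈ ball (0 : ℂ) 1, lorentzC (φ z) (fun k => conj (φ z k)) ≠ 0
  not_parallel : ∀ z ∈ ball (0 : ℂ) 1, z ≠ 0 →
    ¬ ∃ a, ∀ k, deriv (fun w => φ w k) z = a * φ z k
  ends : ∀ e ∈ E, ∃ (b : ℂ → ℂ) (ψ : ℂ → Fin 3 → ℂ), AnalyticAt ℂ b e ∧ b e = 0 ∧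
    (∀ k, AnalyticAt ℂ (fun w => ψ w k) e) ∧ (∃ k, ψ e k ≠ 0) ∧ lorentzC (ψ e) (ψ e) = 0 ∧
    lorentzC (ψ e) (fun k => conj (ψ e k)) = 0 ∧ ∀ᶠ z in 𝓝[≠] e, ∀ k, b z * φ z k = ψ z k

lemma analyticAt_cmul (A : Matrix (Fin 3) (Fin 3) ℝ) {φ : ℂ → Fin 3 → ℂ} {z : ℂ}
    (h : ∀ k, AnalyticAt ℂ (fun w => φ w k) z) (k : Fin 3) :
    AnalyticAt ℂ (fun w => cmul A (φ w) k) z := by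
  have h0 := h 0
  have h1 := h 1
  have h2 := h 2
  unfold cmul
  fun_prop

lemma DiscData.notMem_of_mem_ball {φ : ℂ → Fin 3 → ℂ} {E : Finset ℂ} (h : DiscData φ E) {z : ℂ}
    (hz : z ∈ ball (0 : ℂ) 1) : z ∉ E := fun hzE => by
  have := h.norm_eq z hzE
  rw [mem_ball_zero_iff] at hz
  exact hz.ne this

/-- Every field is stated through real linear conditions and the Lorentzian product, so
normalization by isometries is free. -/
theorem DiscData.cmul {φ : ℂ → Fin 3 → ℂ} {E : Finset ℂ} (h : DiscData φ E)
    {A : Matrix (Fin 3) (Fin 3) ℝ} (hA : IsLorentz A) : DiscData (fun z => cmul A (φ z)) E where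
  one_mem := h.one_mem
  norm_eq := h.norm_eq
  analytic z hz hzE := analyticAt_cmul A (h.analytic z hz hzE)
  null z hz hzE := by rw [hA.lorentzC_cmul, h.null z hz hzE]
  ne_zero z hz hzE := by
    obtain ⟨k, hk⟩ := h.ne_zero z hz hzE
    by_contra! h'
    exact hk (hA.eq_zero_of_cmul h' k)
  re_zero z hz hzE k := by
    have h0 := fun k => h.re_zero z hz hzE k
    have e : z * Maxface.cmul A (φ z) k = (A k 0 : ℂ) * (z * φ z 0) + (A k 1 : ℂ) * (z * φ z 1) +
        (A k 2 : ℂ) * (z * φ z 2) := by rw [Maxface.cmul]; ring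
    rw [e, Complex.add_re, Complex.add_re, Complex.re_ofReal_mul, Complex.re_ofReal_mul,
      Complex.re_ofReal_mul, h0, h0, h0]
    simp
  spacelike z hz := by
    rw [← cmul_conj, hA.lorentzC_cmul]
    exact h.spacelike z hz
  not_parallel z hz hz0 := by
    rintro ⟨a, ha⟩
    refine h.not_parallel z hz hz0 ⟨a, ?_⟩
    have hd := fun k => (h.analytic z (Metric.ball_subset_closedBall hz) (h.notMem_of_mem_ball hz)
      k).differentiableAt.hasDerivAt
    have h1 : ∀ k, deriv (fun w => Maxface.cmul A (φ w) k) z =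
        Maxface.cmul A (fun j => deriv (fun w => φ w j) z) k := fun k =>
      ((((hd 0).const_mul _).add ((hd 1).const_mul _)).add ((hd 2).const_mul _)).deriv
    have h2 := hA.eq_zero_of_cmul (v := fun j => deriv (fun w => φ w j) z - a * φ z j) fun k => by
      have := ha k
      rw [h1] at this
      simp only [Maxface.cmul] at this ⊢
      linear_combination this
    exact fun k => sub_eq_zero.1 (h2 k)
  ends e he := by
    obtain ⟨b, ψ, hb, hb0, hψ, ⟨k, hk⟩, hn, hs, hev⟩ := h.ends e he
    refine ⟨b, fun z => Maxface.cmul A (ψ z), hb, hb0, analyticAt_cmul A hψ, ?_, ?_, ?_, ?_⟩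
    · by_contra! h'
      exact hk (hA.eq_zero_of_cmul h' k)
    · rw [hA.lorentzC_cmul, hn]
    · rw [← cmul_conj, hA.lorentzC_cmul, hs]
    · filter_upwards [hev] with z hz k
      simp only [Maxface.cmul, ← hz]
      ring

end

/-! ### The Gauss map on the disc and its normalization. -/

section

open Metric (ball closedBall)

lemma lorentzC_self_eq (v : Fin 3 → ℂ) : lorentzC v v =
    (v 1 - Complex.I * v 2) * (v 1 + Complex.I * v 2) - v 0 ^ 2 := by
  simp only [lorentzC]
  linear_combination (v 2) ^ 2 * Complex.I_sq

lemma eq_zero_of_isotropic {v : Fin 3 → ℂ} (hv : lorentzC v v = 0)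
    (hX : v 1 - Complex.I * v 2 = 0) (hY : v 1 + Complex.I * v 2 = 0) (k : Fin 3) : v k = 0 := by
  rw [lorentzC_self_eq, hX, zero_mul, zero_sub, neg_eq_zero, pow_eq_zero_iff two_ne_zero] at hv
  have h1 : v 1 = 0 := by linear_combination (hX + hY) / 2
  have h2 : v 2 = 0 := by
    linear_combination Complex.I * (hX - hY) / 2 + v 2 * Complex.I_sq
  fin_cases k <;> assumption

/-- If all `z v k` are imaginary, conjugation exchanges `z (v₁ - i v₂)` and `z (v₁ + i v₂)` up to
sign. This is why the Gauss map is unimodular on the circle. -/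
lemma norm_eq_of_re_mul_eq_zero {v : Fin 3 → ℂ} {z : ℂ} (hz : ‖z‖ = 1)
    (h : ∀ k, (z * v k).re = 0) :
    ‖v 1 - Complex.I * v 2‖ = ‖v 1 + Complex.I * v 2‖ := by
  have e : z * (v 1 - Complex.I * v 2) = -conj (z * (v 1 + Complex.I * v 2)) := by
    have h1 := h 1
    have h2 := h 2
    simp only [Complex.mul_re] at h1 h2
    apply Complex.ext <;> simp <;> linarith
  calc _ = ‖z * (v 1 - Complex.I * v 2)‖ := by rw [norm_mul, hz, one_mul]
    _ = _ := by rw [e, norm_neg, Complex.norm_conj, norm_mul, hz, one_mul]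

lemma DiscData.gauss_denominator_ne_zero {φ : ℂ → Fin 3 → ℂ} {E : Finset ℂ} (h : DiscData φ E)
    (hlt : ∀ z ∈ ball (0 : ℂ) 1, ‖φ z 1 + Complex.I * φ z 2‖ < ‖φ z 1 - Complex.I * φ z 2‖)
    {z : ℂ} (hz : z ∈ closedBall (0 : ℂ) 1) (hzE : z ∉ E) : φ z 1 - Complex.I * φ z 2 ≠ 0 := by
  intro hX
  rcases (mem_closedBall_zero_iff.1 hz).lt_or_eq with h1 | h1
  · have := hlt z (mem_ball_zero_iff.2 h1)
    rw [hX, norm_zero] at this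
    exact (norm_nonneg _).not_gt this
  · have h2 := norm_eq_of_re_mul_eq_zero h1 (h.re_zero z h1 hzE)
    rw [hX, norm_zero, eq_comm, norm_eq_zero] at h2
    obtain ⟨k, hk⟩ := h.ne_zero z hz hzE
    exact hk (eq_zero_of_isotropic (h.null z hz hzE) hX h2 k)

/-- The difference of the two norms is continuous on the connected disc and, by `spacelike`, never
zero, so its sign at the centre decides. -/
lemma DiscData.norm_lt_of_zero {φ : ℂ → Fin 3 → ℂ} {E : Finset ℂ} (h : DiscData φ E)
    (h0 : ‖φ 0 1 + Complex.I * φ 0 2‖ < ‖φ 0 1 - Complex.I * φ 0 2‖) :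
    ∀ z ∈ ball (0 : ℂ) 1, ‖φ z 1 + Complex.I * φ z 2‖ < ‖φ z 1 - Complex.I * φ z 2‖ := by
  intro z hz
  by_contra! hle
  have hc : ContinuousOn (fun z => ‖φ z 1 + Complex.I * φ z 2‖ - ‖φ z 1 - Complex.I * φ z 2‖)
      (ball 0 1) := fun w hw => by
    have ha := fun k => (h.analytic w (Metric.ball_subset_closedBall hw)
      (h.notMem_of_mem_ball hw) k).continuousAt
    have h1 := ha 1
    have h2 := ha 2
    exact ContinuousAt.continuousWithinAt (by fun_prop)
  obtain ⟨w, hw, hw0⟩ := (convex_ball (0 : ℂ) 1).isPreconnected.intermediate_value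
    (Metric.mem_ball_self one_pos) hz hc ⟨(sub_neg.2 h0).le, sub_nonneg.2 hle⟩
  exact h.spacelike w hw ((lorentzC_conj_eq_zero_iff (h.null w (Metric.ball_subset_closedBall hw)
    (h.notMem_of_mem_ball hw))).2 (sub_eq_zero.1 hw0).symm)

/-- At an end, the Gauss map is unimodular and `1 / ω` has a zero. -/
lemma DiscData.exists_gauss_at_end {φ : ℂ → Fin 3 → ℂ} {E : Finset ℂ} (h : DiscData φ E) {e : ℂ}
    (he : e ∈ E) : ∃ g b : ℂ → ℂ, AnalyticAt ℂ g e ∧ AnalyticAt ℂ b e ∧ ‖g e‖ = 1 ∧ b e = 0 ∧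
      ∀ᶠ z in 𝓝[≠] e, -(φ z 0) / (φ z 1 - Complex.I * φ z 2) = g z ∧
        b z * (φ z 1 - Complex.I * φ z 2) = 1 := by
  obtain ⟨b, ψ, hb, hb0, hψ, ⟨k, hk⟩, hn, hs, hev⟩ := h.ends e he
  have hXY := (lorentzC_conj_eq_zero_iff hn).1 hs
  set X : ℂ → ℂ := fun z => ψ z 1 - Complex.I * ψ z 2
  have hXa : AnalyticAt ℂ X e := by
    have h1 := hψ 1
    have h2 := hψ 2
    fun_prop
  have hX : X e ≠ 0 := by
    intro hX
    have hX' : ψ e 1 - Complex.I * ψ e 2 = 0 := hX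
    rw [hX', norm_zero, eq_comm, norm_eq_zero] at hXY
    exact hk (eq_zero_of_isotropic hn hX hXY k)
  refine ⟨fun z => -(ψ z 0) / X z, fun z => b z / X z, (hψ 0).neg.div hXa hX, hb.div hXa hX,
    ?_, by simp [hb0], ?_⟩
  · rw [lorentzC_self_eq, sub_eq_zero] at hn
    have h1 := congrArg norm hn
    rw [norm_mul, ← hXY, norm_pow, ← pow_two] at h1
    rw [norm_div, norm_neg]
    rw [pow_left_inj₀ (norm_nonneg _) (norm_nonneg _) two_ne_zero] at h1
    change ‖X e‖ = _ at h1
    rw [← h1, div_self (norm_ne_zero_iff.2 hX)]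
  · filter_upwards [hev, (hXa.continuousAt.eventually_ne hX).filter_mono nhdsWithin_le_nhds]
      with z hz hXz
    have e1 : X z = b z * (φ z 1 - Complex.I * φ z 2) := by
      simp only [X, ← hz]; ring
    have hb' : b z ≠ 0 := fun hb' => hXz (by rw [e1, hb', zero_mul])
    rw [← hz, e1]
    rw [e1] at hXz
    have hX' := right_ne_zero_of_mul hXz
    constructor <;> field_simp

/-- The Gauss map, extended over the ends, is analytic on the closed disc, of modulus less than `1`
inside and equal to `1` on the circle; its inner critical points other than `0` are excluded by
`not_parallel`. Hence `eq_const_mul_pow_of_inner` applies. -/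
theorem DiscData.exists_gauss_eq {φ : ℂ → Fin 3 → ℂ} {E : Finset ℂ} (h : DiscData φ E)
    (hlt : ∀ z ∈ ball (0 : ℂ) 1, ‖φ z 1 + Complex.I * φ z 2‖ < ‖φ z 1 - Complex.I * φ z 2‖)
    (h0 : φ 0 0 = 0) : ∃ (k : ℕ) (l : ℂ), 1 ≤ k ∧ ‖l‖ = 1 ∧
      ∀ z ∈ closedBall (0 : ℂ) 1, z ∉ E →
        φ z 0 = -(l * z ^ k) * (φ z 1 - Complex.I * φ z 2) := by
  classical
  choose! G b hG _ hG1 _ hev using fun e (he : e ∈ E) => h.exists_gauss_at_end he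
  set g : ℂ → ℂ := fun z => if z ∈ E then G z z else -(φ z 0) / (φ z 1 - Complex.I * φ z 2) with hg
  have hgE : ∀ z ∉ E, g z = -(φ z 0) / (φ z 1 - Complex.I * φ z 2) := fun z hz => if_neg hz
  have hXa : ∀ z ∈ closedBall (0 : ℂ) 1, z ∉ E →
      AnalyticAt ℂ (fun z => φ z 1 - Complex.I * φ z 2) z := by
    intro z hz hzE
    have h1 := h.analytic z hz hzE 1
    have h2 := h.analytic z hz hzE 2
    fun_prop
  have hX := fun z hz hzE => h.gauss_denominator_ne_zero hlt (z := z) hz hzE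
  have hgev : ∀ z ∉ E, g =ᶠ[𝓝 z] fun z => -(φ z 0) / (φ z 1 - Complex.I * φ z 2) := by
    intro z hz
    filter_upwards [E.finite_toSet.isClosed.isOpen_compl.mem_nhds hz] with w hw
    exact hgE w hw
  have hga : ∀ z ∈ closedBall (0 : ℂ) 1, AnalyticAt ℂ g z := by
    intro z hz
    by_cases hzE : z ∈ E
    · refine (hG z hzE).congr ?_
      have h1 : ∀ᶠ w in 𝓝[≠] z, G z w = g w := by
        filter_upwards [hev z hzE, eventually_notMem_finset E z] with w hw hwE
        rw [hgE w hwE, hw.1]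
      have h2 := eventually_nhdsWithin_iff.1 h1
      filter_upwards [h2] with w hw
      by_cases hwz : w = z
      · simp [hg, hwz, hzE]
      · exact hw hwz
    · exact ((h.analytic z hz hzE 0).neg.div (hXa z hz hzE) (hX z hz hzE)).congr (hgev z hzE).symm
  have hsq : ∀ z ∈ closedBall (0 : ℂ) 1, z ∉ E → ‖φ z 0‖ ^ 2 =
      ‖φ z 1 - Complex.I * φ z 2‖ * ‖φ z 1 + Complex.I * φ z 2‖ := by
    intro z hz hzE
    have h1 := h.null z hz hzE
    rw [lorentzC_self_eq, sub_eq_zero] at h1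
    rw [← norm_mul, h1, norm_pow]
  have hlt' : ∀ z ∈ ball (0 : ℂ) 1, ‖g z‖ < 1 := by
    intro z hz
    have hzE := h.notMem_of_mem_ball hz
    have hz' := Metric.ball_subset_closedBall hz
    have hp := norm_pos_iff.2 (hX z hz' hzE)
    rw [hgE z hzE, norm_div, norm_neg, div_lt_one hp]
    refine lt_of_pow_lt_pow_left₀ 2 hp.le ?_
    rw [hsq z hz' hzE, pow_two]
    exact mul_lt_mul_of_pos_left (hlt z hz) hp
  have hone : ∀ z, ‖z‖ = 1 → ‖g z‖ = 1 := by
    intro z hz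
    by_cases hzE : z ∈ E
    · simp only [hg, if_pos hzE]; exact hG1 z hzE
    · have hz' : z ∈ closedBall (0 : ℂ) 1 := mem_closedBall_zero_iff.2 hz.le
      have hp := norm_pos_iff.2 (hX z hz' hzE)
      rw [hgE z hzE, norm_div, norm_neg, div_eq_one_iff_eq hp.ne']
      refine (pow_left_inj₀ (norm_nonneg _) hp.le two_ne_zero).1 ?_
      rw [hsq z hz' hzE, ← norm_eq_of_re_mul_eq_zero hz (h.re_zero z hz hzE), pow_two]
  have hcrit : ∀ z ∈ ball (0 : ℂ) 1, z ≠ 0 → deriv g z ≠ 0 := by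
    intro z hz hz0 hd
    have hzE := h.notMem_of_mem_ball hz
    have hz' := Metric.ball_subset_closedBall hz
    have hXd := (hXa z hz' hzE).differentiableAt.hasDerivAt
    have hgd := (hga z hz').differentiableAt.hasDerivAt
    rw [hd] at hgd
    set X : ℂ → ℂ := fun z => φ z 1 - Complex.I * φ z 2
    have hball : ∀ᶠ w in 𝓝 z, w ∈ ball (0 : ℂ) 1 := Metric.isOpen_ball.mem_nhds hz
    have e0 : ∀ w ∈ ball (0 : ℂ) 1, φ w 0 = -(g w * X w) := by
      intro w hw
      rw [hgE w (h.notMem_of_mem_ball hw), div_mul_cancel₀ _ (hX w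
        (Metric.ball_subset_closedBall hw) (h.notMem_of_mem_ball hw)), neg_neg]
    have eY : ∀ w ∈ ball (0 : ℂ) 1, φ w 1 + Complex.I * φ w 2 = g w ^ 2 * X w := by
      intro w hw
      have hX' := hX w (Metric.ball_subset_closedBall hw) (h.notMem_of_mem_ball hw)
      have h1 := h.null w (Metric.ball_subset_closedBall hw) (h.notMem_of_mem_ball hw)
      rw [lorentzC_self_eq, sub_eq_zero, e0 w hw] at h1
      apply mul_left_cancel₀ hX'
      rw [h1]; ring
    -- Near `z` one has `φ = (-g, (1 + g²) / 2, i (1 - g²) / 2) X`. When `g'(z) = 0` only `X`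
    -- contributes to the derivative.
    refine h.not_parallel z hz hz0 ⟨deriv X z / X z, fun k => ?_⟩
    have hXz : X z ≠ 0 := hX z hz' hzE
    fin_cases k
    · have h1 : (fun w => φ w 0) =ᶠ[𝓝 z] fun w => -(g w * X w) := hball.mono e0
      have h2 := (hgd.mul hXd).neg
      change deriv (fun w => φ w 0) z = _ * φ z 0
      rw [h1.deriv_eq, e0 z hz]
      refine h2.deriv.trans ?_
      field_simp
      ring
    · have e1 : ∀ w ∈ ball (0 : ℂ) 1, φ w 1 = (1 + g w ^ 2) * X w / 2 := by
        intro w hw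
        have := eY w hw
        linear_combination this / 2
      have h1 : (fun w => φ w 1) =ᶠ[𝓝 z] fun w => (1 + g w ^ 2) * X w / 2 := hball.mono e1
      have h2 := (((hgd.pow 2).const_add 1).mul hXd).div_const 2
      change deriv (fun w => φ w 1) z = _ * φ z 1
      rw [h1.deriv_eq, e1 z hz]
      refine h2.deriv.trans ?_
      field_simp
      simp
      ring
    · have e1 : ∀ w ∈ ball (0 : ℂ) 1, φ w 2 = Complex.I * ((1 - g w ^ 2) * X w / 2) := by
        intro w hw
        have := eY w hw
        linear_combination -Complex.I * this / 2 + φ w 2 * Complex.I_sq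
      have h1 : (fun w => φ w 2) =ᶠ[𝓝 z] fun w => Complex.I * ((1 - g w ^ 2) * X w / 2) :=
        hball.mono e1
      have h2 := ((((hgd.pow 2).const_sub 1).mul hXd).div_const 2).const_mul Complex.I
      change deriv (fun w => φ w 2) z = _ * φ z 2
      rw [h1.deriv_eq, e1 z hz]
      refine h2.deriv.trans ?_
      field_simp
      simp
      ring
  have hg0 : g 0 = 0 := by
    rw [hgE 0 (h.notMem_of_mem_ball (Metric.mem_ball_self one_pos)), h0]
    simp
  obtain ⟨k, l, hk, hl, hkl⟩ := eq_const_mul_pow_of_inner hga hlt' hone hg0 hcrit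
  refine ⟨k, l, hk, hl, fun z hz hzE => ?_⟩
  rw [← hkl z hz, hgE z hzE]
  have := hX z hz hzE
  field_simp

/-- The rotation by which the Gauss map gets multiplied by `conj l`. -/
def rotation (l : ℂ) : Matrix (Fin 3) (Fin 3) ℝ :=
  !![1, 0, 0; 0, l.re, l.im; 0, -l.im, l.re]

lemma isLorentz_rotation {l : ℂ} (hl : ‖l‖ = 1) : IsLorentz (rotation l) := by
  intro x y
  have h : l.re * l.re + l.im * l.im = 1 := by
    rw [← Complex.normSq_apply, Complex.normSq_eq_norm_sq, hl, one_pow]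
  simp only [lorentz, mulVec_fin_three, rotation, Matrix.of_apply, Matrix.cons_val',
    Matrix.cons_val_zero, Matrix.cons_val_one, Matrix.cons_val, Matrix.cons_val_fin_one]
  linear_combination (x 1 * y 1 + x 2 * y 2) * h

/-- The Lorentz transformation under which the value `g` of the Gauss map becomes `0`. -/
def boost (g : ℂ) : Matrix (Fin 3) (Fin 3) ℝ :=
  (1 - (g.re ^ 2 + g.im ^ 2))⁻¹ •
    !![1 + (g.re ^ 2 + g.im ^ 2), 2 * g.re, 2 * g.im;
      2 * g.re, 1 + g.re ^ 2 - g.im ^ 2, 2 * g.re * g.im;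
      2 * g.im, 2 * g.re * g.im, 1 - g.re ^ 2 + g.im ^ 2]

lemma isLorentz_boost {g : ℂ} (hg : ‖g‖ < 1) : IsLorentz (boost g) := by
  intro x y
  have h : 1 - (g.re ^ 2 + g.im ^ 2) ≠ 0 := by
    have : g.re ^ 2 + g.im ^ 2 = ‖g‖ ^ 2 := by
      rw [← Complex.normSq_eq_norm_sq, Complex.normSq_apply]; ring
    rw [this]
    nlinarith [norm_nonneg g]
  simp only [lorentz, mulVec_fin_three, boost, Matrix.smul_apply, smul_eq_mul, Matrix.of_apply,
    Matrix.cons_val',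
    Matrix.cons_val_zero, Matrix.cons_val_one, Matrix.cons_val, Matrix.cons_val_fin_one]
  field_simp
  ring

/-- The reflection by which the Gauss map gets inverted. -/
def reflection : Matrix (Fin 3) (Fin 3) ℝ := !![1, 0, 0; 0, 1, 0; 0, 0, -1]

lemma isLorentz_reflection : IsLorentz reflection := by
  intro x y
  simp [lorentz, mulVec_fin_three, reflection]

/-- After a Lorentz transformation the Gauss map has absolute value less than `1` inside the disc
and vanishes at the centre. -/
theorem DiscData.exists_normalization {φ : ℂ → Fin 3 → ℂ} {E : Finset ℂ} (h : DiscData φ E) :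
    ∃ A, IsLorentz A ∧ Maxface.cmul A (φ 0) 0 = 0 ∧ ∀ z ∈ ball (0 : ℂ) 1,
      ‖Maxface.cmul A (φ z) 1 + Complex.I * Maxface.cmul A (φ z) 2‖ <
        ‖Maxface.cmul A (φ z) 1 - Complex.I * Maxface.cmul A (φ z) 2‖ := by
  have hb0 : (0 : ℂ) ∈ ball (0 : ℂ) 1 := Metric.mem_ball_self one_pos
  have hc0 := Metric.ball_subset_closedBall hb0
  -- A reflection exchanges the two norms if they come in the wrong order, and it leaves the time
  -- component alone.
  have key : ∀ {φ : ℂ → Fin 3 → ℂ} (_ : DiscData φ E), ∃ A, IsLorentz A ∧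
      ‖Maxface.cmul A (φ 0) 1 + Complex.I * Maxface.cmul A (φ 0) 2‖ <
        ‖Maxface.cmul A (φ 0) 1 - Complex.I * Maxface.cmul A (φ 0) 2‖ ∧
      Maxface.cmul A (φ 0) 0 = φ 0 0 := by
    intro φ h
    have hne : ‖φ 0 1 - Complex.I * φ 0 2‖ ≠ ‖φ 0 1 + Complex.I * φ 0 2‖ := fun h' =>
      h.spacelike 0 hb0 ((lorentzC_conj_eq_zero_iff
        (h.null 0 hc0 (h.notMem_of_mem_ball hb0))).2 h')
    rcases hne.lt_or_gt with h' | h'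
    · exact ⟨reflection, isLorentz_reflection, by simpa [Maxface.cmul, reflection, ← sub_eq_add_neg]
        using h', by simp [Maxface.cmul, reflection]⟩
    · exact ⟨1, fun x y => by simp, by simpa [Maxface.cmul] using h', by simp [Maxface.cmul]⟩
  obtain ⟨A, hA, hlt, -⟩ := key h
  have h1 := h.cmul hA
  set χ := fun z => Maxface.cmul A (φ z) with hχ
  change ‖χ 0 1 + Complex.I * χ 0 2‖ < ‖χ 0 1 - Complex.I * χ 0 2‖ at hlt
  set X := χ 0 1 - Complex.I * χ 0 2 with hXdef
  have hXp : 0 < ‖X‖ := (norm_nonneg _).trans_lt hlt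
  have hX : X ≠ 0 := norm_pos_iff.1 hXp
  obtain ⟨g, hg⟩ : ∃ g, χ 0 0 = -(g * X) := ⟨-(χ 0 0) / X, by field_simp⟩
  have hnull := h1.null 0 hc0 (h.notMem_of_mem_ball hb0)
  rw [lorentzC_self_eq, sub_eq_zero, ← hXdef, hg] at hnull
  have hY : χ 0 1 + Complex.I * χ 0 2 = g ^ 2 * X := by
    apply mul_left_cancel₀ hX
    rw [hnull]; ring
  have hg1 : ‖g‖ < 1 := by
    rw [hY, norm_mul, norm_pow] at hlt
    by_contra! hle
    exact absurd hlt (not_lt.2 (le_mul_of_one_le_left hXp.le (one_le_pow₀ hle)))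
  have hB := isLorentz_boost hg1
  have h2 := h1.cmul hB
  have hz : Maxface.cmul (boost g) (χ 0) 0 = 0 := by
    have e1 : χ 0 1 = (1 + g ^ 2) * X / 2 := by linear_combination (hY - hXdef) / 2
    have e2 : χ 0 2 = Complex.I * ((1 - g ^ 2) * X / 2) := by
      linear_combination -Complex.I * (hY + hXdef) / 2 + χ 0 2 * Complex.I_sq
    have e3 : g = g.re + g.im * Complex.I := (Complex.re_add_im g).symm
    simp only [Maxface.cmul, boost, Matrix.smul_apply, smul_eq_mul, Matrix.of_apply,
      Matrix.cons_val', Matrix.cons_val_zero, Matrix.cons_val_one, Matrix.cons_val,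
      Matrix.cons_val_fin_one, hg, e1, e2]
    push_cast
    set a : ℂ := (g.re : ℂ)
    set b : ℂ := (g.im : ℂ)
    rw [e3]
    have hI := Complex.I_sq
    have hI3 : Complex.I ^ 3 = -Complex.I := by rw [pow_succ, hI]; ring
    ring_nf
    simp only [hI, hI3]
    ring
  -- Applying `key` again after the boost restores the inequality, whatever the boost did to it,
  -- without disturbing the zero at the centre.
  obtain ⟨C, hC, hlt', hC0⟩ := key h2
  refine ⟨C * (boost g * A), hC.mul (hB.mul hA), ?_, ?_⟩
  · rw [cmul_mul, cmul_mul]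
    exact hC0.trans hz
  · have h3 := (h2.cmul hC).norm_lt_of_zero hlt'
    simpa only [cmul_mul, hχ] using h3

end

/-! ### Identification of the null curve with the principal data. -/

section

open Metric (ball closedBall)

/-- After normalization the Gauss map is `l z ^ k`; a rotation of the spatial plane removes `l`. The
form is then found by `exists_eq_principalForm` up to a real factor, which becomes the homothety. -/
theorem DiscData.exists_eq_weierstrassForm {φ : ℂ → Fin 3 → ℂ} {E : Finset ℂ} (h : DiscData φ E) :
    ∃ (A : Matrix (Fin 3) (Fin 3) ℝ) (c : ℝ) (k : ℕ) (α : Fin (2 * (k + 1)) → ℝ),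
      IsLorentz A ∧ 0 < c ∧ 1 ≤ k ∧ α ⟨0, by omega⟩ = 0 ∧ Monotone α ∧
      (∀ j, α j < 2 * Real.pi) ∧
      (∀ z : ℂ, z ∈ E ↔ ∃ j, z = Complex.exp (Complex.I * α j)) ∧
      ∀ z ∈ ball (0 : ℂ) 1, ∀ j,
        (c : ℂ) * Maxface.cmul A (φ z) j = weierstrassForm (fun z => z ^ k) (principalForm α) z j := by
  classical
  obtain ⟨B, hB, hB0, hlt₀⟩ := h.exists_normalization
  obtain ⟨k, l, hk, hl, hg₀⟩ := (h.cmul hB).exists_gauss_eq hlt₀ hB0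
  have hR := isLorentz_rotation hl
  have hlc : ‖conj l‖ = 1 := by rw [Complex.norm_conj, hl]
  obtain ⟨A₀, hA₀, χ, hχ⟩ : ∃ A₀, IsLorentz A₀ ∧ ∃ χ, χ = (fun z => Maxface.cmul A₀ (φ z)) ∧
      (∀ z, χ z 1 - Complex.I * χ z 2 =
        l * (Maxface.cmul B (φ z) 1 - Complex.I * Maxface.cmul B (φ z) 2)) ∧
      (∀ z, χ z 1 + Complex.I * χ z 2 =
        conj l * (Maxface.cmul B (φ z) 1 + Complex.I * Maxface.cmul B (φ z) 2)) ∧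
      ∀ z, χ z 0 = Maxface.cmul B (φ z) 0 := by
    refine ⟨rotation l * B, hR.mul hB, _, rfl, fun z => ?_, fun z => ?_, fun z => ?_⟩
    · simp only [cmul_mul]
      set v := Maxface.cmul B (φ z)
      simp only [Maxface.cmul, rotation, Matrix.of_apply, Matrix.cons_val',
        Matrix.cons_val_zero, Matrix.cons_val_one, Matrix.cons_val, Matrix.cons_val_fin_one]
      conv_rhs => rw [← Complex.re_add_im l]
      push_cast
      linear_combination (l.im : ℂ) * v 2 * Complex.I_sq
    · simp only [cmul_mul]
      set v := Maxface.cmul B (φ z)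
      simp only [Maxface.cmul, rotation, Matrix.of_apply, Matrix.cons_val',
        Matrix.cons_val_zero, Matrix.cons_val_one, Matrix.cons_val, Matrix.cons_val_fin_one]
      conv_rhs => rw [← Complex.re_add_im l]
      simp only [map_add, map_mul, Complex.conj_I, Complex.conj_ofReal]
      push_cast
      linear_combination (l.im : ℂ) * v 2 * Complex.I_sq
    · simp only [cmul_mul]
      simp [Maxface.cmul, rotation]
  obtain ⟨hχ, hχX, hχY, hχ0⟩ := hχ
  have hd : DiscData χ E := hχ ▸ h.cmul hA₀
  have hlt : ∀ z ∈ ball (0 : ℂ) 1,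
      ‖χ z 1 + Complex.I * χ z 2‖ < ‖χ z 1 - Complex.I * χ z 2‖ := by
    intro z hz
    rw [hχX, hχY, norm_mul, norm_mul, hl, hlc, one_mul, one_mul]
    exact hlt₀ z hz
  have hg : ∀ z ∈ closedBall (0 : ℂ) 1, z ∉ E →
      χ z 0 = -z ^ k * (χ z 1 - Complex.I * χ z 2) := by
    intro z hz hzE
    rw [hχX, hχ0, hg₀ z hz hzE]
    ring
  have hX := fun z hz hzE => hd.gauss_denominator_ne_zero hlt (z := z) hz hzE
  set X : ℂ → ℂ := fun z => χ z 1 - Complex.I * χ z 2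
  choose! G b _ hb _ hb0 hev using fun e (he : e ∈ E) => hd.exists_gauss_at_end he
  -- The reciprocal of the coefficient `X / 2` of `ω`, extended by its limit `0` at the ends.
  set β : ℂ → ℂ := fun z => if z ∈ E then 0 else 2 / X z with hβ
  have hβE : ∀ z ∉ E, β z = 2 / X z := fun z hz => if_neg hz
  have hβa : ∀ z ∈ closedBall (0 : ℂ) 1, AnalyticAt ℂ β z := by
    intro z hz
    by_cases hzE : z ∈ E
    · refine ((analyticAt_const (v := (2 : ℂ))).mul (hb z hzE)).congr ?_
      have h1 : ∀ᶠ w in 𝓝[≠] z, 2 * b z w = β w := by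
        filter_upwards [hev z hzE, eventually_notMem_finset E z] with w hw hwE
        have h2 := hw.2
        have h3 : X w ≠ 0 := right_ne_zero_of_mul_eq_one h2
        rw [hβE w hwE, eq_div_iff h3]
        linear_combination 2 * h2
      filter_upwards [eventually_nhdsWithin_iff.1 h1] with w hw
      by_cases hwz : w = z
      · simp [hβ, hwz, hzE, hb0 z hzE]
      · exact hw hwz
    · have h1 := hd.analytic z hz hzE 1
      have h2 := hd.analytic z hz hzE 2
      have h3 : AnalyticAt ℂ X z := by fun_prop
      refine ((analyticAt_const (v := (2 : ℂ))).div h3 (hX z hz hzE)).congr ?_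
      filter_upwards [E.finite_toSet.isClosed.isOpen_compl.mem_nhds hzE] with w hw
      exact (hβE w hw).symm
  have hnz : ∀ z ∈ closedBall (0 : ℂ) 1, ∀ᶠ w in 𝓝[≠] z, β w ≠ 0 := by
    intro z hz
    by_cases hzE : z ∈ E
    · filter_upwards [hev z hzE, eventually_notMem_finset E z] with w hw hwE
      rw [hβE w hwE]
      exact div_ne_zero two_ne_zero (right_ne_zero_of_mul_eq_one hw.2)
    · refine ((hβa z hz).continuousAt.eventually_ne ?_).filter_mono nhdsWithin_le_nhds
      rw [hβE z hzE]
      exact div_ne_zero two_ne_zero (hX z hz hzE)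
  obtain ⟨α, hα0, hαm, hαl, hαE, c, hc, hpf⟩ := exists_eq_principalForm hd.one_mem hd.norm_eq
    (h := fun z => X z / 2) (b := β) (l := 1) norm_one k hβa
    (fun z hz hzE => by
      have : X z ≠ 0 := hX z hz hzE
      rw [hβE z hzE]; field_simp)
    (fun e he => if_pos he) hnz (fun z hz hzE => by
      have h1 := hd.re_zero z hz hzE 0
      rw [hg z (mem_closedBall_zero_iff.2 hz.le) hzE] at h1
      have e : z * (-z ^ k * X z) = ((-2 : ℝ) : ℂ) * (1 * z ^ (k + 1) * (X z / 2)) := by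
        push_cast; ring
      rw [e, Complex.re_ofReal_mul] at h1
      simpa using h1)
  -- A homothety factor must be positive; the sign of `c` is absorbed by the isometry `-1`.
  obtain ⟨s, hs, hs1⟩ : ∃ s : ℝ, (s = 1 ∨ s = -1) ∧ s * c = |c| := by
    rcases hc.lt_or_gt with h' | h'
    · exact ⟨-1, Or.inr rfl, by rw [abs_of_neg h']; ring⟩
    · exact ⟨1, Or.inl rfl, by rw [abs_of_pos h']; ring⟩
  refine ⟨s • A₀, |c|⁻¹, k, α, fun x y => ?_, inv_pos.2 (abs_pos.2 hc), hk, hα0, hαm, hαl, hαE,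
    fun z hz j => ?_⟩
  · rw [← hA₀ x y]
    have : s * s = 1 := by rcases hs with rfl | rfl <;> norm_num
    simp only [Matrix.smul_mulVec, lorentz, Pi.smul_apply, smul_eq_mul]
    linear_combination (-(A₀.mulVec x 0 * A₀.mulVec y 0) + A₀.mulVec x 1 * A₀.mulVec y 1 +
      A₀.mulVec x 2 * A₀.mulVec y 2) * this
  · have hz' := Metric.ball_subset_closedBall hz
    have hzE := hd.notMem_of_mem_ball hz
    have e1 : ((|c|⁻¹ : ℝ) : ℂ) * Maxface.cmul (s • A₀) (φ z) j = (c : ℂ)⁻¹ * χ z j := by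
      have e2 : |c|⁻¹ * s = c⁻¹ := by
        have hs0 : s ≠ 0 := by rcases hs with rfl | rfl <;> norm_num
        rw [← hs1]; field_simp
      have e3 : Maxface.cmul (s • A₀) (φ z) j = s * χ z j := by
        rw [hχ]; simp only [Maxface.cmul, Matrix.smul_apply, smul_eq_mul]; push_cast; ring
      rw [e3, ← mul_assoc]
      exact_mod_cast congrArg (fun r : ℝ => (r : ℂ) * χ z j) e2
    have hp := hpf z hz' hzE
    have hcC : (c : ℂ) ≠ 0 := Complex.ofReal_ne_zero.2 hc
    have hP : principalForm α z = (c : ℂ)⁻¹ * (X z / 2) := by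
      field_simp
      rw [one_mul] at hp
      linear_combination -2 * hp
    have hX0 := hg z hz' hzE
    have hY : χ z 1 + Complex.I * χ z 2 = (z ^ k) ^ 2 * X z := by
      have h1 := hd.null z hz' hzE
      rw [lorentzC_self_eq, sub_eq_zero, hX0] at h1
      apply mul_left_cancel₀ (hX z hz' hzE)
      rw [h1]; ring
    have hXd : X z = χ z 1 - Complex.I * χ z 2 := rfl
    rw [e1]
    fin_cases j
    · change _ * χ z 0 = -2 * z ^ k * principalForm α z
      rw [hP, hX0, ← hXd]; ring
    · change _ * χ z 1 = (1 + (z ^ k) ^ 2) * principalForm α z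
      rw [hP]
      linear_combination (c : ℂ)⁻¹ * (hY - hXd) / 2
    · change _ * χ z 2 = Complex.I * (1 - (z ^ k) ^ 2) * principalForm α z
      rw [hP]
      linear_combination (c : ℂ)⁻¹ * (-Complex.I * (hY + hXd) / 2 + χ z 2 * Complex.I_sq)

end

/-! ### The principal data: ends and fold-type. -/

section

/-- The denominator of `principalForm`. -/
def endPoly {m : ℕ} (α : Fin m → ℝ) (z : ℂ) : ℂ :=
  ∏ j, (z - Complex.exp (Complex.I * (α j : ℂ)))

/-- The numerator of `principalForm`. -/
def principalConst {m : ℕ} (α : Fin m → ℝ) : ℂ :=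
  Complex.I * Complex.exp (Complex.I * ((∑ j, (α j : ℂ)) / 2))

lemma norm_exp_I_mul (t : ℝ) : ‖Complex.exp (Complex.I * (t : ℂ))‖ = 1 := by
  rw [mul_comm, Complex.norm_exp_ofReal_mul_I]

section

variable {m : ℕ} (α : Fin m → ℝ)

lemma principalForm_eq (z : ℂ) : principalForm α z = principalConst α / endPoly α z := rfl

lemma principalConst_ne_zero : principalConst α ≠ 0 :=
  mul_ne_zero Complex.I_ne_zero (Complex.exp_ne_zero _)

lemma analyticAt_endPoly (z : ℂ) : AnalyticAt ℂ (endPoly α) z := by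
  unfold endPoly
  fun_prop

lemma endPoly_eq_zero_iff (z : ℂ) :
    endPoly α z = 0 ↔ ∃ j, z = Complex.exp (Complex.I * (α j : ℂ)) := by
  simp [endPoly, Finset.prod_eq_zero_iff, sub_eq_zero]

lemma eventually_endPoly_ne_zero (z : ℂ) : ∀ᶠ w in 𝓝[≠] z, endPoly α w ≠ 0 := by
  filter_upwards [eventually_notMem_finset
    (Finset.univ.image fun j => Complex.exp (Complex.I * (α j : ℂ))) z] with w hw h
  obtain ⟨j, rfl⟩ := (endPoly_eq_zero_iff α w).1 h
  simp at hw

lemma analyticAt_principalForm {z : ℂ} (h : endPoly α z ≠ 0) :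
    AnalyticAt ℂ (principalForm α) z :=
  analyticAt_const.div (analyticAt_endPoly α z) h

lemma tendsto_principalForm_mul (z : ℂ) :
    Tendsto (fun w => principalForm α w * endPoly α w) (𝓝[≠] z) (𝓝 (principalConst α)) := by
  refine tendsto_const_nhds.congr' ?_
  filter_upwards [eventually_endPoly_ne_zero α z] with w hw
  rw [principalForm_eq, div_mul_cancel₀ _ hw]

lemma not_analyticAt_principalForm {z : ℂ} (h : endPoly α z = 0) :
    ¬ AnalyticAt ℂ (principalForm α) z := by
  intro ha
  have h1 : Tendsto (fun w => principalForm α w * endPoly α w) (𝓝[≠] z) (𝓝 _) :=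
    ((ha.mul (analyticAt_endPoly α z)).continuousAt.tendsto).mono_left nhdsWithin_le_nhds
  have h2 := tendsto_nhds_unique h1 (tendsto_principalForm_mul α z)
  apply principalConst_ne_zero α
  rw [← h2]
  simp [h]

lemma meromorphicNFAt_principalForm (z : ℂ) : MeromorphicNFAt (principalForm α) z := by
  have h1 : principalForm α = (fun z => (principalConst α)⁻¹ * endPoly α z)⁻¹ := by
    funext w
    simp [principalForm_eq, div_eq_mul_inv, mul_comm]
  rw [h1]
  exact (analyticAt_const.mul (analyticAt_endPoly α z)).meromorphicNFAt.inv

lemma formOrder_principalForm_le (z : ℂ) : formOrder (z : Sphere) (principalForm α) ≤ 0 := by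
  by_contra! h
  have h1 : Tendsto (principalForm α) (𝓝[≠] z) (𝓝 0) := tendsto_zero_of_meromorphicOrderAt_pos h
  have h2 := h1.mul ((analyticAt_endPoly α z).continuousAt.tendsto.mono_left nhdsWithin_le_nhds)
  rw [zero_mul] at h2
  exact principalConst_ne_zero α (tendsto_nhds_unique (tendsto_principalForm_mul α z) h2)

end

lemma endPoly_inv {m : ℕ} (α : Fin m → ℝ) {w : ℂ} (hw : w ≠ 0) :
    endPoly α w⁻¹ * w ^ m = ∏ j, (1 - Complex.exp (Complex.I * (α j : ℂ)) * w) := by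
  have h : w ^ m = ∏ _j : Fin m, w := by simp
  rw [endPoly, h, ← Finset.prod_mul_distrib]
  refine Finset.prod_congr rfl fun j _ => ?_
  rw [sub_mul, inv_mul_cancel₀ hw]

/-- The behaviour of the forms `z ^ i * ω` at infinity. -/
lemma exists_formCoeff_infty {k : ℕ} (α : Fin (2 * (k + 1)) → ℝ) :
    ∃ u : ℂ → ℂ, AnalyticAt ℂ u 0 ∧ u 0 ≠ 0 ∧ ∀ i ≤ 2 * k,
      formCoeff ∞ (fun z => z ^ i * principalForm α z) =ᶠ[𝓝[≠] 0] fun w => w ^ (2 * k - i) * u w := by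
  -- The denominator has degree `2 k + 2` and `dz` contributes `-dw / w²`, so `ω` has a zero of
  -- order `2 k` at `∞`, which `g² = z ^ (2 k)` cancels exactly.
  set D : ℂ → ℂ := fun w => ∏ j, (1 - Complex.exp (Complex.I * (α j : ℂ)) * w) with hD
  have hDa : AnalyticAt ℂ D 0 := by simp only [hD]; fun_prop
  have hD0 : D 0 ≠ 0 := by simp [hD]
  refine ⟨fun w => -principalConst α / D w, analyticAt_const.div hDa hD0,
    div_ne_zero (neg_ne_zero.2 (principalConst_ne_zero α)) hD0, fun i hi => ?_⟩
  filter_upwards [self_mem_nhdsWithin,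
    (hDa.continuousAt.eventually_ne hD0).filter_mono nhdsWithin_le_nhds] with w hw hDw
  have hw0 : w ≠ 0 := hw
  have h1 : endPoly α w⁻¹ * w ^ (2 * (k + 1)) = D w := endPoly_inv α hw0
  have h2 : endPoly α w⁻¹ ≠ 0 := left_ne_zero_of_mul (h1 ▸ hDw)
  change -(w⁻¹ ^ i * principalForm α w⁻¹) / w ^ 2 = _
  have h3 : w ^ (2 * (k + 1)) = w ^ (2 * k - i) * w ^ i * w ^ 2 := by
    rw [← pow_add, ← pow_add]; congr 1; omega
  rw [← h1, h3, principalForm_eq, inv_pow]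
  field_simp

/-- The expression is `-i k` times `endPoly α z / (L z ^ (k + 1))`. On the circle the square of this
quotient is the nonnegative number `∏ |z - e_j|²`, so the quotient is real; this is the purpose of
the constant `Λ`. -/
lemma re_deriv_div_eq_zero {k : ℕ} (α : Fin (2 * (k + 1)) → ℝ) {z : ℂ} (hz : ‖z‖ = 1) :
    (deriv (fun z : ℂ => z ^ k) z / ((z ^ k) ^ 2 * principalForm α z)).re = 0 := by
  have hz0 : z ≠ 0 := by rintro rfl; simp at hz
  set L := Complex.exp (Complex.I * ((∑ j, (α j : ℂ)) / 2)) with hL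
  have hL0 : L ≠ 0 := Complex.exp_ne_zero _
  have hL2 : L ^ 2 = ∏ j, Complex.exp (Complex.I * (α j : ℂ)) := by
    rw [hL, ← Complex.exp_nat_mul, ← Complex.exp_sum, ← Finset.mul_sum]
    congr 1; push_cast; ring
  have hsq : (endPoly α z / (L * z ^ (k + 1))) ^ 2 =
      ((∏ j, ‖z - Complex.exp (Complex.I * (α j : ℂ))‖ ^ 2 : ℝ) : ℂ) := by
    have : endPoly α z ^ 2 = z ^ (2 * (k + 1)) * L ^ 2 *
        ((∏ j, ‖z - Complex.exp (Complex.I * (α j : ℂ))‖ ^ 2 : ℝ) : ℂ) := by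
      rw [endPoly, ← Finset.prod_pow]
      simp_rw [sub_sq_of_norm_eq_one hz (norm_exp_I_mul _)]
      rw [Finset.prod_mul_distrib, Finset.prod_mul_distrib, Finset.prod_mul_distrib, hL2]
      simp [pow_mul]
    rw [div_pow, this, mul_pow]
    field_simp
    ring
  have him : (endPoly α z / (L * z ^ (k + 1))).im = 0 := by
    set q := endPoly α z / (L * z ^ (k + 1))
    have hr : 0 ≤ ∏ j, ‖z - Complex.exp (Complex.I * (α j : ℂ))‖ ^ 2 :=
      Finset.prod_nonneg fun j _ => by positivity
    have h1 := congrArg Complex.re hsq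
    have h2 := congrArg Complex.im hsq
    rw [Complex.ofReal_re] at h1
    rw [Complex.ofReal_im] at h2
    simp only [pow_two, Complex.mul_re, Complex.mul_im] at h1 h2
    by_contra hne
    have h3 : q.re = 0 := by
      rcases mul_eq_zero.1 (show q.im * q.re = 0 by linarith) with h | h
      · exact absurd h hne
      · exact h
    rw [h3] at h1
    simp only [pow_two] at hr
    have := mul_self_pos.2 hne
    linarith
  have e : deriv (fun z : ℂ => z ^ k) z / ((z ^ k) ^ 2 * principalForm α z) =
      ((k : ℝ) : ℂ) * (-Complex.I * (endPoly α z / (L * z ^ (k + 1)))) := by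
    have hc : principalForm α z = Complex.I * L / endPoly α z := rfl
    rw [hc, deriv_pow_field]
    rcases Nat.eq_zero_or_pos k with rfl | hk
    · simp
    have h3 : z ^ (k + 1) = z ^ (k - 1) * z ^ 2 := by rw [← pow_add]; congr 1; omega
    have h4 : z ^ k = z ^ (k - 1) * z := by rw [← pow_succ]; congr 1; omega
    rw [h3, h4]
    by_cases hE : endPoly α z = 0
    · simp [hE]
    have hI := Complex.I_ne_zero
    push_cast
    field_simp
    rw [Complex.I_sq]
    ring
  rw [e, Complex.re_ofReal_mul, neg_mul, Complex.neg_re, Complex.I_mul_re, him]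
  simp

/-- The ends of the principal data are the points `exp (i α_j)`. -/
theorem isEnd_principalForm_iff {k : ℕ} (α : Fin (2 * (k + 1)) → ℝ) (p : Sphere) :
    IsEnd (fun z => z ^ k) (principalForm α) p ↔
      ∃ j, p = (Complex.exp (Complex.I * (α j : ℂ)) : Sphere) := by
  induction p using OnePoint.rec with
  | infty =>
    simp only [OnePoint.infty_ne_coe, exists_false, iff_false]
    obtain ⟨u, hu, -, hform⟩ := exists_formCoeff_infty α
    have key : ∀ i ≤ 2 * k, ¬ formOrder ∞ (fun z => z ^ i * principalForm α z) < 0 := by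
      intro i hi
      rw [not_lt, formOrder, coordAt_infty, meromorphicOrderAt_congr (hform i hi)]
      exact ((analyticAt_id.pow _).mul hu).meromorphicOrderAt_nonneg
    rintro (h | h | h)
    · exact key 0 (by omega) (by simpa using h)
    · exact key k (by omega) h
    · exact key (2 * k) le_rfl (by simpa only [← pow_mul, mul_comm] using h)
  | coe z =>
    simp only [OnePoint.coe_eq_coe, ← endPoly_eq_zero_iff]
    constructor
    · intro h
      by_contra hne
      have ha := analyticAt_principalForm α hne
      have hp : AnalyticAt ℂ (fun z : ℂ => z ^ k) z := analyticAt_id.pow k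
      rcases h with h | h | h
      · exact ha.meromorphicOrderAt_nonneg.not_gt h
      · exact (hp.mul ha).meromorphicOrderAt_nonneg.not_gt h
      · exact ((hp.pow 2).mul ha).meromorphicOrderAt_nonneg.not_gt h
    · intro h
      left
      by_contra hle
      exact not_analyticAt_principalForm α h
        ((meromorphicNFAt_principalForm α z).meromorphicOrderAt_nonneg_iff_analyticAt.1
          (not_lt.1 hle))

/-- The principal data are of fold-type. -/
theorem isFoldType_principalForm {k : ℕ} (hk : 1 ≤ k) (α : Fin (2 * (k + 1)) → ℝ) :
    IsFoldType (fun z => z ^ k) (principalForm α) where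
  mero_g z _ := (analyticAt_id.pow k).meromorphicNFAt
  mero_h z _ := meromorphicNFAt_principalForm α z
  mero_g_infty := (MeromorphicAt.id 0).inv.pow k
  mero_h_infty := by
    refine MeromorphicAt.div (MeromorphicAt.const _ _) ?_
    refine MeromorphicAt.fun_prod fun j _ => ?_
    exact (MeromorphicAt.id 0).inv.sub (MeromorphicAt.const _ _)
  no_zero p := by
    induction p using OnePoint.rec with
    | infty =>
      right; right
      obtain ⟨u, hu, hu0, hform⟩ := exists_formCoeff_infty α
      have h1 := hform (2 * k) le_rfl
      simp only [Nat.sub_self, pow_zero, one_mul, pow_mul'] at h1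
      rw [formOrder, coordAt_infty, meromorphicOrderAt_congr h1]
      by_contra! h
      exact hu0 (tendsto_nhds_unique (hu.continuousAt.tendsto.mono_left nhdsWithin_le_nhds)
        (tendsto_zero_of_meromorphicOrderAt_pos h))
    | coe z => exact Or.inl (formOrder_principalForm_le α z)
  ends p hp := by
    obtain ⟨j, rfl⟩ := (isEnd_principalForm_iff α p).1 hp
    exact ⟨_, norm_exp_I_mul _, rfl⟩
  norm_one z := by
    rw [norm_pow, pow_eq_one_iff_of_nonneg (norm_nonneg z) (by omega)]
  norm_infty h := by
    have h1 := h.eventually (gt_mem_nhds one_lt_two)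
    have h2 : ∀ᶠ w : ℂ in 𝓝[≠] 0, ‖w‖ < 1 / 2 := by
      refine Eventually.filter_mono nhdsWithin_le_nhds ?_
      exact continuous_norm.continuousAt.eventually (gt_mem_nhds (by norm_num))
    obtain ⟨w, h3, h4, h5⟩ := (h1.and (h2.and self_mem_nhdsWithin)).exists
    have hw : 0 < ‖w‖ := norm_pos_iff.2 h5
    have h6 : 2 ≤ ‖w⁻¹‖ := by
      rw [norm_inv, le_inv_comm₀ two_pos hw]; linarith
    have h7 : ‖w⁻¹‖ ≤ ‖w⁻¹‖ ^ k := le_self_pow₀ (by linarith) (by omega)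
    rw [norm_pow] at h3
    linarith
  re_zero z hz := re_deriv_div_eq_zero α hz

end

/-! ### Existence of ends, and the effect of the inversion. -/

section

lemma IsNullLift.hasFDerivAt {u : ℂ → R31} {z : ℂ} (hu : IsNullLift u z) (k : Fin 3) :
    HasFDerivAt (fun w => u w k)
      (Complex.reCLM.comp (liftDeriv u k z • (1 : ℂ →L[ℝ] ℂ))) z := by
  have h := hasFDerivAt_pi'.1 hu.diff.self_of_nhds.hasFDerivAt k
  refine h.congr_fderiv (ContinuousLinearMap.ext fun a => ?_)
  exact dd_eq_re u a z k

lemma IsMaxface.continuousAt {f : Sphere → R31} {E : Finset Sphere} (hf : IsMaxface f E)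
    {p : Sphere} (hp : p ∉ E) : ContinuousAt f p := by
  have h := (hf.smooth p hp).continuousAt
  rw [ContinuousAt, ← map_paramAt_nhds p, tendsto_map'_iff]
  have h1 : loc f p (coordAt p) = f p := by rw [loc, paramAt_coordAt]
  rw [ContinuousAt, h1] at h
  exact h

/-- There is no compact maxface without branch points. -/
theorem IsMaxface.nonempty {f : Sphere → R31} {E : Finset Sphere} (hf : IsMaxface f E) :
    E.Nonempty := by
  by_contra hE
  rw [Finset.not_nonempty_iff_eq_empty] at hE
  subst hE
  set u : ℂ → R31 := fun w => f (w : Sphere)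
  have hu : ∀ z, IsNullLift u z := fun z => hf.isNullLift (p := (z : Sphere)) (by simp)
  obtain ⟨C, hC⟩ : ∃ C, ∀ p, ‖f p‖ ≤ C := by
    have hc : Continuous f := continuous_iff_continuousAt.2 fun p => hf.continuousAt (by simp)
    obtain ⟨C, hC⟩ := (isCompact_range hc).isBounded.exists_norm_le
    exact ⟨C, fun p => hC _ ⟨p, rfl⟩⟩
  have hz : ∀ k z, liftDeriv u k z = 0 := by
    intro k
    have hd : Differentiable ℂ (liftDeriv u k) := fun z => ((hu z).analytic k).differentiableAt
    obtain ⟨F, hF⟩ := hd.isExactOn_univ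
    have hF' : ∀ z, HasDerivAt F (liftDeriv u k z) z := fun z => hF z (mem_univ z)
    have hre : ∀ z, HasFDerivAt (fun w => (F w).re - u w k) (0 : ℂ →L[ℝ] ℝ) z := by
      intro z
      have h1 := (Complex.reCLM.hasFDerivAt.comp z
        ((hF' z).hasFDerivAt.restrictScalars ℝ)).sub ((hu z).hasFDerivAt k)
      refine HasFDerivAt.congr_fderiv (f' := _) h1 (ContinuousLinearMap.ext fun a => ?_)
      simp [mul_comm]
    have hconst : ∀ z, (F z).re - u z k = (F 0).re - u 0 k := fun z =>
      is_const_of_fderiv_eq_zero (fun z => (hre z).differentiableAt) (fun z => (hre z).fderiv) z 0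
    -- On the compact sphere `f` is bounded, so a primitive `F` of the lift has bounded real part.
    -- Liouville's theorem for `exp F` then kills its derivative.
    have hexp : Differentiable ℂ fun z => Complex.exp (F z) := fun z =>
      (hF' z).differentiableAt.cexp
    have hb : Bornology.IsBounded (range fun z => Complex.exp (F z)) := by
      refine isBounded_iff_forall_norm_le.2 ⟨Real.exp ((F 0).re - u 0 k + C), ?_⟩
      rintro _ ⟨z, rfl⟩
      rw [Complex.norm_exp, Real.exp_le_exp]
      have h1 := hconst z
      have h2 : u z k ≤ C := (le_abs_self _).trans ((norm_le_pi_norm (u z) k).trans (hC z))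
      linarith
    intro z
    have h1 : (fun z => Complex.exp (F z)) = fun _ => Complex.exp (F 0) := by
      funext z; exact hexp.apply_eq_apply_of_bounded hb z 0
    have h2 := (hF' z).cexp
    rw [h1] at h2
    have h3 := h2.unique (hasDerivAt_const z _)
    exact (mul_eq_zero.1 h3).resolve_left (Complex.exp_ne_zero _)
  apply hf.no_branch ((0 : ℂ) : Sphere) (by simp)
  ext a k
  change dd u a 0 k = 0
  rw [dd_eq_re, hz]
  simp

lemma liftDeriv_conj {u : ℂ → R31} {w : ℂ} (hu : DifferentiableAt ℝ u (conj w)) (k : Fin 3) :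
    liftDeriv (fun x => u (conj x)) k w = conj (liftDeriv u k (conj w)) := by
  have h1 : HasFDerivAt (fun x => u (conj x))
      ((fderiv ℝ u (conj w)).comp (Complex.conjCLE : ℂ →L[ℝ] ℂ)) w :=
    hu.hasFDerivAt.comp w Complex.conjCLE.hasFDerivAt
  have h2 : ∀ a, dd (fun x => u (conj x)) a w = dd u (conj a) (conj w) := by
    intro a
    simp only [dd, h1.fderiv]
    rfl
  have h3 : dd u (-Complex.I) (conj w) = -dd u Complex.I (conj w) := map_neg _ _
  simp [liftDeriv, h2, h3]

/-- The derivative of a null curve whose real part is invariant under inversion in the circle. -/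
lemma liftDeriv_of_inversion {u : ℂ → R31} {z : ℂ} (hz : z ≠ 0)
    (hu : DifferentiableAt ℝ u (conj z)⁻¹) (h : ∀ᶠ x in 𝓝 z, u x = u (conj x)⁻¹) (k : Fin 3) :
    liftDeriv u k z = conj (liftDeriv u k (conj z)⁻¹) * deriv (fun x => x⁻¹) z := by
  have e : ∀ x : ℂ, conj x⁻¹ = (conj x)⁻¹ := fun x => map_inv₀ _ _
  have hu' : DifferentiableAt ℝ u (conj z⁻¹) := by rwa [e]
  have hv : DifferentiableAt ℝ (fun x => u (conj x)) z⁻¹ :=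
    hu'.comp z⁻¹ Complex.conjCLE.differentiableAt
  rw [liftDeriv_comp (u := u) (v := fun x => u (conj x)) (μ := fun x => x⁻¹) hv
    (differentiableAt_inv hz) (h.mono fun x hx => by rw [hx, e]) k, liftDeriv_conj hu', e]

/-- The inversion fixes `z`, so its transformation rule becomes `z F' = -conj (z F')`. -/
lemma re_mul_liftDeriv_eq_zero {u : ℂ → R31} {z : ℂ} (hz : ‖z‖ = 1)
    (hu : DifferentiableAt ℝ u z) (h : ∀ᶠ x in 𝓝 z, u x = u (conj x)⁻¹) (k : Fin 3) :
    (z * liftDeriv u k z).re = 0 := by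
  have hz0 : z ≠ 0 := by rintro rfl; simp at hz
  have h1 : z * conj z = 1 := by rw [Complex.mul_conj, Complex.normSq_eq_norm_sq, hz]; simp
  have h2 : (conj z)⁻¹ = z := inv_eq_of_mul_eq_one_left h1
  have h3 := liftDeriv_of_inversion hz0 (by rwa [h2]) h k
  rw [h2, deriv_inv] at h3
  have h4 : z * liftDeriv u k z = -conj (z * liftDeriv u k z) := by
    conv_lhs => rw [h3]
    have h5 : conj z = z⁻¹ := eq_inv_of_mul_eq_one_right h1
    rw [map_mul, h5]
    field_simp
  have h6 := congrArg Complex.re h4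
  rw [Complex.neg_re, Complex.conj_re] at h6
  linarith

/-- Supplies the mirror image of an umbilic: two conjugations together with the holomorphic
coordinate change `x ↦ 1 / x` preserve parallelism. -/
lemma parallel_of_inversion {u : ℂ → R31} {z : ℂ} (hz : z ≠ 0) (hu : ∀ᶠ x in 𝓝 z, IsNullLift u x)
    (h : ∀ᶠ x in 𝓝 (conj z)⁻¹, u x = u (conj x)⁻¹)
    (hp : ∃ a, ∀ k, deriv (liftDeriv u k) z = a * liftDeriv u k z) :
    ∃ a, ∀ k, deriv (liftDeriv u k) (conj z)⁻¹ = a * liftDeriv u k (conj z)⁻¹ := by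
  have hz' : conj z ≠ 0 := (map_ne_zero _).2 hz
  have hw : (conj z)⁻¹ ≠ 0 := inv_ne_zero hz'
  have hd : ∀ k, HasDerivAt (liftDeriv u k) (deriv (liftDeriv u k) z) z := fun k =>
    (hu.self_of_nhds.analytic k).differentiableAt.hasDerivAt
  have hψ : ∀ k, HasDerivAt (fun y => conj (liftDeriv u k (conj y)))
      (conj (deriv (liftDeriv u k) z)) (conj z) := fun k => (hd k).conj_conj
  refine (exists_parallel_comp (Q := fun k y => conj (liftDeriv u k (conj y)))
    (μ := fun x => x⁻¹) (analyticAt_inv hw) ?_ ?_ ?_).2 ?_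
  · rw [deriv_inv]; exact neg_ne_zero.2 (inv_ne_zero (pow_ne_zero 2 hw))
  · intro k
    rw [inv_inv]
    exact (hψ k).differentiableAt
  · have hc : ContinuousAt (fun x : ℂ => (conj x)⁻¹) (conj z)⁻¹ :=
      (Complex.continuous_conj.continuousAt).inv₀ ((map_ne_zero _).2 hw)
    have e1 : (conj (conj z)⁻¹)⁻¹ = z := by simp
    have ht : Tendsto (fun x : ℂ => (conj x)⁻¹) (𝓝 (conj z)⁻¹) (𝓝 z) := by
      have := hc.tendsto
      rwa [e1] at this
    filter_upwards [h.eventually_nhds, ht.eventually hu, isOpen_ne.mem_nhds hw]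
      with x hx hx' hx0 k
    rw [liftDeriv_of_inversion hx0 hx'.diff.self_of_nhds hx k, map_inv₀]
  · obtain ⟨a, ha⟩ := hp
    refine ⟨conj a, fun k => ?_⟩
    rw [inv_inv, (hψ k).deriv, ha, map_mul, Complex.conj_conj]

end

/-! ### Weakly complete ends on the fold circle. -/

section

open Metric (ball closedBall)

/-- The Gauss map is meromorphic in every coordinate of the sphere. -/
lemma meromorphicAt_gaussLoc_smul {f : Sphere → R31} {E : Finset Sphere} (hf : IsMaxface f E)
    (M : GL (Fin 2) ℂ) {e : ℂ}
    (hg : MeromorphicAt (gaussLoc (loc f (M • (e : Sphere)))) (coordAt (M • (e : Sphere))))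
    (hE : ∀ᶠ z : ℂ in 𝓝[≠] e, M • (z : Sphere) ∉ E) :
    MeromorphicAt (gaussLoc fun w : ℂ => f (M • (w : Sphere))) e := by
  obtain ⟨μ, hμ, hμ', hμc, hM⟩ := exists_mobius_coord M (e : Sphere)
  rw [coordAt_coe] at *
  rw [← hμc] at hg
  refine (hg.comp_analyticAt hμ).congr ?_
  filter_upwards [hE, hM.eventually_nhds.filter_mono nhdsWithin_le_nhds,
    (hμ.deriv.continuousAt.eventually_ne hμ').filter_mono nhdsWithin_le_nhds,
    hμ.eventually_analyticAt.filter_mono nhdsWithin_le_nhds] with z hz hMz hμz hza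
  have hz1 : paramAt (M • (e : Sphere)) (μ z) ∉ E := by
    rw [← hMz.self_of_nhds]; exact hz
  have hv := hf.isNullLift_paramAt hz1
  have h := fun k => liftDeriv_comp (u := fun w : ℂ => f (M • (w : Sphere)))
    (v := loc f (M • (e : Sphere))) hv.diff.self_of_nhds hza.differentiableAt (hMz.mono fun x hx => by
      have hx' : M • (x : Sphere) = paramAt (M • (e : Sphere)) (μ x) := hx
      rw [hx']; rfl) k
  simp only [Function.comp_apply, gaussLoc, h]
  rw [← mul_assoc, ← sub_mul, ← neg_mul, mul_div_mul_right _ _ hμz]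

/-- A pole would make `|G|` tend to infinity, although it equals `1` along the circle. The value of
the extension follows by continuity. -/
lemma exists_unimodular_extension {G : ℂ → ℂ} {e : ℂ} (hG : MeromorphicAt G e) (he : ‖e‖ = 1)
    (h : ∀ᶠ z in 𝓝[≠] e, ‖z‖ = 1 → ‖G z‖ = 1) :
    ∃ g, AnalyticAt ℂ g e ∧ ‖g e‖ = 1 ∧ G =ᶠ[𝓝[≠] e] g := by
  have hfreq : ∃ᶠ z in 𝓝[≠] e, ‖G z‖ = 1 :=
    ((frequently_norm_eq_one he).and_eventually h).mono fun z hz => hz.2 hz.1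
  have h0 : 0 ≤ meromorphicOrderAt G e := by
    by_contra! hlt
    have h1 := tendsto_norm_atTop_iff_cobounded.2 (tendsto_cobounded_of_meromorphicOrderAt_neg hlt)
    obtain ⟨z, hz1, hz2⟩ := (hfreq.and_eventually (h1.eventually (eventually_gt_atTop 1))).exists
    exact hz2.ne' hz1
  obtain ⟨g, hg, hGg⟩ := hG.meromorphicOrderAt_nonneg_iff.1 h0
  refine ⟨g, hg, ?_, hGg⟩
  by_contra hne
  have h2 : ∀ᶠ z in 𝓝[≠] e, ‖g z‖ ≠ 1 :=
    (hg.continuousAt.norm.eventually_ne hne).filter_mono nhdsWithin_le_nhds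
  obtain ⟨z, hz1, hz2, hz3⟩ := (hfreq.and_eventually (h2.and hGg)).exists
  exact hz2 (hz3 ▸ hz1)

/-- The behaviour of a weakly complete maxface at an end on the fold circle. -/
theorem exists_end_expansion {f : Sphere → R31} {E : Finset Sphere} (hf : IsMaxface f E)
    (hcomplete : IsWeaklyComplete f E) (M : GL (Fin 2) ℂ) {e : ℂ} (he : ‖e‖ = 1)
    (heE : M • (e : Sphere) ∈ E)
    (hg : MeromorphicAt (gaussLoc (loc f (M • (e : Sphere)))) (coordAt (M • (e : Sphere))))
    (hE : ∀ᶠ z : ℂ in 𝓝[≠] e, M • (z : Sphere) ∉ E)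
    (hre : ∀ z : ℂ, ‖z‖ = 1 → M • (z : Sphere) ∉ E → ∀ k,
      (z * liftDeriv (fun w : ℂ => f (M • (w : Sphere))) k z).re = 0) :
    ∃ (b : ℂ → ℂ) (ψ : ℂ → Fin 3 → ℂ), AnalyticAt ℂ b e ∧ b e = 0 ∧
      (∀ k, AnalyticAt ℂ (fun w => ψ w k) e) ∧ (∃ k, ψ e k ≠ 0) ∧ lorentzC (ψ e) (ψ e) = 0 ∧
      lorentzC (ψ e) (fun k => conj (ψ e k)) = 0 ∧ ∀ᶠ z in 𝓝[≠] e, ∀ k,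
        b z * liftDeriv (fun w : ℂ => f (M • (w : Sphere))) k z = ψ z k := by
  set u : ℂ → R31 := fun w => f (M • (w : Sphere)) with hu
  set X : ℂ → ℂ := fun z => liftDeriv u 1 z - Complex.I * liftDeriv u 2 z with hX
  set Y : ℂ → ℂ := fun z => liftDeriv u 1 z + Complex.I * liftDeriv u 2 z with hY
  have hnull : ∀ z : ℂ, M • (z : Sphere) ∉ E →
      lorentzC (fun k => liftDeriv u k z) (fun k => liftDeriv u k z) = 0 := by
    intro z hz
    have := (exists_coord_relation hf M hz).1.null.self_of_nhds
    simp only [lorentzC]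
    linear_combination this
  have hXY : ∀ z : ℂ, M • (z : Sphere) ∉ E → X z * Y z = liftDeriv u 0 z ^ 2 := by
    intro z hz
    have := hnull z hz
    rwa [lorentzC_self_eq, sub_eq_zero] at this
  obtain ⟨g, hga, hg1, hgG⟩ := exists_unimodular_extension (meromorphicAt_gaussLoc_smul hf M hg hE)
    he (hE.mono fun z hz hz1 => by
      have h1 : ‖X z‖ = ‖Y z‖ := norm_eq_of_re_mul_eq_zero hz1 (hre z hz1 hz)
      have h2 : X z ≠ 0 := by
        intro h2
        obtain ⟨k, hk⟩ := exists_liftDeriv_ne_zero hf M hz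
        refine hk (eq_zero_of_isotropic (hnull z hz) h2 ?_ k)
        rw [h2, norm_zero, eq_comm, norm_eq_zero] at h1
        exact h1
      have h3 := congrArg norm (hXY z hz)
      rw [norm_mul, ← h1, norm_pow, ← pow_two,
        pow_left_inj₀ (norm_nonneg _) (norm_nonneg _) two_ne_zero] at h3
      change ‖-(liftDeriv u 0 z) / X z‖ = 1
      rw [norm_div, norm_neg, ← h3, div_self (norm_ne_zero_iff.2 h2)])
  have hev : ∀ᶠ z : ℂ in 𝓝[≠] e, M • (z : Sphere) ∉ E ∧ X z ≠ 0 ∧ liftDeriv u 0 z = -(g z * X z) ∧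
      Y z = g z ^ 2 * X z ∧ ‖g z‖ ≤ 2 := by
    have h1 : ∀ᶠ z in 𝓝[≠] e, ‖g z‖ < 2 := (hga.continuousAt.norm.eventually
      (gt_mem_nhds (by simp only [hg1]; norm_num))).filter_mono nhdsWithin_le_nhds
    have h2 : ∀ᶠ z in 𝓝[≠] e, g z ≠ 0 := (hga.continuousAt.eventually_ne
      (by rw [← norm_ne_zero_iff, hg1]; exact one_ne_zero)).filter_mono nhdsWithin_le_nhds
    filter_upwards [hE, hgG, h1, h2] with z hz hgz h1 h2
    have hgz' : -(liftDeriv u 0 z) / X z = g z := hgz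
    have hX0 : X z ≠ 0 := by
      intro h0
      rw [h0, div_zero] at hgz'
      exact h2 hgz'.symm
    have h0 : liftDeriv u 0 z = -(g z * X z) := by
      rw [← hgz', div_mul_cancel₀ _ hX0, neg_neg]
    refine ⟨hz, hX0, h0, ?_, h1.le⟩
    apply mul_left_cancel₀ hX0
    rw [hXY z hz, h0]; ring
  obtain ⟨R, hR, hball⟩ := Metric.mem_nhdsWithin_iff.1 hev
  have hball' : ∀ z ∈ ball e R \ {e}, M • (z : Sphere) ∉ E ∧ X z ≠ 0 ∧
      liftDeriv u 0 z = -(g z * X z) ∧ Y z = g z ^ 2 * X z ∧ ‖g z‖ ≤ 2 := fun z hz => hball hz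
  obtain ⟨b, hb, hb0, hbX⟩ := exists_analyticAt_inv_of_isCompleteAt (a := X) hR
    (fun z hz => by
      have h := (exists_coord_relation hf M (hball' z hz).1).1.analytic
      have h1 := h 1
      have h2 := h 2
      have h3 : AnalyticAt ℂ X z := by simp only [hX]; fun_prop
      exact h3.differentiableAt.differentiableWithinAt)
    (fun z hz => (hball' z hz).2.1) (by
      intro y hy hye
      obtain ⟨hpath, hlen⟩ := isC1Path_smul hf M (y := y) fun t ht =>
        ⟨(hball' _ (hy t ht).1).1, (hy t ht).2⟩
      have hdiv : IsDivergent E fun t => M • (y t : Sphere) := by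
        intro K hK hKE
        have h1 : Tendsto (fun t => M • (y t : Sphere)) (𝓝[<] 1) (𝓝 (M • (e : Sphere))) :=
          ((continuous_smul_sphere M).tendsto _).comp
            ((OnePoint.continuous_coe.tendsto e).comp hye)
        exact h1.eventually (hK.isClosed.isOpen_compl.mem_nhds fun h => hKE h heE)
      have htop := hcomplete _ hpath hdiv
      rw [hlen] at htop
      -- Since `|g| ≤ 2` near `e`, the density `(1 + |g|²) |X| / 2` is at most `5 / 2` times `|X|`,
      -- so completeness of `ds_E` passes to `|X| |dz|`.
      by_contra hne
      have h2 : ∫⁻ t in Ico (0 : ℝ) 1, ENNReal.ofReal (densityE u (y t) * ‖deriv y t‖) ≤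
          ∫⁻ t in Ico (0 : ℝ) 1, ENNReal.ofReal (5 / 2) * ENNReal.ofReal (‖X (y t)‖ * ‖deriv y t‖) := by
        refine MeasureTheory.setLIntegral_mono' measurableSet_Ico fun t ht => ?_
        rw [← ENNReal.ofReal_mul (by norm_num), ← mul_assoc]
        refine ENNReal.ofReal_le_ofReal (mul_le_mul_of_nonneg_right ?_ (norm_nonneg _))
        obtain ⟨-, -, -, h3, h4⟩ := hball' _ (hy t ht).1
        change (‖X (y t)‖ + ‖Y (y t)‖) / 2 ≤ _
        rw [h3, norm_mul, norm_pow]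
        have h5 : ‖g (y t)‖ ^ 2 ≤ 4 := by nlinarith [norm_nonneg (g (y t))]
        nlinarith [mul_le_mul_of_nonneg_right h5 (norm_nonneg (X (y t)))]
      rw [MeasureTheory.lintegral_const_mul' _ _ ENNReal.ofReal_ne_top, htop, top_le_iff] at h2
      exact ENNReal.mul_ne_top ENNReal.ofReal_ne_top hne h2)
  -- Multiplication by `b = 1 / X` leaves the null vector with Gauss map `g`, which is regular and
  -- nonzero at the end because `|g e| = 1`.
  refine ⟨b, fun z => ![-g z, (1 + g z ^ 2) / 2, Complex.I * (1 - g z ^ 2) / 2], hb, hb0, ?_,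
    ⟨0, ?_⟩, ?_, ?_, ?_⟩
  · intro k
    fin_cases k
    · exact hga.neg
    · exact (analyticAt_const.add (hga.pow 2)).div_const
    · exact (analyticAt_const.mul (analyticAt_const.sub (hga.pow 2))).div_const
  · simp only [Matrix.cons_val_zero]
    rw [← norm_ne_zero_iff, norm_neg, hg1]
    exact one_ne_zero
  · simp only [lorentzC, Matrix.cons_val_zero, Matrix.cons_val_one, Matrix.cons_val]
    linear_combination (1 - g e ^ 2) ^ 2 / 4 * Complex.I_sq
  · rw [lorentzC_conj_eq_zero_iff]
    · simp only [Matrix.cons_val_one, Matrix.cons_val]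
      have e1 : (1 + g e ^ 2) / 2 - Complex.I * (Complex.I * (1 - g e ^ 2) / 2) = 1 := by
        linear_combination -(1 - g e ^ 2) / 2 * Complex.I_sq
      have e2 : (1 + g e ^ 2) / 2 + Complex.I * (Complex.I * (1 - g e ^ 2) / 2) = g e ^ 2 := by
        linear_combination (1 - g e ^ 2) / 2 * Complex.I_sq
      rw [e1, e2, norm_pow, hg1]
      simp
    · simp only [lorentzC, Matrix.cons_val_zero, Matrix.cons_val_one, Matrix.cons_val]
      linear_combination (1 - g e ^ 2) ^ 2 / 4 * Complex.I_sq
  · filter_upwards [hev, hbX] with z hz hbz k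
    obtain ⟨-, -, h0, hYz, -⟩ := hz
    simp only [hX] at hbz h0 hYz
    simp only [hY] at hYz
    fin_cases k
    · change b z * liftDeriv u 0 z = -g z
      rw [h0]
      linear_combination -g z * hbz
    · change b z * liftDeriv u 1 z = (1 + g z ^ 2) / 2
      linear_combination (1 + g z ^ 2) / 2 * hbz + b z / 2 * hYz
    · change b z * liftDeriv u 2 z = Complex.I * (1 - g z ^ 2) / 2
      linear_combination Complex.I * (1 - g z ^ 2) / 2 * hbz - Complex.I * b z / 2 * hYz +
        b z * liftDeriv u 2 z * Complex.I_sq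

end

/-! ### From Kobayashi surfaces to data on the disc. -/

section

open Metric (ball closedBall)

/-- A Kobayashi surface with at most two umbilics has a coordinate in which the involution is the
inversion in the unit circle and no point of the unit disc other than the centre is an umbilic. -/
theorem IsKobayashi.exists_discData {f : Sphere → R31} {E : Finset Sphere} (hf : IsKobayashi f E)
    (humb : {p | p ∉ E ∧ IsUmbilic f p}.encard ≤ 2) :
    ∃ (M : GL (Fin 2) ℂ) (E' : Finset ℂ), (∀ z : ℂ, z ∈ E' ↔ M • (z : Sphere) ∈ E) ∧
      M • (∞ : Sphere) ∉ E ∧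
      DiscData (fun z k => liftDeriv (fun w : ℂ => f (M • (w : Sphere))) k z) E' := by
  have hm := hf.maxface
  obtain ⟨p, hp⟩ := hm.nonempty
  obtain ⟨I, hI, hinv, hfI, hEI, hfold, hreg⟩ := hf.symm
  -- The future centre of the disc is an umbilic whenever one exists. It is not fixed by `I`,
  -- because fixed points off the ends are singular and umbilics are not.
  obtain ⟨q, hq, hqu⟩ : ∃ q, I q ≠ q ∧
      ((∃ x, x ∉ E ∧ IsUmbilic f x) → q ∉ E ∧ IsUmbilic f q) := by
    by_cases hx : ∃ x, x ∉ E ∧ IsUmbilic f x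
    · obtain ⟨x, hxE, hxu⟩ := hx
      exact ⟨x, fun h => hxu.1 ((hfold x hxE).1 h).1, fun _ => ⟨hxE, hxu⟩⟩
    · obtain ⟨q, hq⟩ := exists_ne_of_isAntiHolo hI hinv (hEI p hp)
      exact ⟨q, hq, fun h => absurd h hx⟩
  obtain ⟨M, hM1, hM0, hMinf, hIM⟩ := exists_circle_coord hI hinv (hEI p hp) hq
  have hinj : ∀ x y : ℂ, M • (x : Sphere) = M • (y : Sphere) → x = y := fun x y h =>
    OnePoint.coe_injective (smul_left_cancel M h)
  have hfix : ∀ z : ℂ, I (M • (z : Sphere)) = M • (z : Sphere) ↔ ‖z‖ = 1 := by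
    intro z
    by_cases hz : z = 0
    · subst hz
      rw [hMinf]
      simp only [norm_zero, zero_ne_one, iff_false]
      intro h
      exact OnePoint.infty_ne_coe _ (smul_left_cancel M h)
    · rw [hIM z hz]
      constructor
      · intro h
        have h1 := hinj _ _ h
        have h2 : z * conj z = 1 := by
          have h3 := inv_mul_cancel₀ ((map_ne_zero (starRingEnd ℂ)).2 hz)
          rwa [h1] at h3
        rw [Complex.mul_conj, Complex.normSq_eq_norm_sq] at h2
        have h3 : ‖z‖ ^ 2 = 1 := by exact_mod_cast h2
        exact (pow_eq_one_iff_of_nonneg (norm_nonneg z) two_ne_zero).1 h3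
      · intro h
        have h1 : z * conj z = 1 := by rw [Complex.mul_conj, Complex.normSq_eq_norm_sq, h]; simp
        rw [inv_eq_of_mul_eq_one_left h1]
  set u : ℂ → R31 := fun w => f (M • (w : Sphere)) with hu
  set E' : Finset ℂ := E.preimage (fun z : ℂ => M • (z : Sphere))
    (fun x _ y _ h => hinj x y h) with hE'
  have hmem : ∀ z : ℂ, z ∈ E' ↔ M • (z : Sphere) ∈ E := fun z => Finset.mem_preimage
  have hnorm : ∀ z : ℂ, M • (z : Sphere) ∈ E → ‖z‖ = 1 := fun z hz => (hfix z).1 (hEI _ hz)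
  have hlift : ∀ z : ℂ, z ∉ E' → IsNullLift u z := fun z hz =>
    (exists_coord_relation hm M fun h => hz ((hmem z).2 h)).1
  have hnotE : ∀ z : ℂ, ‖z‖ ≠ 1 → M • (z : Sphere) ∉ E := fun z hz h => hz (hnorm z h)
  have hns : ∀ z : ℂ, ‖z‖ ≠ 1 → ¬ IsSingular f (M • (z : Sphere)) := fun z hz =>
    hreg _ (hnotE z hz) fun h => hz ((hfix z).1 h)
  have hopen : ∀ z : ℂ, z ∉ E' → ∀ᶠ x in 𝓝 z, x ∉ E' := fun z hz =>
    E'.finite_toSet.isClosed.isOpen_compl.mem_nhds hz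
  have hrefl : ∀ z : ℂ, z ≠ 0 → z ∉ E' → ∀ᶠ x in 𝓝 z, u x = u (conj x)⁻¹ := by
    intro z hz hzE
    filter_upwards [hopen z hzE, isOpen_ne.mem_nhds hz] with x hx hx0
    have hx' : M • (x : Sphere) ∉ E := fun h => hx ((hmem x).2 h)
    have h1 := hfI _ hx'
    rw [hIM x hx0] at h1
    exact h1.symm
  have hre : ∀ z : ℂ, ‖z‖ = 1 → M • (z : Sphere) ∉ E → ∀ k, (z * liftDeriv u k z).re = 0 := by
    intro z hz hzE k
    have hz0 : z ≠ 0 := by rintro rfl; simp at hz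
    have hzE' : z ∉ E' := fun h => hzE ((hmem z).1 h)
    exact re_mul_liftDeriv_eq_zero hz (hlift z hzE').diff.self_of_nhds (hrefl z hz0 hzE') k
  refine ⟨M, E', hmem, fun h => ?_, ?_⟩
  · have h1 := hEI _ h
    rw [← hMinf, hinv] at h1
    rw [hMinf] at h1
    exact OnePoint.coe_ne_infty _ (smul_left_cancel M h1)
  · refine ⟨(hmem 1).2 (hM1 ▸ hp), fun e he => hnorm e ((hmem e).1 he),
      fun z _ hzE k => (hlift z hzE).analytic k, fun z _ hzE => ?_,
      fun z _ hzE => exists_liftDeriv_ne_zero hm M fun h => hzE ((hmem z).2 h),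
      fun z hz hzE k => hre z hz (fun h => hzE ((hmem z).2 h)) k, fun z hz => ?_,
      fun z hz hz0 hpar => ?_, fun e he => ?_⟩
    · have := (hlift z hzE).null.self_of_nhds
      simp only [lorentzC]
      linear_combination this
    · have hz1 : ‖z‖ ≠ 1 := (mem_ball_zero_iff.1 hz).ne
      have hzE := hnotE z hz1
      have hnull := (exists_coord_relation hm M hzE).1.null.self_of_nhds
      have h1 : lorentzC (fun k => liftDeriv u k z) (fun k => liftDeriv u k z) = 0 := by
        simp only [lorentzC]
        linear_combination hnull
      exact fun h => norm_ne_of_not_isSingular hm M hzE (hns z hz1) ((lorentzC_conj_eq_zero_iff h1).1 h)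
    · have hz1 : ‖z‖ < 1 := mem_ball_zero_iff.1 hz
      have hzp : 0 < ‖z‖ := norm_pos_iff.2 hz0
      have hw1 : 1 < ‖(conj z)⁻¹‖ := by
        rw [norm_inv, Complex.norm_conj]
        exact (one_lt_inv₀ hzp).2 hz1
      have hzE := hnotE z hz1.ne
      have hwE := hnotE _ hw1.ne'
      have hzE' : z ∉ E' := fun h => hzE ((hmem z).1 h)
      have hwE' : (conj z)⁻¹ ∉ E' := fun h => hwE ((hmem _).1 h)
      have hw0 : (conj z)⁻¹ ≠ 0 := inv_ne_zero ((map_ne_zero _).2 hz0)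
      have hzu : IsUmbilic f (M • (z : Sphere)) :=
        isUmbilic_smul_of_parallel hm M hzE (hns z hz1.ne) hpar
      have hwu : IsUmbilic f (M • (((conj z)⁻¹ : ℂ) : Sphere)) :=
        isUmbilic_smul_of_parallel hm M hwE (hns _ hw1.ne') (parallel_of_inversion hz0
          ((hopen z hzE').mono fun x hx => hlift x hx) (hrefl _ hw0 hwE') hpar)
      have h0u := hqu ⟨_, hzE, hzu⟩
      rw [← hM0] at h0u
      -- A critical point `z ≠ 0` in the disc would give three distinct umbilics: the centre, `z`,
      -- and its mirror image outside the closed disc.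
      have hsub : ({M • ((0 : ℂ) : Sphere), M • (z : Sphere), M • (((conj z)⁻¹ : ℂ) : Sphere)} :
          Set Sphere) ⊆ {p | p ∉ E ∧ IsUmbilic f p} := by
        rintro x (rfl | rfl | rfl)
        exacts [h0u, ⟨hzE, hzu⟩, ⟨hwE, hwu⟩]
      have h3 := (encard_le_encard hsub).trans humb
      rw [encard_eq_three.2 ⟨_, _, _, fun h => hz0 (hinj _ _ h).symm,
        fun h => hw0 (hinj _ _ h).symm, fun h => ?_, rfl⟩] at h3
      · exact absurd h3 (by norm_num)
      · have h4 := hinj _ _ h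
        rw [← h4] at hw1
        exact hw1.not_gt hz1
    · have heE := (hmem e).1 he
      refine exists_end_expansion hm hf.complete M (hnorm e heE) heE (hf.gauss _ heE) ?_ hre
      exact (eventually_notMem_finset E' e).mono fun z hz h => hz ((hmem z).2 h)

end

/-! ### Analytic continuation beyond the disc, and conclusion. -/

section

open Metric (ball closedBall)

lemma analyticAt_weierstrassForm {k : ℕ} {m : ℕ} {α : Fin m → ℝ} {z : ℂ} (h : endPoly α z ≠ 0)
    (j : Fin 3) :
    AnalyticAt ℂ (fun w => weierstrassForm (fun z => z ^ k) (principalForm α) w j) z := by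
  have h1 := analyticAt_principalForm α h
  fin_cases j
  · change AnalyticAt ℂ (fun w : ℂ => -2 * w ^ k * principalForm α w) z
    fun_prop
  · change AnalyticAt ℂ (fun w : ℂ => (1 + (w ^ k) ^ 2) * principalForm α w) z
    fun_prop
  · change AnalyticAt ℂ (fun w : ℂ => Complex.I * (1 - (w ^ k) ^ 2) * principalForm α w) z
    fun_prop

/-- If the differentials of `c A u` and of the Weierstrass data agree on the disc, then they agree
everywhere. -/
lemma cmul_liftDeriv_eq_weierstrassForm {u : ℂ → R31} {A : Matrix (Fin 3) (Fin 3) ℝ} {c : ℝ}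
    {k m : ℕ} {α : Fin m → ℝ} (hu : ∀ z, endPoly α z ≠ 0 → IsNullLift u z)
    (h : ∀ z ∈ ball (0 : ℂ) 1, ∀ j, (c : ℂ) * cmul A (fun i => liftDeriv u i z) j =
      weierstrassForm (fun z => z ^ k) (principalForm α) z j) {z : ℂ} (hz : endPoly α z ≠ 0)
    (j : Fin 3) : (c : ℂ) * cmul A (fun i => liftDeriv u i z) j =
      weierstrassForm (fun z => z ^ k) (principalForm α) z j := by
  have hset : {z | endPoly α z ≠ 0} =
      ((Finset.univ.image fun j => Complex.exp (Complex.I * (α j : ℂ)) : Finset ℂ) : Set ℂ)ᶜ := by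
    ext w
    simp [endPoly_eq_zero_iff, eq_comm]
  -- The complement of a finite set in the plane is connected, so the identity theorem carries the
  -- equality across the fold circle.
  have hconn : IsPreconnected {z | endPoly α z ≠ 0} := by
    rw [hset]
    exact ((Finset.finite_toSet _).countable.isPathConnected_compl_of_one_lt_rank
      (by simp)).isConnected.isPreconnected
  have h0 : (0 : ℂ) ∈ {z | endPoly α z ≠ 0} := by
    intro h0
    obtain ⟨j, hj⟩ := (endPoly_eq_zero_iff α 0).1 h0
    exact Complex.exp_ne_zero _ hj.symm
  exact AnalyticOnNhd.eqOn_of_preconnected_of_eventuallyEq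
    (f := fun z => (c : ℂ) * cmul A (fun i => liftDeriv u i z) j)
    (g := fun z => weierstrassForm (fun z => z ^ k) (principalForm α) z j)
    (fun w hw => analyticAt_const.mul
      (analyticAt_cmul A (φ := fun z i => liftDeriv u i z) (hu w hw).analytic j))
    (fun w hw => analyticAt_weierstrassForm hw j) hconn h0
    (by
      filter_upwards [Metric.ball_mem_nhds (0 : ℂ) one_pos] with w hw
      exact h w hw j) hz

lemma IsNullLift.hasFDerivAt_mulVec {u : ℂ → R31} {z : ℂ} (hu : IsNullLift u z)
    (A : Matrix (Fin 3) (Fin 3) ℝ) (c : ℝ) (k : Fin 3) :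
    HasFDerivAt (fun w => (c • A.mulVec (u w)) k)
      (Complex.reCLM.comp (((c : ℂ) * cmul A (fun i => liftDeriv u i z) k) • (1 : ℂ →L[ℝ] ℂ))) z := by
  have h := fun i => hu.hasFDerivAt i
  have h1 := ((((h 0).const_mul (A k 0)).add ((h 1).const_mul (A k 1))).add
    ((h 2).const_mul (A k 2))).const_mul c
  have h2 : (fun w => (c • A.mulVec (u w)) k) =
      fun w => c * (A k 0 * u w 0 + A k 1 * u w 1 + A k 2 * u w 2) := by
    funext w
    rw [Pi.smul_apply, mulVec_fin_three, smul_eq_mul]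
  rw [h2]
  refine HasFDerivAt.congr_fderiv (f' := _) h1 (ContinuousLinearMap.ext fun a => ?_)
  simp [cmul]
  ring

end

end Maxface

end

theorem mainTheorem10 (f : Maxface.Sphere → Maxface.R31) (E : Finset Maxface.Sphere)
    (hf : Maxface.IsKobayashi f E)
    (humb : {p | p ∉ E ∧ Maxface.IsUmbilic f p}.encard ≤ 2) :
    ∃ (n : ℕ) (hn : 2 ≤ n) (α : Fin (2 * n) → ℝ),
      α ⟨0, by omega⟩ = 0 ∧ Monotone α ∧ (∀ j, α j < 2 * Real.pi) ∧
      Maxface.IsFoldType (fun z => z ^ (n - 1)) (Maxface.principalForm α) ∧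
      ∃ f₀ : Maxface.Sphere → Maxface.R31,
        Maxface.IsAssociated f₀ (fun z => z ^ (n - 1)) (Maxface.principalForm α) ∧
        Maxface.Homothetic f E f₀
          {p | Maxface.IsEnd (fun z => z ^ (n - 1)) (Maxface.principalForm α) p} := by
  obtain ⟨M, E', hmem, hinf, hdisc⟩ := hf.exists_discData humb
  obtain ⟨A, c, k, α, hA, hc, hk, hα0, hαm, hαl, hαE, hform⟩ := hdisc.exists_eq_weierstrassForm
  have hm := hf.maxface
  have hend : ∀ p, Maxface.IsEnd (fun z => z ^ k) (Maxface.principalForm α) p ↔ M • p ∈ E := by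
    intro p
    rw [Maxface.isEnd_principalForm_iff]
    induction p using OnePoint.rec with
    | infty => simp [hinf]
    | coe z => rw [← hmem, hαE]; simp only [OnePoint.coe_eq_coe]
  have hE' : ∀ z : ℂ, M • (z : Maxface.Sphere) ∈ E ↔ Maxface.endPoly α z = 0 := fun z => by
    rw [← hmem, hαE, Maxface.endPoly_eq_zero_iff]
  have hlift : ∀ z, Maxface.endPoly α z ≠ 0 →
      Maxface.IsNullLift (fun w : ℂ => f (M • (w : Maxface.Sphere))) z := fun z hz =>
    (Maxface.exists_coord_relation hm M fun h => hz ((hE' z).1 h)).1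
  -- The associated maxface is `f` itself, read in the coordinate `M` and moved by `c A`.
  -- Single-valuedness is therefore automatic, and the change of parameter is the inverse of `M`.
  refine ⟨k + 1, by omega, α, hα0, hαm, hαl, Maxface.isFoldType_principalForm hk α,
    fun p => c • A.mulVec (f (M • p)), ⟨fun p hp => ?_, fun z _ hz j => ?_⟩,
    (MulAction.toPerm M).symm, c, A.mulVecLin, 0, Maxface.isHolo_smul M⁻¹, Maxface.isHolo_smul M,
    fun p => ?_, hc, hA, fun p _ => ?_⟩
  · have h1 : ContinuousAt (fun p => f (M • p)) p :=
      ContinuousAt.comp (hm.continuousAt fun h => hp ((hend p).2 h))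
        (Maxface.continuous_smul_sphere M).continuousAt
    exact ((Continuous.matrix_mulVec continuous_const continuous_id).continuousAt.comp h1).const_smul c
  · have hz' : Maxface.endPoly α z ≠ 0 := fun h => Maxface.not_analyticAt_principalForm α h hz
    rw [Nat.add_sub_cancel, ← Maxface.cmul_liftDeriv_eq_weierstrassForm hlift hform hz' j]
    exact (hlift z hz').hasFDerivAt_mulVec A c j
  · refine Iff.trans ?_ (hend _).symm
    simp
  · simp
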